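/- Let $T>0$ and let $(\Omega,\mathcal F,(\mathcal F_t)_{t\in[0,T]},\mathbb P)$ be a filtered probability space satisfying the usual conditions; write $\mathbb E_t=\mathbb E[\,\cdot\mid\mathcal F_t]$. Let $\mathcal L^2$ (resp. $\mathcal S^2$) be the set of predictable processes $X$ with $\mathbb E[\int_0^TX_t^2dt]<\infty$ (resp. $\mathbb E[\sup_{t\le T}X_t^2]<\infty$), and let $\mathcal H^2$ be the set of semimartingales $S=M+A$ with $M$ a square-integrable martingale and $A$ (the drift of $S$) a predictable process with $A_0=0$ and square-integrable total variation. Processes in $\mathcal H^2$ are identified if they are indistinguishable, and trading strategies if they agree $dt\otimes d\mathbb P$-almost everywhere. Let $\mathcal A$ be a finite set of agents. Agent $a$ has mass $m(a)\in(0,\infty)$, risk tolerance $\rho^a>0$, target position $\xi^a\in\mathcal S^2$, and trading friction $\lambda^a\in[0,\infty]$, where $\lambda^a=\infty$ means that she cannot trade in the open market. Let $\lambda\ge0$ be the common price impact, with $\lambda+\lambda^a>0$ for all $a$ and $\lambda^a<\infty$ for at least one $a$. Let $\mathscr D_T\in L^2(\mathcal F_T)$ be the terminal dividend and $K^N\in\mathcal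 S^2$ the demand of noise traders. For $u^a\in\mathcal L^2$ put $U^a_t=\int_0^tu^a_sds$, $\bar u=\sum_{a}m(a)u^a$, $\bar U=\sum_a m(a)U^a$ and $\bar u^{-a}=\bar u-m(a)u^a$. Given $\bar u^{-a}$ and $S\in\mathcal H^2$ with drift $A$, agent $a$'s goal functional is $$J^a(K,u;\bar u^{-a},S)=\mathbb E\Big[\int_0^TK_t\,dA_t-\int_0^T\Big(\lambda\bar u^{-a}_tu_t+\big(\lambda m(a)+\tfrac12\lambda^a\big)u_t^2\Big)dt-\int_0^T\frac1{2\rho^a}\Big(\xi^a_t-K_t-\int_0^tu_sds\Big)^2dt\Big],$$ with $\infty\cdot0=0$. An equilibrium consists of a price $S\in\mathcal H^2$ with $S_T=\mathscr D_T$ and strategies $(K^a,u^a)_{a\in\mathcal A}\in(\mathcal S^2\times\mathcal L^2)^{\mathcal A}$ such that $K^N+\sum_am(a)K^a=0$ and, for each $a$, $(K^a,u^a)$ maximizes $J^a(\cdot,\cdot;\bar u^{-a},S)$ over $\mathcal S^2\times\mathcal L^2$. Set $\eta^a=1/(m(a)\lambda+\lambda^a)$ (so $\eta^a=0$ if $\lambda^a=\infty$),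 $\bar\eta=\sum_am(a)\eta^a$, $\eta=1/\lambda$, $\bar\rho=\sum_am(a)\rho^a$, $\bar\xi=\sum_am(a)\xi^a$ and $\Delta=\frac1{\bar\rho}\frac{\eta\bar\eta}{\eta+\bar\eta}$, read as $\Delta=\bar\eta/\bar\rho$ if $\lambda=0$. For $X\in\mathcal L^2$ let $$\mathbf U^\Delta_t(X)=\frac1\Delta\int_0^tk^\Delta(s,t)\,\mathbb E_s\Big[\int_s^Tk^\Delta(s,r)X_r\,dr\Big]ds,\qquad k^\Delta(t,s)=\frac{\Delta\cosh(\sqrt\Delta(T-s))}{\cosh(\sqrt\Delta(T-t))}.$$ Theorem. (i) There exists a unique equilibrium $(S,(K^a,u^a)_{a\in\mathcal A})$. (ii) The aggregate position in the open market is $\bar U_t=\mathbf U^\Delta_t(K^N+\bar\xi)$, $0\le t\le T$. The pair $(\bar u,\bar U)$ solves, with $X=K^N+\bar\xi$ and some square-integrable martingale $N$, the linear FBSDE $d\bar u_t=\Delta(\bar U_t-X_t)dt+dN_t$, $\bar u_T=0$, $d\bar U_t=\bar u_tdt$, $\bar U_0=0$. Agent $a$'s share is $U^a_t=\frac{\eta^a}{\bar\eta}\bar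 U_t$. (iii) The equilibrium price is $S_t=\mathbb E_t\big[\mathscr D_T-\int_t^T\mu_s\,ds\big]$ with $\mu_t=\frac1{\bar\rho}\big(\bar U_t-K^N_t-\bar\xi_t\big)$, and agent $a$'s optimal position in the dealer market is $$K^a_t=\xi^a_t-\frac{\eta^a}{\bar\eta}\bar U_t+\frac{\rho^a}{\bar\rho}\big(\bar U_t-K^N_t-\bar\xi_t\big),\qquad 0\le t\le T.$$ -/

import Mathlib

open MeasureTheory Set Filter Topology
open scoped NNReal ENNReal

namespace DealerMarket

noncomputable section

/-! Real-valued processes are functions `ℝ≥0 → Ω → ℝ` of which only the values on `[0, T]` matter,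
where `T` is the time horizon; a filtration on `[0, T]` is continued by `𝓕 t = 𝓕 T` for `t ≥ T`. -/

/-- Lebesgue measure on `[0, ∞)`. -/
def leb : Measure ℝ≥0 := (volume : Measure ℝ).comap (fun t : ℝ≥0 => (t : ℝ))

variable {Ω : Type*} {mΩ : MeasurableSpace Ω}

/-- The usual conditions: right-continuity, and completeness (every `P`-null set, measurable or
not, belongs to `𝓕 0`). -/
structure UsualConditions (𝓕 : Filtration ℝ≥0 mΩ) (P : Measure Ω) : Prop where
  rightCont : 𝓕.IsRightContinuous
  complete : ∀ s : Set Ω, P s = 0 → MeasurableSet[𝓕 0] s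

/-- Right-continuous paths with left limits. -/
def IsCadlag (f : ℝ≥0 → ℝ) : Prop :=
  ∀ t, ContinuousWithinAt f (Ici t) t ∧ ∃ l, Tendsto f (𝓝[<] t) (𝓝 l)

/-- The measure `dt ⊗ dP` on `[0, T] × Ω`. -/
def timeProd (P : Measure Ω) (T : ℝ≥0) : Measure (ℝ≥0 × Ω) :=
  (leb.restrict (Iic T)).prod P

/-- `𝓛²`: predictable processes with `E[∫₀ᵀ X_t² dt] < ∞`. -/
def MemL2 (𝓕 : Filtration ℝ≥0 mΩ) (P : Measure Ω) (T : ℝ≥0) (X : ℝ≥0 → Ω → ℝ) : Prop :=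
  IsStronglyPredictable 𝓕 X ∧ MemLp (Function.uncurry X) 2 (timeProd P T)

/-- `𝓢²`: predictable processes with `E[sup_{t ≤ T} X_t²] < ∞`; that is, `sup_{t ≤ T} |X_t|` is
dominated by a square-integrable random variable. -/
def MemS2 (𝓕 : Filtration ℝ≥0 mΩ) (P : Measure Ω) (T : ℝ≥0) (X : ℝ≥0 → Ω → ℝ) : Prop :=
  IsStronglyPredictable 𝓕 X ∧
    ∃ Z : Ω → ℝ, MemLp Z 2 P ∧ ∀ᵐ ω ∂P, ∀ t ≤ T, |X t ω| ≤ Z ω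

/-- `𝓜²`: square-integrable (càdlàg) martingales on `[0, T]`. -/
structure MemM2 (𝓕 : Filtration ℝ≥0 mΩ) (P : Measure Ω) (T : ℝ≥0) (M : ℝ≥0 → Ω → ℝ) : Prop where
  martingale : Martingale M 𝓕 P
  cadlag : ∀ᵐ ω ∂P, IsCadlag fun t => M t ω
  sq_integrable : MemLp (M T) 2 P

/-- Predictable càdlàg processes started at `0` whose total variation on `[0, T]` is
square-integrable (dominated by a square-integrable random variable). -/
structure IsDrift (𝓕 : Filtration ℝ≥0 mΩ) (P : Measure Ω) (T : ℝ≥0) (A : ℝ≥0 → Ω → ℝ) :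
    Prop where
  predictable : IsStronglyPredictable 𝓕 A
  cadlag : ∀ᵐ ω ∂P, IsCadlag fun t => A t ω
  zero : ∀ᵐ ω ∂P, A 0 ω = 0
  variation : ∃ Z : Ω → ℝ, MemLp Z 2 P ∧
    ∀ᵐ ω ∂P, eVariationOn (fun t => A t ω) (Iic T) ≤ ENNReal.ofReal (Z ω)

/-- `S = M + A` on `[0, T]` is the canonical decomposition of `S ∈ 𝓗²` (the initial value is
part of `M`). It is unique up to indistinguishability. -/
structure IsDecomposition (𝓕 : Filtration ℝ≥0 mΩ) (P : Measure Ω) (T : ℝ≥0)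
    (S M A : ℝ≥0 → Ω → ℝ) : Prop where
  mart : MemM2 𝓕 P T M
  drift : IsDrift 𝓕 P T A
  eq : ∀ᵐ ω ∂P, ∀ t ≤ T, S t ω = M t ω + A t ω

/-- `𝓗²`: semimartingales whose local martingale part is a square-integrable martingale and whose
predictable finite-variation part has square-integrable total variation. -/
def MemH2 (𝓕 : Filtration ℝ≥0 mΩ) (P : Measure Ω) (T : ℝ≥0) (S : ℝ≥0 → Ω → ℝ) : Prop :=
  ∃ M A, IsDecomposition 𝓕 P T S M A

open scoped Classical in
/-- The pathwise Lebesgue–Stieltjes integral `∫_{(0,T]} k dα` against a path `α` of bounded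
variation on `[0, T]`. -/
def stieltjesIntegral (T : ℝ≥0) (k α : ℝ≥0 → ℝ) : ℝ :=
  if h : BoundedVariationOn (fun t => α (min t T)) univ then
    ∫ᵛ t in Ioc 0 T, k t ∂•h.vectorMeasure
  else 0

/-- The position `U_t = ∫₀ᵗ u_s ds` accumulated at trading rate `u`. -/
def position (u : ℝ≥0 → Ω → ℝ) (t : ℝ≥0) (ω : Ω) : ℝ := ∫ s in Iic t, u s ω ∂leb

/-- The constants of the model, for agents indexed by `𝒜`: the horizon `T`, the masses `m`,
the risk tolerances `ρ`, the common impact parameter `lam`, and the idiosyncratic friction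
parameters `lamA`, where `lamA a = ∞` means that agent `a` has no access to the open market.
Frictionless trading in the open market is ruled out, and some agent can trade there. -/
structure Params (𝒜 : Type*) where
  T : ℝ≥0
  T_pos : 0 < T
  m : 𝒜 → ℝ
  m_pos : ∀ a, 0 < m a
  ρ : 𝒜 → ℝ
  ρ_pos : ∀ a, 0 < ρ a
  lam : ℝ
  lam_nonneg : 0 ≤ lam
  lamA : 𝒜 → ℝ≥0∞
  friction : ∀ a, 0 < ENNReal.ofReal lam + lamA a
  access : ∃ a, lamA a < ∞

variable {𝒜 : Type*}

/-- Agent `a`'s goal functional `J^a(K, u; v, S)`, where `ξ` is the agent's target position, `v`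
the other agents' aggregate trading rate, and `A` the drift of the price `S`. The idiosyncratic
cost `E[∫₀ᵀ (λ^a / 2) u_t² dt]` is computed in `[0, ∞]` with `∞ * 0 = 0`, so for `λ^a = ∞` the goal
is `-∞` unless `u = 0`. -/
def Params.goal (p : Params 𝒜) (P : Measure Ω) (a : 𝒜) (ξ v A K u : ℝ≥0 → Ω → ℝ) : EReal :=
  (((∫ ω, (stieltjesIntegral p.T (fun t => K t ω) (fun t => A t ω) -
          ∫ t in Iic p.T, (p.lam * v t ω * u t ω + p.lam * p.m a * u t ω ^ 2) ∂leb) ∂P) -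
      ∫ ω, (∫ t in Iic p.T,
        1 / (2 * p.ρ a) * (ξ t ω - K t ω - position u t ω) ^ 2 ∂leb) ∂P : ℝ) : EReal) -
    ((∫⁻ ω, ∫⁻ t in Iic p.T, p.lamA a / 2 * ENNReal.ofReal (u t ω ^ 2) ∂leb ∂P : ℝ≥0∞) : EReal)

/-- The price elasticity `η^a = 1 / (m(a) λ + λ^a)`, which is `0` for `λ^a = ∞`. -/
def Params.η (p : Params 𝒜) (a : 𝒜) : ℝ :=
  (ENNReal.ofReal (p.m a * p.lam) + p.lamA a)⁻¹.toReal

variable [Fintype 𝒜]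

/-- The aggregate `∑ m(a) X^a`. -/
def Params.agg (p : Params 𝒜) (X : 𝒜 → ℝ≥0 → Ω → ℝ) (t : ℝ≥0) (ω : Ω) : ℝ :=
  ∑ a, p.m a * X a t ω

/-- `η̄ = ∑ m(a) η^a`. -/
def Params.ηbar (p : Params 𝒜) : ℝ := ∑ a, p.m a * p.η a

/-- `ρ̄ = ∑ m(a) ρ^a`. -/
def Params.ρbar (p : Params 𝒜) : ℝ := ∑ a, p.m a * p.ρ a

open scoped Classical in
/-- `Δ = (1 / ρ̄) η η̄ / (η + η̄)` with `η = 1 / λ`; for `λ = 0`, where `η = ∞`, this is read as the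
limit `η̄ / ρ̄`. -/
def Params.Δ (p : Params 𝒜) : ℝ :=
  if p.lam = 0 then 1 / p.ρbar * p.ηbar
  else 1 / p.ρbar * ((1 / p.lam * p.ηbar) / (1 / p.lam + p.ηbar))

/-- An equilibrium: a price `S ∈ 𝓗²` with `S_T = D`, and strategies `(K^a, u^a) ∈ 𝓢² × 𝓛²` for
each agent, such that the dealer market clears and `(K^a, u^a)` maximizes agent `a`'s goal
functional over `𝓢² × 𝓛²`, given the price and the other agents' aggregate trading rate
`ū - m(a) u^a`. -/
structure Params.IsEquilibrium (p : Params 𝒜) (𝓕 : Filtration ℝ≥0 mΩ) (P : Measure Ω)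
    (D : Ω → ℝ) (KN : ℝ≥0 → Ω → ℝ) (ξ : 𝒜 → ℝ≥0 → Ω → ℝ)
    (S : ℝ≥0 → Ω → ℝ) (K u : 𝒜 → ℝ≥0 → Ω → ℝ) : Prop where
  price : MemH2 𝓕 P p.T S
  terminal : S p.T =ᵐ[P] D
  dealer : ∀ a, MemS2 𝓕 P p.T (K a)
  rate : ∀ a, MemL2 𝓕 P p.T (u a)
  clearing : ∀ᵐ ω ∂P, ∀ t ≤ p.T, KN t ω + p.agg K t ω = 0
  nash : ∃ M A, IsDecomposition 𝓕 P p.T S M A ∧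
    ∀ a, ∀ K' u' : ℝ≥0 → Ω → ℝ, MemS2 𝓕 P p.T K' → MemL2 𝓕 P p.T u' →
      p.goal P a (ξ a) (fun t ω => p.agg u t ω - p.m a * u a t ω) A K' u' ≤
        p.goal P a (ξ a) (fun t ω => p.agg u t ω - p.m a * u a t ω) A (K a) (u a)

/-- The kernel `k^Δ(t, s) = Δ cosh(√Δ (T - s)) / cosh(√Δ (T - t))`. -/
def kernel (Δ : ℝ) (T t s : ℝ≥0) : ℝ :=
  Δ * Real.cosh (√Δ * (T - s)) / Real.cosh (√Δ * (T - t))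

/-- `U = 𝐔^Δ(X)` on `[0, T]` up to indistinguishability, where
`𝐔^Δ_t(X) = (1 / Δ) ∫₀ᵗ k^Δ(s, t) E_s[∫ₛᵀ k^Δ(s, r) X_r dr] ds`;
the conditional expectations inside the time integral are those of the càdlàg version `V` of the
process `s ↦ E_s[∫ₛᵀ k^Δ(s, r) X_r dr]`, which is determined up to indistinguishability. -/
def IsExplicitSolution (𝓕 : Filtration ℝ≥0 mΩ) (P : Measure Ω) (T : ℝ≥0) (Δ : ℝ)
    (X U : ℝ≥0 → Ω → ℝ) : Prop :=
  ∃ V : ℝ≥0 → Ω → ℝ, (∀ᵐ ω ∂P, IsCadlag fun s => V s ω) ∧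
    (∀ s ≤ T, V s =ᵐ[P] P[fun ω => ∫ r in Ioc s T, kernel Δ T s r * X r ω ∂leb | 𝓕 s]) ∧
    ∀ᵐ ω ∂P, ∀ t ≤ T, U t ω = 1 / Δ * ∫ s in Iic t, kernel Δ T s t * V s ω ∂leb

/-- `(u, U)` solves the linear forward-backward equation
`du_t = Δ (U_t - X_t) dt + dN_t`, `u_T = 0`, `dU_t = u_t dt`, `U_0 = 0` on `[0, T]`, where the
square-integrable martingale `N` is part of the solution and `u ∈ 𝓛²` is identified with
processes that agree with it `dt ⊗ dP`-almost everywhere. -/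
def IsFBSDESolution (𝓕 : Filtration ℝ≥0 mΩ) (P : Measure Ω) (T : ℝ≥0) (Δ : ℝ)
    (X u U : ℝ≥0 → Ω → ℝ) : Prop :=
  MemL2 𝓕 P T u ∧ (∀ᵐ ω ∂P, ∀ t ≤ T, U t ω = ∫ s in Iic t, u s ω ∂leb) ∧
    ∃ N, MemM2 𝓕 P T N ∧ ∀ᵐ q ∂(timeProd P T),
      0 - u q.1 q.2 = (∫ s in Ioc q.1 T, Δ * (U s q.2 - X s q.2) ∂leb) + (N T q.2 - N q.1 q.2)

end

end DealerMarket

/-!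
Given the drift `A` of the price and the aggregate rate of the others, the goal of an agent is a
concave quadratic functional of `(K, u)`, so `(K, u)` is optimal if and only if the directional
derivative vanishes in all admissible directions `(H, h)` (`Params.goal_le_of_derivGoal_eq_zero`,
`Params.derivGoal_eq_zero_of_goal_le`). For `λ^a = ∞` the goal is `-∞` unless `u = 0`, and only
directions with `h = 0` are admissible.

Directions `(H, 0)` say that `E[∫ H dA] = E[∫ g H dt]` for all `H ∈ 𝓢²`, where
`g = -(ξ^a - K^a - U^a) / ρ^a`. Hence `g` is the same for all agents, and summing `ρ^a m(a) g` and
clearing the dealer market gives `g = (Ū - K^N - ξ̄) / ρ̄`. A predictable drift is determined by these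
integrals (`IsDrift.ae_eq_of_integral_eq`), so `A = ∫ g dt`.

Directions `(0, h)` give `λ E[∫ ū h dt] + E[∫ u^a h dt] / η^a = -E[∫ g (∫ h) dt]`. Weighted with
`m(a) η^a` and summed, this is the weak form `E[∫ ū h dt] = -E[∫ Δ (Ū - X) (∫ h) dt]`, with
`X = K^N + ξ̄`, of the linear forward-backward equation. Two solutions of the weak form differ by a
`w` with `E[∫ w² dt] + Δ E[∫ W² dt] = 0`, `W = ∫ w dt`, which gives uniqueness of `ū`
(`ae_eq_of_integral_mul_eq`), hence of `g`, `A`, `u^a` and `K^a`; the martingale part of the price is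
then determined by its terminal value (`Params.IsEquilibrium.unique`).

For existence, the ansatz `u = V + (c' / c) U` with `c_t = cosh (√Δ (T - t))`, whose feedback
coefficient `c' / c` solves the Riccati equation of the system, leads to the explicit formula, and
this is shown to give a solution (`UsualConditions.exists_solution`). Fubini's theorem and the
martingale property show that a solution satisfies the weak form (`IsFBSDESolution.integral_mul_eq`).
Distributing the aggregate rate in proportion to `η^a` then satisfies all first order conditions
(`Params.derivGoal_eq_zero`, `Params.exists_isEquilibrium`).

Two facts on processes in continuous time are needed. Under the usual conditions the martingale
`E_t[Y]` has a càdlàg version: along the dyadic times, Doob's upcrossing and maximal inequalities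
give one-sided limits everywhere (`UsualConditions.exists_cadlag_condExp`). And a drift is determined
by the expected integrals of processes in `𝓢²` against it: the difference `B` of two candidates
is tested with `B` itself and with its values frozen at the points of a grid.
-/

namespace DealerMarket

noncomputable section

/-! ### Lebesgue measure on the half-line -/

lemma measurableEmbedding_nnreal_coe : MeasurableEmbedding (fun t : ℝ≥0 => (t : ℝ)) :=
  NNReal.isClosedEmbedding_coe.measurableEmbedding

lemma leb_preimage (s : Set ℝ) (hs : s ⊆ Ici 0) :
    leb ((fun t : ℝ≥0 => (t : ℝ)) ⁻¹' s) = volume s := by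
  rw [leb, measurableEmbedding_nnreal_coe.comap_preimage, inter_eq_left.2]
  intro x hx
  exact ⟨⟨x, hs hx⟩, rfl⟩

lemma leb_Iic (t : ℝ≥0) : leb (Iic t) = t := by
  have : Iic t = (fun t : ℝ≥0 => (t : ℝ)) ⁻¹' (Icc 0 (t : ℝ)) := by ext; simp
  rw [this, leb_preimage _ (fun x hx => hx.1), Real.volume_Icc]
  simp

lemma leb_singleton (t : ℝ≥0) : leb {t} = 0 := by
  have : {t} = (fun t : ℝ≥0 => (t : ℝ)) ⁻¹' {(t : ℝ)} := by ext; simp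
  rw [this, leb_preimage _ (by simp), Real.volume_singleton]

instance : NullSingletonClass leb := ⟨leb_singleton⟩

instance : IsFiniteMeasureOnCompacts leb where
  lt_top_of_isCompact K hK := by
    obtain ⟨b, hb⟩ := hK.bddAbove
    exact (measure_mono (fun x hx => hb hx)).trans_lt
      ((leb_Iic b).trans_lt ENNReal.coe_lt_top)

instance : SigmaFinite leb := inferInstance

instance (T : ℝ≥0) : IsFiniteMeasure (leb.restrict (Iic T)) :=
  ⟨by rw [Measure.restrict_apply_univ, leb_Iic]; exact ENNReal.coe_lt_top⟩

lemma setIntegral_leb_Ioc (f : ℝ → ℝ) {s t : ℝ≥0} :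
    ∫ r in Ioc s t, f r ∂leb = ∫ x in Ioc (s : ℝ) t, f x := by
  have h1 : Ioc s t = (fun t : ℝ≥0 => (t : ℝ)) ⁻¹' (Ioc (s : ℝ) t) := by ext; simp
  have h2 : leb.map (fun t : ℝ≥0 => (t : ℝ)) = volume.restrict (Ici 0) := by
    rw [leb, measurableEmbedding_nnreal_coe.map_comap]
    congr 1
    ext x
    simp
  rw [h1, ← measurableEmbedding_nnreal_coe.setIntegral_map, h2,
    Measure.restrict_restrict measurableSet_Ioc, inter_eq_left.2]
  exact fun x hx => s.2.trans hx.1.le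

/-- The fundamental theorem of calculus for a continuously differentiable function. -/
lemma setIntegral_leb_deriv {f f' : ℝ → ℝ} (hf : ∀ x, HasDerivAt f (f' x) x) (hf' : Continuous f')
    {s t : ℝ≥0} (hst : s ≤ t) : ∫ r in Ioc s t, f' r ∂leb = f t - f s := by
  rw [setIntegral_leb_Ioc, ← intervalIntegral.integral_of_le (by exact_mod_cast hst)]
  exact intervalIntegral.integral_eq_sub_of_hasDerivAt (fun x _ => hf x)
    (hf'.intervalIntegrable _ _)

/-- Integration by parts of a continuously differentiable function against an absolutely
continuous one. -/
lemma integral_by_parts {f f' : ℝ → ℝ} (hf : ∀ x, HasDerivAt f (f' x) x) (hf' : Continuous f')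
    {g : ℝ≥0 → ℝ} {t : ℝ≥0} (hg : IntegrableOn g (Iic t) leb) :
    f t * ∫ r in Iic t, g r ∂leb =
      (∫ s in Iic t, f' s * ∫ r in Iic s, g r ∂leb ∂leb) + ∫ r in Iic t, f r * g r ∂leb := by
  have hfc : Continuous f := continuous_iff_continuousAt.2 fun x => (hf x).continuousAt
  have hb : ∀ h : ℝ → ℝ, Continuous h → ∃ C, ∀ s ∈ Iic t, ‖h s‖ ≤ C := fun h hh => by
    have : IsCompact (Iic t) := by rw [← Icc_bot]; exact isCompact_Icc
    exact this.exists_bound_of_continuousOn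
      (f := fun s : ℝ≥0 => h s) (hh.comp NNReal.continuous_coe).continuousOn
  obtain ⟨C, hC⟩ := hb f' hf'
  obtain ⟨C', hC'⟩ := hb f hfc
  have hint : Integrable (fun q : ℝ≥0 × ℝ≥0 => f' q.1 * (Iic q.1).indicator g q.2)
      ((leb.restrict (Iic t)).prod (leb.restrict (Iic t))) := by
    have h1 : Integrable (fun q : ℝ≥0 × ℝ≥0 => f' q.1 * g q.2)
        ((leb.restrict (Iic t)).prod (leb.restrict (Iic t))) := by
      refine Integrable.mul_prod (f := fun s : ℝ≥0 => f' s) ?_ hg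
      exact Integrable.of_bound (hf'.comp NNReal.continuous_coe).aestronglyMeasurable C
        ((ae_restrict_iff' measurableSet_Iic).2 (ae_of_all _ hC))
    have h2 : MeasurableSet {q : ℝ≥0 × ℝ≥0 | q.2 ≤ q.1} :=
      measurableSet_le measurable_snd measurable_fst
    refine (h1.indicator h2).congr (ae_of_all _ fun q => ?_)
    by_cases hq : q.2 ≤ q.1 <;> simp [indicator, hq]
  have e1 : ∫ s in Iic t, f' s * ∫ r in Iic s, g r ∂leb ∂leb =
      ∫ s in Iic t, (∫ r in Iic t, f' s * (Iic s).indicator g r ∂leb) ∂leb := by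
    refine setIntegral_congr_fun measurableSet_Iic fun s hs => ?_
    rw [integral_const_mul, setIntegral_indicator measurableSet_Iic, inter_eq_right.2]
    exact Iic_subset_Iic.2 hs
  rw [e1, integral_integral_swap hint, ← integral_const_mul]
  have e2 : ∀ r ∈ Iic t, ∫ s in Iic t, f' s * (Iic s).indicator g r ∂leb = (f t - f r) * g r := by
    intro r hr
    rw [← setIntegral_leb_deriv hf hf' hr, ← integral_mul_const, ← integral_Icc_eq_integral_Ioc]
    have : Icc r t = Iic t ∩ Ici r := by ext; simp [and_comm]
    rw [this, ← setIntegral_indicator measurableSet_Ici]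
    refine integral_congr_ae (ae_of_all _ fun s => ?_)
    simp only [indicator, mem_Iic, mem_Ici]
    split_ifs <;> simp
  rw [setIntegral_congr_fun measurableSet_Iic e2, ← integral_add]
  · exact integral_congr_ae (ae_of_all _ fun r => by ring)
  · refine hg.bdd_mul (c := C' + C') (f := fun r : ℝ≥0 => f t - f r)
      (continuous_const.sub (hfc.comp NNReal.continuous_coe)).aestronglyMeasurable ?_
    exact (ae_restrict_iff' measurableSet_Iic).2 (ae_of_all _ fun r hr =>
      (norm_sub_le _ _).trans (add_le_add (hC' t (mem_Iic.2 le_rfl)) (hC' r hr)))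
  · refine hg.bdd_mul (c := C') (f := fun r : ℝ≥0 => f r)
      (hfc.comp NNReal.continuous_coe).aestronglyMeasurable ?_
    exact (ae_restrict_iff' measurableSet_Iic).2 (ae_of_all _ hC')

end

noncomputable section

/-! ### Predictable processes -/

variable {Ω : Type*} {mΩ : MeasurableSpace Ω} {P : Measure Ω} {𝓕 : Filtration ℝ≥0 mΩ} {T : ℝ≥0}

/-- The left end point of the interval `(k / (n + 1), (k + 1) / (n + 1)]` containing `t > 0`;
it is `0` at `t = 0`. -/
def gridLeft (n : ℕ) (t : ℝ≥0) : ℝ≥0 := ((⌈((n : ℝ≥0) + 1) * t⌉₊ - 1 : ℕ) : ℝ≥0) / (n + 1)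

/-- The right end point of the interval `(k / (n + 1), (k + 1) / (n + 1)]` containing `t > 0`;
it is `0` at `t = 0`. -/
def gridRight (n : ℕ) (t : ℝ≥0) : ℝ≥0 := (⌈((n : ℝ≥0) + 1) * t⌉₊ : ℝ≥0) / (n + 1)

lemma le_gridRight (n : ℕ) (t : ℝ≥0) : t ≤ gridRight n t := by
  rw [gridRight, le_div_iff₀ (by positivity), mul_comm]
  exact Nat.le_ceil _

lemma gridRight_le (n : ℕ) (t : ℝ≥0) : gridRight n t ≤ t + 1 / (n + 1) := by
  rw [gridRight, div_le_iff₀ (by positivity), add_mul _ _ ((n : ℝ≥0) + 1), one_div,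
    inv_mul_cancel₀ (by positivity), mul_comm t]
  exact (Nat.ceil_lt_add_one (by positivity)).le

@[simp] lemma gridLeft_zero (n : ℕ) : gridLeft n 0 = 0 := by simp [gridLeft]

lemma gridLeft_lt (n : ℕ) {t : ℝ≥0} (ht : 0 < t) : gridLeft n t < t := by
  have h : 0 < ⌈((n : ℝ≥0) + 1) * t⌉₊ := Nat.ceil_pos.2 (by positivity)
  rw [gridLeft, div_lt_iff₀ (by positivity), mul_comm]
  refine Nat.lt_ceil.1 ?_
  rw [mul_comm]
  exact Nat.sub_lt h one_pos

lemma le_gridLeft_add (n : ℕ) (t : ℝ≥0) : t ≤ gridLeft n t + 1 / (n + 1) := by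
  rw [gridLeft, ← add_div, le_div_iff₀ (by positivity), mul_comm]
  refine (Nat.le_ceil _).trans ?_
  norm_cast
  exact le_tsub_add

lemma tendsto_one_div_succ : Tendsto (fun n : ℕ => (1 : ℝ≥0) / (n + 1)) atTop (𝓝 0) := by
  rw [← NNReal.tendsto_coe]
  simpa using tendsto_one_div_add_atTop_nhds_zero_nat (𝕜 := ℝ)

lemma tendsto_gridRight (t : ℝ≥0) : Tendsto (fun n => gridRight n t) atTop (𝓝[≥] t) := by
  refine tendsto_nhdsWithin_iff.2 ⟨?_, Eventually.of_forall fun n => le_gridRight n t⟩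
  refine tendsto_of_tendsto_of_tendsto_of_le_of_le tendsto_const_nhds ?_
    (fun n => le_gridRight n t) (fun n => gridRight_le n t)
  simpa using tendsto_const_nhds.add tendsto_one_div_succ

lemma tendsto_gridLeft {t : ℝ≥0} (ht : 0 < t) : Tendsto (fun n => gridLeft n t) atTop (𝓝[<] t) := by
  refine tendsto_nhdsWithin_iff.2 ⟨?_, Eventually.of_forall fun n => gridLeft_lt n ht⟩
  refine tendsto_of_tendsto_of_tendsto_of_le_of_le (g := fun n : ℕ => t - 1 / ((n : ℝ≥0) + 1)) ?_
    tendsto_const_nhds (fun n => tsub_le_iff_right.2 (le_gridLeft_add n t))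
    (fun n => (gridLeft_lt n ht).le)
  simpa using (tendsto_const_nhds (x := t)).sub tendsto_one_div_succ

lemma gridLeft_eq_of_mem_Ioc {n k : ℕ} {t : ℝ≥0}
    (ht : t ∈ Ioc ((k : ℝ≥0) / (n + 1)) (((k + 1 : ℕ) : ℝ≥0) / (n + 1))) :
    gridLeft n t = (k : ℝ≥0) / (n + 1) := by
  have h : ⌈((n : ℝ≥0) + 1) * t⌉₊ = k + 1 := by
    rw [Nat.ceil_eq_iff (by simp), mul_comm]
    exact ⟨by simpa using (div_lt_iff₀ (by positivity)).1 ht.1,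
      (le_div_iff₀ (by positivity)).1 ht.2⟩
  rw [gridLeft, h, Nat.add_sub_cancel]

lemma exists_mem_Ioc_grid (n : ℕ) {t : ℝ≥0} (ht : 0 < t) :
    ∃ k : ℕ, t ∈ Ioc ((k : ℝ≥0) / (n + 1)) (((k + 1 : ℕ) : ℝ≥0) / (n + 1)) := by
  have h : 0 < ⌈((n : ℝ≥0) + 1) * t⌉₊ := Nat.ceil_pos.2 (by positivity)
  refine ⟨⌈((n : ℝ≥0) + 1) * t⌉₊ - 1, gridLeft_lt n ht, ?_⟩
  rw [Nat.sub_add_cancel h]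
  exact le_gridRight n t

/-- A limit of left end point discretizations of an adapted process is predictable. -/
lemma isStronglyPredictable_of_tendsto_gridLeft {V g : ℝ≥0 → Ω → ℝ} (hV : StronglyAdapted 𝓕 V)
    (h : ∀ t ω, Tendsto (fun n => V (gridLeft n t) ω) atTop (𝓝 (g t ω))) :
    IsStronglyPredictable 𝓕 g := by
  refine stronglyMeasurable_iff_measurable.2 ?_
  have hlim : Tendsto (fun n (q : ℝ≥0 × Ω) => V (gridLeft n q.1) q.2) atTop
      (𝓝 (Function.uncurry g)) := by
    rw [tendsto_pi_nhds]
    rintro ⟨t, ω⟩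
    exact h t ω
  refine @measurable_of_tendsto_metrizable (ℝ≥0 × Ω) ℝ 𝓕.predictable _ _ _ _ _ _
    (fun n => ?_) hlim
  intro s hs
  have : (fun q : ℝ≥0 × Ω => V (gridLeft n q.1) q.2) ⁻¹' s =
      ({⊥} ×ˢ (V 0 ⁻¹' s)) ∪ ⋃ k : ℕ, Ioc ((k : ℝ≥0) / (n + 1)) (((k + 1 : ℕ) : ℝ≥0) / (n + 1)) ×ˢ
        (V ((k : ℝ≥0) / (n + 1)) ⁻¹' s) := by
    ext ⟨t, ω⟩
    rcases eq_or_ne t 0 with rfl | ht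
    · simp
    · obtain ⟨k, hk⟩ := exists_mem_Ioc_grid n (pos_iff_ne_zero.2 ht)
      simp only [mem_preimage, bot_eq_zero', mem_union, mem_prod, mem_singleton_iff, ht, false_and,
        false_or, mem_iUnion]
      constructor
      · intro h'
        exact ⟨k, hk, by rwa [gridLeft_eq_of_mem_Ioc hk] at h'⟩
      · rintro ⟨j, hj, h'⟩
        rwa [gridLeft_eq_of_mem_Ioc hj]
  rw [this]
  refine MeasurableSet.union ?_ (MeasurableSet.iUnion fun k => ?_)
  · exact measurableSet_predictable_singleton_bot_prod ((hV 0).measurable hs)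
  · exact measurableSet_predictable_Ioc_prod _ _ ((hV _).measurable hs)

lemma isStronglyPredictable_of_continuous {V : ℝ≥0 → Ω → ℝ} (hV : StronglyAdapted 𝓕 V)
    (h : ∀ ω, Continuous fun t => V t ω) : IsStronglyPredictable 𝓕 V := by
  refine isStronglyPredictable_of_tendsto_gridLeft hV fun t ω => ?_
  rcases eq_or_ne t 0 with rfl | ht
  · simp
  · exact ((h ω).tendsto t).comp ((tendsto_gridLeft (pos_iff_ne_zero.2 ht)).mono_right
      nhdsWithin_le_nhds)

/-- The left-limit process of an adapted process with left limits is predictable. -/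
lemma exists_predictable_leftLim {V : ℝ≥0 → Ω → ℝ} (hV : StronglyAdapted 𝓕 V)
    (h : ∀ ω, IsCadlag fun t => V t ω) :
    ∃ W : ℝ≥0 → Ω → ℝ, IsStronglyPredictable 𝓕 W ∧ W 0 = V 0 ∧
      ∀ t, 0 < t → ∀ ω, Tendsto (fun s => V s ω) (𝓝[<] t) (𝓝 (W t ω)) := by
  choose l hl using fun ω t => (h ω t).2
  have h0 : ∀ t, 0 < t → ∀ ω, Tendsto (fun s => V s ω) (𝓝[<] t) (𝓝 (if t = 0 then V 0 ω else l ω t)) :=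
    fun t ht ω => by simpa [ht.ne'] using hl ω t
  refine ⟨fun t ω => if t = 0 then V 0 ω else l ω t, ?_, by simp, h0⟩
  refine isStronglyPredictable_of_tendsto_gridLeft hV fun t ω => ?_
  rcases eq_or_ne t 0 with rfl | ht
  · simp
  · exact (h0 t (pos_iff_ne_zero.2 ht) ω).comp (tendsto_gridLeft (pos_iff_ne_zero.2 ht))

lemma stronglyMeasurable_uncurry_of_rightCont {V : ℝ≥0 → Ω → ℝ} (hV : ∀ t, StronglyMeasurable (V t))
    (h : ∀ ω t, ContinuousWithinAt (fun s => V s ω) (Ici t) t) :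
    StronglyMeasurable (Function.uncurry V) := by
  refine stronglyMeasurable_iff_measurable.2 ?_
  have hlim : Tendsto (fun n (q : ℝ≥0 × Ω) => V (gridRight n q.1) q.2) atTop
      (𝓝 (Function.uncurry V)) := by
    rw [tendsto_pi_nhds]
    rintro ⟨t, ω⟩
    exact (h ω t).tendsto.comp (tendsto_gridRight t)
  refine measurable_of_tendsto_metrizable (fun n => ?_) hlim
  have h1 : Measurable fun q : ℕ × Ω => V ((q.1 : ℝ≥0) / (n + 1)) q.2 :=
    measurable_from_prod_countable_right fun k => (hV ((k : ℝ≥0) / (n + 1))).measurable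
  have h2 : Measurable fun q : ℝ≥0 × Ω => (⌈((n : ℝ≥0) + 1) * q.1⌉₊, q.2) := by fun_prop
  exact h1.comp h2

lemma predictable_le (𝓕 : Filtration ℝ≥0 mΩ) : 𝓕.predictable ≤ Prod.instMeasurableSpace :=
  measurableSpace_le_predictable_of_measurableSet
    (fun A hA => (measurableSet_singleton _).prod (𝓕.le _ A hA))
    (fun i A hA => measurableSet_Ioi.prod (𝓕.le i A hA))

lemma stronglyMeasurable_uncurry_of_predictable {X : ℝ≥0 → Ω → ℝ} (hX : IsStronglyPredictable 𝓕 X) :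
    StronglyMeasurable (Function.uncurry X) :=
  hX.mono (predictable_le 𝓕)

lemma measurableSet_predictable_univ_prod {s : Set Ω} (hs : MeasurableSet[𝓕 0] s) :
    MeasurableSet[𝓕.predictable] (univ ×ˢ s) := by
  have : (univ : Set ℝ≥0) ×ˢ s = ({⊥} ×ˢ s) ∪ (Ioi 0 ×ˢ s) := by
    ext ⟨t, ω⟩
    rcases eq_or_ne t 0 with rfl | ht
    · simp
    · simp [ht, pos_iff_ne_zero]
  rw [this]
  exact (measurableSet_predictable_singleton_bot_prod hs).union
    (measurableSet_predictable_Ioi_prod hs)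

/-- Deterministic Borel functions of time are predictable. -/
lemma isStronglyPredictable_of_measurable {f : ℝ≥0 → ℝ} (hf : Measurable f) :
    IsStronglyPredictable 𝓕 fun t _ => f t := by
  have h : @Measurable _ _ 𝓕.predictable _ (Prod.fst : ℝ≥0 × Ω → ℝ≥0) := ?_
  · exact stronglyMeasurable_iff_measurable.2 (hf.comp h)
  refine measurable_of_Ioi fun t => ?_
  have : (Prod.fst : ℝ≥0 × Ω → ℝ≥0) ⁻¹' Ioi t = Ioi t ×ˢ univ := by ext; simp
  rw [this]
  exact measurableSet_predictable_Ioi_prod MeasurableSet.univ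

lemma isStronglyPredictable_indicator_Ioc {s t : ℝ≥0} {f : Ω → ℝ} (hf : StronglyMeasurable[𝓕 s] f) :
    IsStronglyPredictable 𝓕 fun r ω => (Ioc s t).indicator (fun _ => f ω) r := by
  refine stronglyMeasurable_iff_measurable.2 fun C hC => ?_
  have hI : MeasurableSet[𝓕.predictable] (Ioc s t ×ˢ (univ : Set Ω)) :=
    measurableSet_predictable_Ioc_prod _ _ MeasurableSet.univ
  have : (Function.uncurry fun r ω => (Ioc s t).indicator (fun _ => f ω) r) ⁻¹' C =
      (Ioc s t ×ˢ (f ⁻¹' C)) ∪ ((Ioc s t ×ˢ univ)ᶜ ∩ {_q | (0 : ℝ) ∈ C}) := by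
    ext ⟨r, ω⟩
    by_cases hr : r ∈ Ioc s t
    · simp only [mem_preimage, Function.uncurry_apply_pair, indicator_of_mem hr]
      simp [mem_Ioc.1 hr]
    · simp only [mem_preimage, Function.uncurry_apply_pair, indicator_of_notMem hr]
      rw [mem_Ioc] at hr
      simp [hr]
  rw [this]
  exact (measurableSet_predictable_Ioc_prod _ _ (hf.measurable hC)).union
    (hI.compl.inter (MeasurableSet.const _))

lemma stronglyMeasurable_setIntegral {X : ℝ≥0 → Ω → ℝ} (hX : IsStronglyPredictable 𝓕 X) (t : ℝ≥0) :
    StronglyMeasurable[𝓕 t] fun ω => ∫ s in Iic t, X s ω ∂leb := by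
  have h := hX.isStronglyProgressive t
  have : IsFiniteMeasure (leb.comap (Subtype.val : Iic t → ℝ≥0)) := ⟨by
    rw [(MeasurableEmbedding.subtype_coe measurableSet_Iic).comap_apply]
    rw [image_univ, Subtype.range_coe, leb_Iic]
    exact ENNReal.coe_lt_top⟩
  have h2 := @StronglyMeasurable.integral_prod_left' (Iic t) Ω ℝ _ (𝓕 t)
    (leb.comap Subtype.val) _ _ inferInstance _ h
  convert h2 using 2 with ω
  exact (integral_subtype_comap measurableSet_Iic (fun s => X s ω)).symm

end

noncomputable section

variable {Ω : Type*} {mΩ : MeasurableSpace Ω} {P : Measure Ω} {𝓕 : Filtration ℝ≥0 mΩ} {T : ℝ≥0}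

/-! ### Time-space null sets -/

/-- A path that has left limits agrees with them at Lebesgue almost every time. -/
lemma ae_eq_of_tendsto_nhdsLT {f g : ℝ≥0 → ℝ}
    (hg : ∀ t, 0 < t → Tendsto f (𝓝[<] t) (𝓝 (g t))) : ∀ᵐ t ∂leb, g t = f t := by
  -- A jump at `t` isolates `t` from the left in the set `{f > q}` or `{f < q}`, for a rational `q`.
  have key : ∀ h l : ℝ≥0 → ℝ, (∀ t, 0 < t → Tendsto h (𝓝[<] t) (𝓝 (l t))) →
      {t | 0 < t ∧ l t < h t}.Countable := by
    intro h l hl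
    refine (countable_iUnion fun q : ℚ =>
      countable_setOfPred_isolated_left_within (s := {t : ℝ≥0 | (q : ℝ) < h t})).mono ?_
    rintro t ⟨ht0, ht⟩
    obtain ⟨q, hq1, hq2⟩ := exists_rat_btwn ht
    refine mem_iUnion.2 ⟨q, hq2, ?_⟩
    have h1 : ∀ᶠ s in 𝓝[<] t, h s < q := (hl t ht0).eventually_lt_const hq1
    rw [← empty_mem_iff_bot, inter_comm, nhdsWithin_inter', mem_inf_principal]
    filter_upwards [h1] with s hs hs'
    exact absurd hs' (not_lt.2 hs.le)
  have h1 := key f g hg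
  have h2 := key (fun t => -f t) (fun t => -g t) (fun t ht => (hg t ht).neg)
  have h3 : ({0} ∪ {t | 0 < t ∧ g t < f t} ∪ {t | 0 < t ∧ -g t < -f t}).Countable :=
    ((countable_singleton 0).union h1).union h2
  filter_upwards [h3.ae_notMem leb] with t ht
  simp only [mem_union, mem_singleton_iff, mem_ofPred_eq, not_or, not_and, not_lt,
    neg_le_neg_iff] at ht
  have ht0 : 0 < t := pos_iff_ne_zero.2 ht.1.1
  exact le_antisymm (ht.2 ht0) (ht.1.2 ht0)

variable [IsProbabilityMeasure P]

instance : IsFiniteMeasure (timeProd P T) := by unfold timeProd; infer_instance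

omit [IsProbabilityMeasure P] in
lemma ae_timeProd_of_ae {p : ℝ≥0 → Ω → Prop} (h : ∀ᵐ ω ∂P, ∀ t ≤ T, p t ω) :
    ∀ᵐ q ∂(timeProd P T), p q.1 q.2 := by
  have h1 : ∀ᵐ q ∂(timeProd P T), q.1 ∈ Iic T :=
    Measure.quasiMeasurePreserving_fst.ae (ae_restrict_mem measurableSet_Iic)
  have h2 : ∀ᵐ q ∂(timeProd P T), ∀ t ≤ T, p t q.2 := Measure.quasiMeasurePreserving_snd.ae h
  filter_upwards [h1, h2] with q hq1 hq2 using hq2 _ hq1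

lemma ae_ae_of_ae_timeProd {p : ℝ≥0 → Ω → Prop} (h : ∀ᵐ q ∂(timeProd P T), p q.1 q.2) :
    ∀ᵐ ω ∂P, ∀ᵐ t ∂(leb.restrict (Iic T)), p t ω := by
  have h1 : ∀ᵐ q ∂(P.prod (leb.restrict (Iic T))), p q.2 q.1 := by
    have h2 := Measure.measurePreserving_swap (μ := P) (ν := leb.restrict (Iic T))
    exact h2.quasiMeasurePreserving.ae h
  exact Measure.ae_ae_of_ae_prod h1

lemma integral_timeProd {f : ℝ≥0 × Ω → ℝ} (hf : Integrable f (timeProd P T)) :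
    ∫ q, f q ∂(timeProd P T) = ∫ ω, ∫ t in Iic T, f (t, ω) ∂leb ∂P :=
  integral_prod_symm f hf

lemma ae_eq_of_forall_ae_eq {f g : ℝ≥0 → Ω → ℝ} (hf : Measurable (Function.uncurry f))
    (hg : Measurable (Function.uncurry g)) (h : ∀ t ≤ T, ∀ᵐ ω ∂P, f t ω = g t ω) :
    ∀ᵐ q ∂(timeProd P T), f q.1 q.2 = g q.1 q.2 := by
  have hs : MeasurableSet {q : ℝ≥0 × Ω | f q.1 q.2 = g q.1 q.2} := measurableSet_eq_fun hf hg
  refine (Measure.ae_prod_iff_ae_ae hs).2 ?_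
  exact (ae_restrict_iff' measurableSet_Iic).2 (ae_of_all _ h)

lemma position_eq_of_ae_eq {u v : ℝ≥0 → Ω → ℝ} (h : ∀ᵐ q ∂(timeProd P T), u q.1 q.2 = v q.1 q.2) :
    ∀ᵐ ω ∂P, ∀ t ≤ T, position u t ω = position v t ω := by
  filter_upwards [ae_ae_of_ae_timeProd (p := fun t ω => u t ω = v t ω) h]
    with ω hω t ht
  exact integral_congr_ae (ae_restrict_of_ae_restrict_of_subset (Iic_subset_Iic.2 ht) hω)

/-! ### Cumulative processes -/

/-- Predictable processes all of whose paths are Lebesgue integrable and vanish after the horizon.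
The indefinite integral of such a process is continuous without exceptional set, hence
predictable. -/
structure IsRegularRate (𝓕 : Filtration ℝ≥0 mΩ) (T : ℝ≥0) (u : ℝ≥0 → Ω → ℝ) : Prop where
  predictable : IsStronglyPredictable 𝓕 u
  integrable : ∀ ω, Integrable (fun t => u t ω) leb
  eq_zero : ∀ t ω, T < t → u t ω = 0

lemma UsualConditions.exists_isRegularRate (h𝓕 : UsualConditions 𝓕 P) {X : ℝ≥0 → Ω → ℝ}
    (hX : IsStronglyPredictable 𝓕 X) (hint : Integrable (Function.uncurry X) (timeProd P T)) :
    ∃ Y, IsRegularRate 𝓕 T Y ∧ ∀ᵐ ω ∂P, ∀ t ≤ T, Y t ω = X t ω := by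
  have h1 : ∀ᵐ ω ∂P, IntegrableOn (fun t => X t ω) (Iic T) leb := hint.prod_left_ae
  set N : Set Ω := {ω | IntegrableOn (fun t => X t ω) (Iic T) leb} with hN
  have hNm : MeasurableSet[𝓕 0] N := by
    have := h𝓕.complete Nᶜ h1
    exact (compl_compl N) ▸ this.compl
  have hm : MeasurableSet[𝓕.predictable] (Iic T ×ˢ N) := by
    have h2 := (measurableSet_predictable_univ_prod hNm).diff
      (measurableSet_predictable_Ioi_prod (𝓕 := 𝓕) (i := T) (s := univ) MeasurableSet.univ)
    convert h2 using 1
    ext ⟨t, ω⟩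
    simp [and_comm]
  refine ⟨fun t ω => (Iic T ×ˢ N).indicator (Function.uncurry X) (t, ω), ⟨?_, ?_, ?_⟩, ?_⟩
  · exact hX.indicator hm
  · intro ω
    by_cases hω : ω ∈ N
    · have : (fun t => (Iic T ×ˢ N).indicator (Function.uncurry X) (t, ω)) =
          (Iic T).indicator fun t => X t ω := by
        ext t
        by_cases ht : t ≤ T <;> simp [indicator, ht, hω]
      rw [this, integrable_indicator_iff measurableSet_Iic]
      exact hω
    · have : (fun t => (Iic T ×ˢ N).indicator (Function.uncurry X) (t, ω)) = fun _ => 0 := by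
        ext t
        simp [indicator, hω]
      rw [this]
      exact integrable_zero _ _ _
  · intro t ω ht
    simp [indicator, not_le.2 ht]
  · filter_upwards [h1] with ω hω t ht
    have : ω ∈ N := hω
    simp [indicator, ht, this]

namespace IsRegularRate

variable {u : ℝ≥0 → Ω → ℝ} (hu : IsRegularRate 𝓕 T u)
include hu

lemma position_sub {s t : ℝ≥0} (hst : s ≤ t) (ω : Ω) :
    position u t ω - position u s ω = ∫ r in Ioc s t, u r ω ∂leb := by
  have h := (hu.integrable ω)
  have : Iic t = Iic s ∪ Ioc s t := (Iic_union_Ioc_eq_Iic hst).symm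
  rw [position, position, this, setIntegral_union (by
    rw [Set.disjoint_left]; intro x hx hx'; exact not_lt.2 hx hx'.1) measurableSet_Ioc
    h.integrableOn h.integrableOn]
  ring

lemma continuous_position (ω : Ω) : Continuous fun t => position u t ω := by
  refine continuous_iff_continuousAt.2 fun t => ?_
  have e : (fun t => position u t ω) = fun t => ∫ s, (Iic t).indicator (fun s => u s ω) s ∂leb := by
    ext t
    rw [integral_indicator measurableSet_Iic, position]
  rw [e]
  refine continuousAt_of_dominated (bound := fun s => ‖u s ω‖) ?_ ?_ (hu.integrable ω).norm ?_
  · exact Eventually.of_forall fun t =>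
      ((hu.integrable ω).aestronglyMeasurable.indicator measurableSet_Iic)
  · exact Eventually.of_forall fun t => ae_of_all _ fun s => norm_indicator_le_norm_self _ _
  · have h0 : ∀ᵐ s ∂leb, s ≠ t := (countable_singleton t).ae_notMem leb
    filter_upwards [h0] with s hs
    rcases lt_or_gt_of_ne hs with h | h
    · refine (continuousAt_const (y := u s ω)).congr ?_
      filter_upwards [lt_mem_nhds h] with r hr
      simp [indicator, hr.le]
    · refine (continuousAt_const (y := (0 : ℝ))).congr ?_
      filter_upwards [gt_mem_nhds h] with r hr
      simp [indicator, not_le.2 hr]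

lemma predictable_position : IsStronglyPredictable 𝓕 (position u) :=
  isStronglyPredictable_of_continuous (fun t => stronglyMeasurable_setIntegral hu.predictable t)
    hu.continuous_position

lemma abs_position_sub_le {s t : ℝ≥0} (hst : s ≤ t) (ω : Ω) :
    |position u t ω - position u s ω| ≤
      position (fun t ω => |u t ω|) t ω - position (fun t ω => |u t ω|) s ω := by
  have h : IsRegularRate 𝓕 T (fun t ω => |u t ω|) :=
    ⟨(hu.predictable.norm : _), fun ω => (hu.integrable ω).abs, fun t ω ht => by
      simp [hu.eq_zero t ω ht]⟩
  rw [hu.position_sub hst, h.position_sub hst]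
  exact abs_integral_le_integral_abs

end IsRegularRate

end

noncomputable section

variable {Ω : Type*} {mΩ : MeasurableSpace Ω} {P : Measure Ω} {𝓕 : Filtration ℝ≥0 mΩ} {T : ℝ≥0}

variable [IsProbabilityMeasure P]

/-! ### Square-integrable processes -/

lemma sq_integral_le {α : Type*} {mα : MeasurableSpace α} {μ : Measure α} [IsFiniteMeasure μ]
    {f : α → ℝ} (hf : MemLp f 2 μ) : (∫ x, f x ∂μ) ^ 2 ≤ μ.real univ * ∫ x, f x ^ 2 ∂μ := by
  have hi : Integrable f μ := hf.integrable (by norm_num)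
  set m := μ.real univ
  set I := ∫ x, f x ∂μ
  have h : 0 ≤ ∫ x, (m * f x - I) ^ 2 ∂μ := integral_nonneg fun x => sq_nonneg _
  have e : ∫ x, (m * f x - I) ^ 2 ∂μ = m * (m * (∫ x, f x ^ 2 ∂μ) - I ^ 2) := by
    have : ∀ x, (m * f x - I) ^ 2 = m ^ 2 * f x ^ 2 - 2 * m * I * f x + I ^ 2 := fun x => by ring
    simp_rw [this]
    have h1 : Integrable (fun x => m ^ 2 * f x ^ 2) μ := hf.integrable_sq.const_mul _
    have h2 : Integrable (fun x => 2 * m * I * f x) μ := hi.const_mul _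
    have h3 : Integrable (fun x => m ^ 2 * f x ^ 2 - 2 * m * I * f x) μ := h1.sub h2
    rw [integral_add h3 (integrable_const _), integral_sub h1 h2, integral_const_mul,
      integral_const_mul, integral_const, smul_eq_mul]
    ring
  rcases (measureReal_nonneg (μ := μ) (s := univ)).eq_or_lt with h0 | h0
  · have : μ = 0 := by
      rw [← Measure.measure_univ_eq_zero]
      exact ((measureReal_eq_zero_iff).1 h0.symm)
    simp [I, this]
  · rw [e] at h
    have := nonneg_of_mul_nonneg_right h h0
    linarith

namespace MemL2

variable {X Y : ℝ≥0 → Ω → ℝ}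

omit [IsProbabilityMeasure P] in
lemma memLp (hX : MemL2 𝓕 P T X) : MemLp (fun q : ℝ≥0 × Ω => X q.1 q.2) 2 (timeProd P T) := hX.2

lemma integrable (hX : MemL2 𝓕 P T X) :
    Integrable (fun q : ℝ≥0 × Ω => X q.1 q.2) (timeProd P T) :=
  hX.memLp.integrable (by norm_num)

omit [IsProbabilityMeasure P] in
lemma integrable_mul (hX : MemL2 𝓕 P T X) (hY : MemL2 𝓕 P T Y) :
    Integrable (fun q : ℝ≥0 × Ω => X q.1 q.2 * Y q.1 q.2) (timeProd P T) :=
  MemLp.integrable_mul hX.memLp hY.memLp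

omit [IsProbabilityMeasure P] in
lemma integrable_sq (hX : MemL2 𝓕 P T X) :
    Integrable (fun q : ℝ≥0 × Ω => X q.1 q.2 ^ 2) (timeProd P T) :=
  hX.memLp.integrable_sq

omit [IsProbabilityMeasure P] in
lemma add (hX : MemL2 𝓕 P T X) (hY : MemL2 𝓕 P T Y) : MemL2 𝓕 P T fun t ω => X t ω + Y t ω :=
  ⟨StronglyMeasurable.add hX.1 hY.1, MemLp.add hX.2 hY.2⟩

omit [IsProbabilityMeasure P] in
lemma sub (hX : MemL2 𝓕 P T X) (hY : MemL2 𝓕 P T Y) : MemL2 𝓕 P T fun t ω => X t ω - Y t ω :=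
  ⟨StronglyMeasurable.sub hX.1 hY.1, MemLp.sub hX.2 hY.2⟩

omit [IsProbabilityMeasure P] in
lemma const_mul (c : ℝ) (hX : MemL2 𝓕 P T X) : MemL2 𝓕 P T fun t ω => c * X t ω :=
  ⟨StronglyMeasurable.const_mul hX.1 c, MemLp.const_mul hX.2 c⟩

omit [IsProbabilityMeasure P] in
lemma sum {ι : Type*} (s : Finset ι) {X : ι → ℝ≥0 → Ω → ℝ} (hX : ∀ i, MemL2 𝓕 P T (X i)) :
    MemL2 𝓕 P T fun t ω => ∑ i ∈ s, X i t ω := by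
  classical
  induction s using Finset.induction_on with
  | empty =>
    exact ⟨stronglyMeasurable_const, MemLp.zero'⟩
  | insert i s hi ih =>
    simp_rw [Finset.sum_insert hi]
    exact (hX i).add ih

end MemL2

namespace MemS2

variable {X Y : ℝ≥0 → Ω → ℝ}

omit [IsProbabilityMeasure P] in
lemma add (hX : MemS2 𝓕 P T X) (hY : MemS2 𝓕 P T Y) : MemS2 𝓕 P T fun t ω => X t ω + Y t ω := by
  obtain ⟨hX1, Z, hZ, hXZ⟩ := hX
  obtain ⟨hY1, W, hW, hYW⟩ := hY
  refine ⟨StronglyMeasurable.add hX1 hY1, Z + W, hZ.add hW, ?_⟩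
  filter_upwards [hXZ, hYW] with ω h1 h2 t ht
  exact (abs_add_le _ _).trans (add_le_add (h1 t ht) (h2 t ht))

omit [IsProbabilityMeasure P] in
lemma const_mul (c : ℝ) (hX : MemS2 𝓕 P T X) : MemS2 𝓕 P T fun t ω => c * X t ω := by
  obtain ⟨hX1, Z, hZ, hXZ⟩ := hX
  refine ⟨StronglyMeasurable.const_mul hX1 c, fun ω => |c| * Z ω, hZ.const_mul _, ?_⟩
  filter_upwards [hXZ] with ω h1 t ht
  rw [abs_mul]
  exact mul_le_mul_of_nonneg_left (h1 t ht) (abs_nonneg c)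

omit [IsProbabilityMeasure P] in
lemma sub (hX : MemS2 𝓕 P T X) (hY : MemS2 𝓕 P T Y) : MemS2 𝓕 P T fun t ω => X t ω - Y t ω := by
  have := hX.add (hY.const_mul (-1))
  simpa only [neg_mul, one_mul, ← sub_eq_add_neg] using this

omit [IsProbabilityMeasure P] in
lemma zero : MemS2 𝓕 P T fun _ _ => 0 :=
  ⟨stronglyMeasurable_const, 0, MemLp.zero, by simp⟩

omit [IsProbabilityMeasure P] in
lemma sum {ι : Type*} (s : Finset ι) {X : ι → ℝ≥0 → Ω → ℝ} (hX : ∀ i, MemS2 𝓕 P T (X i)) :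
    MemS2 𝓕 P T fun t ω => ∑ i ∈ s, X i t ω := by
  classical
  induction s using Finset.induction_on with
  | empty => simpa using zero
  | insert i s hi ih =>
    simp_rw [Finset.sum_insert hi]
    exact (hX i).add ih

lemma memL2 (hX : MemS2 𝓕 P T X) : MemL2 𝓕 P T X := by
  obtain ⟨hX1, Z, hZ, hXZ⟩ := hX
  refine ⟨hX1, ?_⟩
  have h1 : MemLp (fun q : ℝ≥0 × Ω => Z q.2) 2 (timeProd P T) := hZ.comp_snd _
  refine h1.of_le (stronglyMeasurable_uncurry_of_predictable hX1).aestronglyMeasurable ?_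
  filter_upwards [ae_timeProd_of_ae hXZ] with q hq
  exact hq.trans (le_abs_self _)

omit [IsProbabilityMeasure P] in
lemma memLp_apply (hX : MemS2 𝓕 P T X) {t : ℝ≥0} (ht : t ≤ T) : MemLp (X t) 2 P := by
  obtain ⟨hX1, Z, hZ, hXZ⟩ := hX
  refine hZ.of_le ((hX1.stronglyAdapted t).mono (𝓕.le t)).aestronglyMeasurable ?_
  filter_upwards [hXZ] with ω hω
  exact (hω t ht).trans (le_abs_self _)

end MemS2

/-- The pathwise integral of a square-integrable process over the time interval. -/
lemma memLp_integral_abs {u : ℝ≥0 → Ω → ℝ} (hu : MemL2 𝓕 P T u) :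
    MemLp (fun ω => ∫ t in Iic T, |u t ω| ∂leb) 2 P := by
  have hsm := stronglyMeasurable_uncurry_of_predictable hu.1
  have hm : AEStronglyMeasurable (fun ω => ∫ t in Iic T, |u t ω| ∂leb) P :=
    (StronglyMeasurable.integral_prod_left' (μ := leb.restrict (Iic T))
      (f := fun q : ℝ≥0 × Ω => |u q.1 q.2|) hsm.norm).aestronglyMeasurable
  have hsq : Integrable (fun ω => ∫ t in Iic T, u t ω ^ 2 ∂leb) P := hu.integrable_sq.integral_prod_right
  refine (memLp_two_iff_integrable_sq hm).2 ?_
  refine (hsq.const_mul (T : ℝ)).mono' (hm.pow 2) ?_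
  have h2 : ∀ᵐ ω ∂P, Integrable (fun t => u t ω ^ 2) (leb.restrict (Iic T)) :=
    hu.integrable_sq.prod_left_ae
  filter_upwards [h2] with ω hω
  have h3 : MemLp (fun t => |u t ω|) 2 (leb.restrict (Iic T)) := by
    refine (memLp_two_iff_integrable_sq ?_).2 (by simpa using hω)
    exact (hsm.comp_measurable measurable_prodMk_right).norm.aestronglyMeasurable
  have h4 := sq_integral_le h3
  have h5 : (leb.restrict (Iic T)).real univ = T := by simp [measureReal_def, leb_Iic]
  rw [Real.norm_eq_abs, abs_of_nonneg (sq_nonneg _)]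
  simpa [h5] using h4

lemma IsRegularRate.memS2_position {u : ℝ≥0 → Ω → ℝ} (hu : IsRegularRate 𝓕 T u)
    (hu2 : MemL2 𝓕 P T u) : MemS2 𝓕 P T (position u) := by
  refine ⟨hu.predictable_position, _, memLp_integral_abs hu2, ae_of_all _ fun ω t ht => ?_⟩
  refine (abs_integral_le_integral_abs).trans ?_
  exact setIntegral_mono_set (hu.integrable ω).abs.integrableOn (ae_of_all _ fun _ => abs_nonneg _)
    (Iic_subset_Iic.2 ht).eventuallyLE

lemma UsualConditions.exists_isRegularRate_of_memL2 (h𝓕 : UsualConditions 𝓕 P) {u : ℝ≥0 → Ω → ℝ}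
    (hu : MemL2 𝓕 P T u) : ∃ v, IsRegularRate 𝓕 T v ∧ MemL2 𝓕 P T v ∧
      (∀ᵐ ω ∂P, ∀ t ≤ T, v t ω = u t ω) ∧
      ∀ᵐ ω ∂P, ∀ t ≤ T, position v t ω = position u t ω := by
  obtain ⟨v, hv, hvu⟩ := h𝓕.exists_isRegularRate hu.1 hu.integrable
  have h1 := ae_timeProd_of_ae hvu
  refine ⟨v, hv, ⟨hv.predictable, ?_⟩, hvu, position_eq_of_ae_eq h1⟩
  exact (memLp_congr_ae (h1 : Function.uncurry v =ᵐ[_] Function.uncurry u)).2 hu.2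

/-- Positions are square-integrable; they need not be predictable themselves, but they are
indistinguishable from predictable processes. -/
lemma UsualConditions.exists_memS2_position (h𝓕 : UsualConditions 𝓕 P) {u : ℝ≥0 → Ω → ℝ}
    (hu : MemL2 𝓕 P T u) : ∃ U, MemS2 𝓕 P T U ∧ (∀ᵐ ω ∂P, ∀ t ≤ T, U t ω = position u t ω) := by
  obtain ⟨v, hv, hv2, -, hvu⟩ := h𝓕.exists_isRegularRate_of_memL2 hu
  exact ⟨_, hv.memS2_position hv2, hvu⟩

omit mΩ in
lemma integral_mul_tail_eq_path {a b : ℝ≥0 → ℝ} (ha : IntegrableOn a (Iic T) leb)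
    (hb : IntegrableOn b (Iic T) leb) :
    ∫ s in Iic T, a s * ∫ r in Ioc s T, b r ∂leb ∂leb =
      ∫ r in Iic T, b r * ∫ s in Iic r, a s ∂leb ∂leb := by
  have hint : Integrable (fun q : ℝ≥0 × ℝ≥0 => a q.1 * (Ici q.1).indicator b q.2)
      ((leb.restrict (Iic T)).prod (leb.restrict (Iic T))) := by
    have h2 : MeasurableSet {q : ℝ≥0 × ℝ≥0 | q.1 ≤ q.2} :=
      measurableSet_le measurable_fst measurable_snd
    refine ((Integrable.mul_prod ha hb).indicator h2).congr (ae_of_all _ fun q => ?_)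
    by_cases hq : q.1 ≤ q.2 <;> simp [indicator, hq]
  have e1 : ∀ s ∈ Iic T, a s * ∫ r in Ioc s T, b r ∂leb =
      ∫ r in Iic T, a s * (Ici s).indicator b r ∂leb := by
    intro s _
    rw [integral_const_mul, setIntegral_indicator measurableSet_Ici,
      ← integral_Icc_eq_integral_Ioc]
    congr 3
    ext; simp [and_comm]
  have e2 : ∀ r ∈ Iic T, b r * ∫ s in Iic r, a s ∂leb =
      ∫ s in Iic T, a s * (Ici s).indicator b r ∂leb := by
    intro r hr
    rw [← integral_const_mul]
    have : Iic r = Iic T ∩ Iic r := (inter_eq_right.2 (Iic_subset_Iic.2 hr)).symm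
    rw [this, ← setIntegral_indicator measurableSet_Iic]
    refine integral_congr_ae (ae_of_all _ fun s => ?_)
    by_cases hs : s ≤ r <;> simp [indicator, hs, mul_comm]
  rw [setIntegral_congr_fun measurableSet_Iic e1, setIntegral_congr_fun measurableSet_Iic e2,
    integral_integral_swap hint]

/-- Fubini's theorem: integrating a rate `h` against the remaining integral of `g` is the same as
integrating `g` against the position accumulated at rate `h`. -/
lemma UsualConditions.integral_mul_tail_eq (h𝓕 : UsualConditions 𝓕 P) {h g : ℝ≥0 → Ω → ℝ}
    (hh : MemL2 𝓕 P T h) (hg : MemL2 𝓕 P T g) :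
    Integrable (fun q : ℝ≥0 × Ω => h q.1 q.2 * ∫ r in Ioc q.1 T, g r q.2 ∂leb) (timeProd P T) ∧
    ∫ q, h q.1 q.2 * (∫ r in Ioc q.1 T, g r q.2 ∂leb) ∂(timeProd P T) =
      ∫ q, g q.1 q.2 * position h q.1 q.2 ∂(timeProd P T) := by
  obtain ⟨v, hv, hv2, hvg, -⟩ := h𝓕.exists_isRegularRate_of_memL2 hg
  obtain ⟨U, hU, hUh⟩ := h𝓕.exists_memS2_position hh
  have e1 : (fun q : ℝ≥0 × Ω => h q.1 q.2 * (position v T q.2 - position v q.1 q.2))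
      =ᵐ[timeProd P T] fun q => h q.1 q.2 * ∫ r in Ioc q.1 T, g r q.2 ∂leb := by
    refine ae_timeProd_of_ae (p := fun t ω => h t ω * (position v T ω - position v t ω) =
      h t ω * ∫ r in Ioc t T, g r ω ∂leb) ?_
    filter_upwards [hvg] with ω hω t ht
    rw [hv.position_sub ht]
    congr 1
    exact setIntegral_congr_fun measurableSet_Ioc fun r hr => hω r hr.2
  have i1 : Integrable (fun q : ℝ≥0 × Ω => h q.1 q.2 * ∫ r in Ioc q.1 T, g r q.2 ∂leb)
      (timeProd P T) := by
    have h1 : MemLp (fun q : ℝ≥0 × Ω => position v T q.2) 2 (timeProd P T) :=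
      ((hv.memS2_position hv2).memLp_apply le_rfl).comp_snd _
    have h2 : MemLp (fun q : ℝ≥0 × Ω => position v T q.2 - position v q.1 q.2) 2 (timeProd P T) :=
      h1.sub (hv.memS2_position hv2).memL2.memLp
    exact (MemLp.integrable_mul hh.memLp h2).congr e1
  have e2 : (fun q : ℝ≥0 × Ω => g q.1 q.2 * U q.1 q.2) =ᵐ[timeProd P T]
      fun q => g q.1 q.2 * position h q.1 q.2 := by
    refine ae_timeProd_of_ae (p := fun t ω => g t ω * U t ω = g t ω * position h t ω) ?_
    filter_upwards [hUh] with ω hω t ht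
    rw [hω t ht]
  have i2 : Integrable (fun q : ℝ≥0 × Ω => g q.1 q.2 * position h q.1 q.2) (timeProd P T) :=
    (hg.integrable_mul hU.memL2).congr e2
  refine ⟨i1, ?_⟩
  rw [integral_timeProd i1, integral_timeProd i2]
  refine integral_congr_ae ?_
  filter_upwards [hh.integrable.prod_left_ae, hg.integrable.prod_left_ae] with ω h1 h2
  exact integral_mul_tail_eq_path h1 h2

end

noncomputable section

/-! ### Lebesgue–Stieltjes integrals -/

section Stieltjes

variable {T : ℝ≥0} {V : ℝ} {α k : ℝ≥0 → ℝ}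

lemma boundedVariationOn_min (hV : eVariationOn α (Iic T) ≤ ENNReal.ofReal V) :
    eVariationOn (fun t => α (min t T)) univ ≤ ENNReal.ofReal V := by
  refine (eVariationOn.comp_le_of_monotoneOn α (fun t => min t T) ?_ ?_).trans hV
  · exact fun s _ t _ hst => min_le_min_right T hst
  · exact fun s _ => min_le_right s T

lemma continuousWithinAt_min (hα : ∀ t, ContinuousWithinAt α (Ici t) t) (t : ℝ≥0) :
    ContinuousWithinAt (fun t => α (min t T)) (Ici t) t := by
  refine (hα (min t T)).comp (t := Ici (min t T)) (by fun_prop) ?_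
  exact fun s hs => min_le_min_right T hs

/-- If the increments of `α` are those of a difference of finite measures, then the integral against
`α` is the difference of the integrals against these measures. -/
lemma stieltjesIntegral_eq_sub (hα : ∀ t, ContinuousWithinAt α (Ici t) t)
    (hV : eVariationOn α (Iic T) ≤ ENNReal.ofReal V) {ν₁ ν₂ : Measure ℝ≥0} [IsFiniteMeasure ν₁]
    [IsFiniteMeasure ν₂]
    (hν : ∀ s t, s ≤ t → t ≤ T → α t - α s = ν₁.real (Ioc s t) - ν₂.real (Ioc s t))
    (hk₁ : IntegrableOn k (Ioc 0 T) ν₁) (hk₂ : IntegrableOn k (Ioc 0 T) ν₂) :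
    stieltjesIntegral T k α = ∫ t in Ioc 0 T, k t ∂ν₁ - ∫ t in Ioc 0 T, k t ∂ν₂ := by
  have h : BoundedVariationOn (fun t => α (min t T)) univ :=
    ((boundedVariationOn_min hV).trans_lt ENNReal.ofReal_lt_top).ne
  have hr : ∀ t, (fun t => α (min t T)).rightLim t = α (min t T) := fun t =>
    ContinuousWithinAt.rightLim_eq (continuousWithinAt_min hα t)
  have hIoc : ∀ s t, (h.vectorMeasure.restrict (Ioc 0 T)) (Ioc s t) =
      ((ν₁.restrict (Ioc 0 T)).toSignedMeasure - (ν₂.restrict (Ioc 0 T)).toSignedMeasure)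
        (Ioc s t) := by
    intro s t
    rw [VectorMeasure.restrict_apply _ measurableSet_Ioc measurableSet_Ioc, Ioc_inter_Ioc,
      sub_apply, Measure.toSignedMeasure_apply_measurable measurableSet_Ioc,
      Measure.toSignedMeasure_apply_measurable measurableSet_Ioc,
      measureReal_restrict_apply measurableSet_Ioc, measureReal_restrict_apply measurableSet_Ioc,
      Ioc_inter_Ioc]
    simp only [zero_le, sup_of_le_left]
    rcases le_total s (t ⊓ T) with hs | hs
    · rw [h.vectorMeasure_Ioc hs, hr, hr, ← hν s _ hs inf_le_right]
      simp [hs.trans inf_le_right]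
    · simp [Ioc_eq_empty (not_lt.2 hs)]
  have key : h.vectorMeasure.restrict (Ioc 0 T) =
      (ν₁.restrict (Ioc 0 T)).toSignedMeasure - (ν₂.restrict (Ioc 0 T)).toSignedMeasure := by
    refine VectorMeasure.ext_of_generateFrom {S | ∃ s t, s ≤ t ∧ Ioc s t = S} ?_ ?_ ?_ ?_
    · rintro _ ⟨s, t, -, rfl⟩
      exact hIoc s t
    · rw [← borel_eq_generateFrom_Ioc_le]
      exact BorelSpace.measurable_eq
    · rintro _ ⟨a, b, -, rfl⟩ _ ⟨c, d, -, rfl⟩ hne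
      rw [Ioc_inter_Ioc] at hne ⊢
      exact ⟨_, _, (nonempty_Ioc.1 hne).le, rfl⟩
    · have := hIoc 0 T
      rw [VectorMeasure.restrict_apply _ measurableSet_Ioc measurableSet_Ioc, sub_apply,
        Measure.toSignedMeasure_apply_measurable measurableSet_Ioc,
        Measure.toSignedMeasure_apply_measurable measurableSet_Ioc,
        measureReal_restrict_apply measurableSet_Ioc,
        measureReal_restrict_apply measurableSet_Ioc] at this
      rw [VectorMeasure.restrict_apply _ measurableSet_Ioc MeasurableSet.univ, sub_apply,
        Measure.toSignedMeasure_apply_measurable MeasurableSet.univ,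
        Measure.toSignedMeasure_apply_measurable MeasurableSet.univ,
        measureReal_restrict_apply MeasurableSet.univ,
        measureReal_restrict_apply MeasurableSet.univ]
      simpa using this
  have hflip : ContinuousLinearMap.lsmul ℝ ℝ = (ContinuousLinearMap.lsmul ℝ ℝ (E := ℝ)).flip := by
    ext
    simp
  rw [stieltjesIntegral, dif_pos h, key, VectorMeasure.integral_sub_vectorMeasure, hflip,
    VectorMeasure.integral_toSignedMeasure, VectorMeasure.integral_toSignedMeasure]
  · rw [VectorMeasure.Integrable, Measure.variation_toSignedMeasure]
    exact hk₁
  · rw [VectorMeasure.Integrable, Measure.variation_toSignedMeasure]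
    exact hk₂

/-- The positive and negative parts of the Lebesgue–Stieltjes measure of a right-continuous path of
bounded variation. Only their total mass, not minimality, is of interest. -/
lemma exists_measures_of_eVariationOn_le (hα : ∀ t, ContinuousWithinAt α (Ici t) t)
    (hV : eVariationOn α (Iic T) ≤ ENNReal.ofReal V) (hV0 : 0 ≤ V) :
    ∃ ν₁ ν₂ : Measure ℝ≥0, IsFiniteMeasure ν₁ ∧ IsFiniteMeasure ν₂ ∧
      ν₁.real univ + ν₂.real univ ≤ 3 * V ∧
      ∀ s t, s ≤ t → t ≤ T → α t - α s = ν₁.real (Ioc s t) - ν₂.real (Ioc s t) := by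
  set f : ℝ≥0 → ℝ := fun t => α (min t T) with hf
  have hle := boundedVariationOn_min hV
  have h : BoundedVariationOn f univ := (hle.trans_lt ENNReal.ofReal_lt_top).ne
  have hfc := continuousWithinAt_min (T := T) hα
  let v : StieltjesFunction ℝ≥0 :=
    { toFun := variationOnFromTo f univ 0
      mono' := monotoneOn_univ.1
        (variationOnFromTo.monotoneOn h.locallyBoundedVariationOn (mem_univ _))
      right_continuous' := fun t => h.continuousWithinAt_variationOnFromTo_Ici (hfc t) }
  let w : StieltjesFunction ℝ≥0 :=
    { toFun := variationOnFromTo f univ 0 - f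
      mono' := monotoneOn_univ.1
        (variationOnFromTo.sub_self_monotoneOn h.locallyBoundedVariationOn (mem_univ _))
      right_continuous' := fun t =>
        (h.continuousWithinAt_variationOnFromTo_Ici (hfc t)).sub (hfc t) }
  have hvw : ∀ t, w t = v t - f t := fun t => rfl
  have hv : ∀ s t, s ≤ t → v.measure.real (Ioc s t) = v t - v s := fun s t hst => by
    rw [measureReal_def, v.measure_Ioc, ENNReal.toReal_ofReal (sub_nonneg.2 (v.mono hst))]
  have hw : ∀ s t, s ≤ t → w.measure.real (Ioc s t) = w t - w s := fun s t hst => by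
    rw [measureReal_def, w.measure_Ioc, ENNReal.toReal_ofReal (sub_nonneg.2 (w.mono hst))]
  have hv1 : IsFiniteMeasure (v.measure.restrict (Ioc 0 T)) := ⟨by
    rw [Measure.restrict_apply_univ, v.measure_Ioc]
    exact ENNReal.ofReal_lt_top⟩
  have hw1 : IsFiniteMeasure (w.measure.restrict (Ioc 0 T)) := ⟨by
    rw [Measure.restrict_apply_univ, w.measure_Ioc]
    exact ENNReal.ofReal_lt_top⟩
  refine ⟨v.measure.restrict (Ioc 0 T), w.measure.restrict (Ioc 0 T), hv1, hw1, ?_, ?_⟩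
  · rw [measureReal_restrict_apply MeasurableSet.univ, measureReal_restrict_apply MeasurableSet.univ,
      univ_inter, hv _ _ zero_le, hw _ _ zero_le, hvw, hvw]
    have h0 : v 0 = 0 := variationOnFromTo.self _ _ _
    have hb : (eVariationOn f univ).toReal ≤ V := ENNReal.toReal_le_of_le_ofReal hV0 hle
    have h1 : v T ≤ V := ((le_abs_self _).trans (variationOnFromTo.abs_le_eVariationOn h)).trans hb
    have h2 : f 0 - f T ≤ V := by
      have := h.dist_le (mem_univ 0) (mem_univ T)
      rw [Real.dist_eq] at this
      exact ((le_abs_self _).trans this).trans hb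
    linarith
  · intro s t hst htT
    have hsub : Ioc s t ∩ Ioc 0 T = Ioc s t :=
      inter_eq_left.2 (Ioc_subset_Ioc zero_le htT)
    rw [measureReal_restrict_apply measurableSet_Ioc, measureReal_restrict_apply measurableSet_Ioc,
      hsub, hv _ _ hst, hw _ _ hst, hvw, hvw]
    simp only [hf, min_eq_left htT, min_eq_left (hst.trans htT)]
    ring

/-- The properties of the Lebesgue–Stieltjes integral of bounded Borel functions against a
right-continuous path whose variation is at most `V`, from a decomposition of the path into
monotone parts. -/
lemma exists_stieltjesIntegral_eq (hα : ∀ t, ContinuousWithinAt α (Ici t) t)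
    (hV : eVariationOn α (Iic T) ≤ ENNReal.ofReal V) (hV0 : 0 ≤ V) :
    ∃ ν₁ ν₂ : Measure ℝ≥0, IsFiniteMeasure ν₁ ∧ IsFiniteMeasure ν₂ ∧
      ν₁.real univ + ν₂.real univ ≤ 3 * V ∧
      (∀ s t, s ≤ t → t ≤ T → α t - α s = ν₁.real (Ioc s t) - ν₂.real (Ioc s t)) ∧
      ∀ k : ℝ≥0 → ℝ, Measurable k → (∃ C, ∀ t ≤ T, |k t| ≤ C) →
        IntegrableOn k (Ioc 0 T) ν₁ ∧ IntegrableOn k (Ioc 0 T) ν₂ ∧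
        stieltjesIntegral T k α = ∫ t in Ioc 0 T, k t ∂ν₁ - ∫ t in Ioc 0 T, k t ∂ν₂ := by
  obtain ⟨ν₁, ν₂, h1, h2, h3, h4⟩ := exists_measures_of_eVariationOn_le hα hV hV0
  refine ⟨ν₁, ν₂, h1, h2, h3, h4, fun k hk ⟨C, hC⟩ => ?_⟩
  have hb : ∀ ν : Measure ℝ≥0, IsFiniteMeasure ν → IntegrableOn k (Ioc 0 T) ν := fun ν _ =>
    Integrable.of_bound hk.aestronglyMeasurable C
      ((ae_restrict_iff' measurableSet_Ioc).2 (ae_of_all _ fun t ht => hC t ht.2))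
  exact ⟨hb _ h1, hb _ h2, stieltjesIntegral_eq_sub hα hV h4 (hb _ h1) (hb _ h2)⟩

section

variable (hα : ∀ t, ContinuousWithinAt α (Ici t) t)
  (hV : eVariationOn α (Iic T) ≤ ENNReal.ofReal V) (hV0 : 0 ≤ V)
include hα hV hV0

lemma stieltjesIntegral_add {k h : ℝ≥0 → ℝ} (hk : Measurable k) (hkb : ∃ C, ∀ t ≤ T, |k t| ≤ C)
    (hh : Measurable h) (hhb : ∃ C, ∀ t ≤ T, |h t| ≤ C) :
    stieltjesIntegral T (fun t => k t + h t) α =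
      stieltjesIntegral T k α + stieltjesIntegral T h α := by
  obtain ⟨ν₁, ν₂, h1, h2, -, -, h5⟩ := exists_stieltjesIntegral_eq hα hV hV0
  obtain ⟨a1, a2, a3⟩ := h5 k hk hkb
  obtain ⟨b1, b2, b3⟩ := h5 h hh hhb
  obtain ⟨C, hC⟩ := hkb
  obtain ⟨C', hC'⟩ := hhb
  rw [(h5 (fun t => k t + h t) (hk.add hh) ⟨C + C', fun t ht =>
    (abs_add_le _ _).trans (add_le_add (hC t ht) (hC' t ht))⟩).2.2, a3, b3, integral_add a1 b1,
    integral_add a2 b2]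
  ring

lemma stieltjesIntegral_const_mul {k : ℝ≥0 → ℝ} (hk : Measurable k)
    (hkb : ∃ C, ∀ t ≤ T, |k t| ≤ C) (c : ℝ) :
    stieltjesIntegral T (fun t => c * k t) α = c * stieltjesIntegral T k α := by
  obtain ⟨ν₁, ν₂, h1, h2, -, -, h5⟩ := exists_stieltjesIntegral_eq hα hV hV0
  obtain ⟨a1, a2, a3⟩ := h5 k hk hkb
  obtain ⟨C, hC⟩ := hkb
  rw [(h5 _ (hk.const_mul c) ⟨|c| * C, fun t ht => by
    rw [abs_mul]; exact mul_le_mul_of_nonneg_left (hC t ht) (abs_nonneg c)⟩).2.2, a3,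
    integral_const_mul, integral_const_mul]
  ring

lemma abs_stieltjesIntegral_le {k : ℝ≥0 → ℝ} (hk : Measurable k) {C : ℝ}
    (hkb : ∀ t ≤ T, |k t| ≤ C) : |stieltjesIntegral T k α| ≤ C * (3 * V) := by
  obtain ⟨ν₁, ν₂, h1, h2, h3, -, h5⟩ := exists_stieltjesIntegral_eq hα hV hV0
  have hC : 0 ≤ C := (abs_nonneg _).trans (hkb 0 zero_le)
  rw [(h5 k hk ⟨C, hkb⟩).2.2]
  have hb : ∀ ν : Measure ℝ≥0, IsFiniteMeasure ν →
      |∫ t in Ioc 0 T, k t ∂ν| ≤ C * ν.real univ := fun ν _ => by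
    have := norm_setIntegral_le_of_norm_le_const (μ := ν) (s := Ioc 0 T) (f := k) (C := C)
      (measure_lt_top _ _) (fun t ht => hkb t ht.2)
    exact this.trans (mul_le_mul_of_nonneg_left (measureReal_mono (subset_univ _)) hC)
  calc _ ≤ |∫ t in Ioc 0 T, k t ∂ν₁| + |∫ t in Ioc 0 T, k t ∂ν₂| := abs_sub _ _
    _ ≤ C * ν₁.real univ + C * ν₂.real univ := add_le_add (hb _ h1) (hb _ h2)
    _ = C * (ν₁.real univ + ν₂.real univ) := by ring
    _ ≤ _ := mul_le_mul_of_nonneg_left h3 hC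

lemma stieltjesIntegral_indicator_Ioc {s t : ℝ≥0} (hst : s ≤ t) (ht : t ≤ T) (c : ℝ) :
    stieltjesIntegral T ((Ioc s t).indicator fun _ => c) α = c * (α t - α s) := by
  obtain ⟨ν₁, ν₂, h1, h2, -, h4, h5⟩ := exists_stieltjesIntegral_eq hα hV hV0
  have hsub : Ioc 0 T ∩ Ioc s t = Ioc s t := inter_eq_right.2 (Ioc_subset_Ioc zero_le ht)
  rw [(h5 _ (measurable_const.indicator measurableSet_Ioc) ⟨|c|, fun r _ =>
    norm_indicator_le_norm_self (fun _ => c) r⟩).2.2, setIntegral_indicator measurableSet_Ioc,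
    setIntegral_indicator measurableSet_Ioc, hsub, setIntegral_const, setIntegral_const, h4 s t hst ht]
  simp only [smul_eq_mul]
  ring

lemma stieltjesIntegral_congr {k h : ℝ≥0 → ℝ} (hk : Measurable k) (hkb : ∃ C, ∀ t ≤ T, |k t| ≤ C)
    (hh : Measurable h) (hkh : ∀ t, 0 < t → t ≤ T → k t = h t) :
    stieltjesIntegral T k α = stieltjesIntegral T h α := by
  obtain ⟨ν₁, ν₂, h1, h2, -, -, h5⟩ := exists_stieltjesIntegral_eq hα hV hV0
  obtain ⟨C, hC⟩ := hkb
  have hhb : ∃ C, ∀ t ≤ T, |h t| ≤ C := by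
    refine ⟨max C |h 0|, fun t ht => ?_⟩
    rcases eq_or_ne t 0 with rfl | h0
    · exact le_max_right _ _
    · rw [← hkh t (pos_iff_ne_zero.2 h0) ht]
      exact (hC t ht).trans (le_max_left _ _)
  rw [(h5 k hk ⟨C, hC⟩).2.2, (h5 h hh hhb).2.2,
    setIntegral_congr_fun measurableSet_Ioc fun t ht => hkh t ht.1 ht.2,
    setIntegral_congr_fun measurableSet_Ioc fun t ht => hkh t ht.1 ht.2]

lemma tendsto_stieltjesIntegral {k : ℕ → ℝ≥0 → ℝ} {l : ℝ≥0 → ℝ} (hk : ∀ n, Measurable (k n)) {C : ℝ}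
    (hkb : ∀ n, ∀ t ≤ T, |k n t| ≤ C) (hl : Measurable l)
    (hlim : ∀ t ≤ T, Tendsto (fun n => k n t) atTop (𝓝 (l t))) :
    Tendsto (fun n => stieltjesIntegral T (k n) α) atTop (𝓝 (stieltjesIntegral T l α)) := by
  obtain ⟨ν₁, ν₂, h1, h2, -, -, h5⟩ := exists_stieltjesIntegral_eq hα hV hV0
  have hlb : ∀ t ≤ T, |l t| ≤ C := fun t ht =>
    le_of_tendsto (hlim t ht).abs (Eventually.of_forall fun n => hkb n t ht)
  rw [(h5 l hl ⟨C, hlb⟩).2.2]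
  simp_rw [fun n => (h5 (k n) (hk n) ⟨C, hkb n⟩).2.2]
  have hb : ∀ ν : Measure ℝ≥0, IsFiniteMeasure ν →
      Tendsto (fun n => ∫ t in Ioc 0 T, k n t ∂ν) atTop (𝓝 (∫ t in Ioc 0 T, l t ∂ν)) := fun ν _ => by
    refine tendsto_integral_of_dominated_convergence (fun _ => C)
      (fun n => (hk n).aestronglyMeasurable) (integrable_const _) (fun n => ?_) ?_
    · exact (ae_restrict_iff' measurableSet_Ioc).2 (ae_of_all _ fun t ht => hkb n t ht.2)
    · exact (ae_restrict_iff' measurableSet_Ioc).2 (ae_of_all _ fun t ht => hlim t ht.2)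
  exact (hb _ h1).sub (hb _ h2)

end

end Stieltjes

end

noncomputable section

section Stieltjes

variable {T : ℝ≥0} {V : ℝ} {α k : ℝ≥0 → ℝ}

lemma eVariationOn_le_of_abs_sub_le {G : ℝ≥0 → ℝ}
    (h : ∀ s t, s ≤ t → |α t - α s| ≤ G t - G s) :
    eVariationOn α (Iic T) ≤ ENNReal.ofReal (G T - G 0) := by
  have hG : Monotone G := fun s t hst => by linarith [h s t hst, abs_nonneg (α t - α s)]
  have h1 : eVariationOn α (Iic T) ≤ eVariationOn G (Iic T) := by
    refine iSup_le fun p => ?_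
    refine le_trans ?_ (eVariationOn.sum_le (f := G) (n := p.1) p.2.2.1 p.2.2.2)
    refine Finset.sum_le_sum fun i _ => ?_
    rw [edist_dist, edist_dist, Real.dist_eq, Real.dist_eq]
    exact ENNReal.ofReal_le_ofReal ((h _ _ (p.2.2.1 (Nat.le_succ i))).trans (le_abs_self _))
  refine h1.trans ?_
  have h2 := (hG.monotoneOn (Iic T)).eVariationOn_eq (a := 0) (b := T) (mem_Iic.2 zero_le)
    (mem_Iic.2 le_rfl)
  have h3 : Iic T ⊆ Icc 0 T := fun t ht => ⟨zero_le, ht⟩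
  rw [inter_eq_left.2 h3] at h2
  exact h2.le

/-- The Riemann sum of a step function. -/
lemma stieltjesIntegral_sum_indicator (hα : ∀ t, ContinuousWithinAt α (Ici t) t)
    (hV : eVariationOn α (Iic T) ≤ ENNReal.ofReal V) (hV0 : 0 ≤ V) {t : ℕ → ℝ≥0} (ht : Monotone t)
    (htT : ∀ i, t i ≤ T) (c : ℕ → ℝ) (n : ℕ) :
    stieltjesIntegral T
      (fun s => ∑ i ∈ Finset.range n, (Ioc (t i) (t (i + 1))).indicator (fun _ => c i) s) α =
      ∑ i ∈ Finset.range n, c i * (α (t (i + 1)) - α (t i)) := by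
  have hm : ∀ i, Measurable ((Ioc (t i) (t (i + 1))).indicator fun _ => c i) :=
    fun i => measurable_const.indicator measurableSet_Ioc
  have hb : ∀ i s, |(Ioc (t i) (t (i + 1))).indicator (fun _ => c i) s| ≤ |c i| :=
    fun i s => norm_indicator_le_norm_self (fun _ => c i) s
  induction n with
  | zero =>
    have := abs_stieltjesIntegral_le hα hV hV0 (k := fun _ => 0) measurable_const (C := 0) (by simp)
    simpa using this
  | succ n ih =>
    simp_rw [Finset.sum_range_succ]
    rw [stieltjesIntegral_add hα hV hV0, ih,
      stieltjesIntegral_indicator_Ioc hα hV hV0 (ht n.le_succ) (htT _)]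
    · exact Finset.measurable_sum _ fun i _ => hm i
    · exact ⟨∑ i ∈ Finset.range n, |c i|, fun s _ => (Finset.abs_sum_le_sum_abs _ _).trans
        (Finset.sum_le_sum fun i _ => hb i s)⟩
    · exact hm n
    · exact ⟨_, fun s _ => hb n s⟩

end Stieltjes

namespace IsRegularRate

variable {Ω : Type*} {mΩ : MeasurableSpace Ω} {P : Measure Ω} {𝓕 : Filtration ℝ≥0 mΩ} {T : ℝ≥0}
  {u : ℝ≥0 → Ω → ℝ} (hu : IsRegularRate 𝓕 T u)
include hu

lemma measurable_path (ω : Ω) : Measurable fun t => u t ω :=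
  (stronglyMeasurable_uncurry_of_predictable hu.predictable).measurable.comp
    measurable_prodMk_right

lemma eVariationOn_position_le (ω : Ω) : eVariationOn (fun t => position u t ω) (Iic T) ≤
    ENNReal.ofReal (∫ t in Iic T, |u t ω| ∂leb) := by
  refine (eVariationOn_le_of_abs_sub_le (G := fun t => position (fun t ω => |u t ω|) t ω)
    fun s t hst => hu.abs_position_sub_le hst ω).trans (ENNReal.ofReal_le_ofReal ?_)
  refine sub_le_self _ ?_
  exact integral_nonneg fun _ => abs_nonneg _

/-- Integration against the absolutely continuous path `∫₀ᵗ u_s ds`. -/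
lemma stieltjesIntegral_position (ω : Ω) {k : ℝ≥0 → ℝ} (hk : Measurable k)
    (hkb : ∃ C, ∀ t ≤ T, |k t| ≤ C) :
    stieltjesIntegral T k (fun t => position u t ω) = ∫ t in Iic T, k t * u t ω ∂leb := by
  have hint : ∀ w : ℝ≥0 → ℝ, Integrable w leb → IsFiniteMeasure
      (leb.withDensity fun t => (Real.toNNReal (w t) : ℝ≥0∞)) := fun w hw =>
    isFiniteMeasure_withDensity_ofReal hw.2
  have h1 := hint _ (hu.integrable ω)
  have hm := hu.measurable_path ω
  have hm' : Measurable fun t => -u t ω := hm.neg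
  have hn : Integrable (fun t => -u t ω) leb := (hu.integrable ω).neg
  have h2 := hint _ hn
  obtain ⟨C, hC⟩ := hkb
  have hkI : ∀ ν : Measure ℝ≥0, IsFiniteMeasure ν → IntegrableOn k (Ioc 0 T) ν := fun ν _ =>
    Integrable.of_bound hk.aestronglyMeasurable C
      ((ae_restrict_iff' measurableSet_Ioc).2 (ae_of_all _ fun t ht => hC t ht.2))
  have hsub : ∀ (f : ℝ≥0 → ℝ) (s : Set ℝ≥0), MeasurableSet s →
      IntegrableOn (fun t => Real.toNNReal (u t ω) • f t) s leb →
      IntegrableOn (fun t => Real.toNNReal (-u t ω) • f t) s leb →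
      ∫ t in s, f t ∂(leb.withDensity fun t => (Real.toNNReal (u t ω) : ℝ≥0∞)) -
        ∫ t in s, f t ∂(leb.withDensity fun t => (Real.toNNReal (-u t ω) : ℝ≥0∞)) =
      ∫ t in s, f t * u t ω ∂leb := by
    intro f s hs hi1 hi2
    rw [setIntegral_withDensity_eq_setIntegral_smul hm.real_toNNReal _ hs,
      setIntegral_withDensity_eq_setIntegral_smul hm'.real_toNNReal _ hs, ← integral_sub hi1 hi2]
    refine integral_congr_ae (ae_of_all _ fun t => ?_)
    simp only [NNReal.smul_def, smul_eq_mul, Real.coe_toNNReal']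
    rw [← sub_mul, max_zero_sub_max_neg_zero_eq_self, mul_comm]
  have hi : ∀ (w : ℝ≥0 → ℝ), Measurable w → Integrable w leb → ∀ (f : ℝ≥0 → ℝ) (s : Set ℝ≥0),
      IntegrableOn f s (leb.withDensity fun t => (Real.toNNReal (w t) : ℝ≥0∞)) → MeasurableSet s →
      IntegrableOn (fun t => Real.toNNReal (w t) • f t) s leb := by
    intro w hw _ f s hf hs
    rw [IntegrableOn, restrict_withDensity hs] at hf
    exact (integrable_withDensity_iff_integrable_smul hw.real_toNNReal).1 hf
  rw [stieltjesIntegral_eq_sub (fun t => (hu.continuous_position ω).continuousWithinAt)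
    (hu.eVariationOn_position_le ω)
    (ν₁ := leb.withDensity fun t => (Real.toNNReal (u t ω) : ℝ≥0∞))
    (ν₂ := leb.withDensity fun t => (Real.toNNReal (-u t ω) : ℝ≥0∞)) ?_ (hkI _ h1) (hkI _ h2),
    hsub k _ measurableSet_Ioc (hi _ hm (hu.integrable ω) _ _ (hkI _ h1) measurableSet_Ioc)
      (hi _ hm' hn _ _ (hkI _ h2) measurableSet_Ioc),
    ← integral_Icc_eq_integral_Ioc]
  · congr 2
    ext; simp
  · intro s t hst _
    have e : ∀ ν : Measure ℝ≥0, ν.real (Ioc s t) = ∫ _ in Ioc s t, (1 : ℝ) ∂ν := by simp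
    have hc : ∀ ν : Measure ℝ≥0, IsFiniteMeasure ν →
      IntegrableOn (fun _ => (1 : ℝ)) (Ioc s t) ν := fun ν _ => integrable_const _
    rw [hu.position_sub hst, e, e, hsub (fun _ => 1) _ measurableSet_Ioc
      (hi _ hm (hu.integrable ω) _ _ (hc _ h1) measurableSet_Ioc)
      (hi _ hm' hn _ _ (hc _ h2) measurableSet_Ioc)]
    simp

end IsRegularRate

section Measurability

variable {Ω : Type*} {mΩ : MeasurableSpace Ω} {T : ℝ≥0} {A : ℝ≥0 → Ω → ℝ} {Z : Ω → ℝ}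

section

variable (hAm : ∀ t, Measurable (A t)) (hα : ∀ ω t, ContinuousWithinAt (fun t => A t ω) (Ici t) t)
  (hV : ∀ ω, eVariationOn (fun t => A t ω) (Iic T) ≤ ENNReal.ofReal (Z ω)) (hZ : ∀ ω, 0 ≤ Z ω)
include hAm hα hV hZ

lemma measurable_stieltjesIntegral_indicator {E : Set (ℝ≥0 × Ω)} (hE : MeasurableSet E) :
    Measurable fun ω => stieltjesIntegral T (fun t => E.indicator (fun _ => (1 : ℝ)) (t, ω))
      (fun t => A t ω) := by
  have hbd : ∀ (E : Set (ℝ≥0 × Ω)) (q), |E.indicator (fun _ => (1 : ℝ)) q| ≤ 1 := fun E q => by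
    by_cases hq : q ∈ E <;> simp [indicator, hq]
  have hpath : ∀ (E : Set (ℝ≥0 × Ω)), MeasurableSet E → ∀ ω,
      Measurable fun t => E.indicator (fun _ => (1 : ℝ)) (t, ω) := fun E hE ω =>
    (measurable_const.indicator hE).comp measurable_prodMk_right
  have hone : ∀ ω, stieltjesIntegral T (fun _ => 1) (fun t => A t ω) = A T ω - A 0 ω := by
    intro ω
    rw [stieltjesIntegral_congr (hα ω) (hV ω) (hZ ω) (h := (Ioc 0 T).indicator fun _ => 1)
      measurable_const ⟨1, by simp⟩ (measurable_const.indicator measurableSet_Ioc)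
      (fun t h0 hT => by simp [indicator, h0, hT]),
      stieltjesIntegral_indicator_Ioc (hα ω) (hV ω) (hZ ω) zero_le le_rfl, one_mul]
  have hgen : (Prod.instMeasurableSpace : MeasurableSpace (ℝ≥0 × Ω)) =
      MeasurableSpace.generateFrom (image2 (· ×ˢ ·) (range Iic) {s | MeasurableSet s}) := by
    refine (generateFrom_eq_prod ?_ MeasurableSpace.generateFrom_measurableSet ?_
      isCountablySpanning_measurableSet).symm
    · rw [← borel_eq_generateFrom_Iic]
      exact BorelSpace.measurable_eq.symm
    · refine ⟨fun n : ℕ => Iic (n : ℝ≥0), fun n => mem_range_self _, ?_⟩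
      exact iUnion_eq_univ_iff.2 fun t => (exists_nat_ge t)
  have hpi : IsPiSystem (image2 (· ×ˢ ·) (range (Iic : ℝ≥0 → Set ℝ≥0)) {s : Set Ω | MeasurableSet s}) :=
    isPiSystem_Iic.prod MeasurableSpace.isPiSystem_measurableSet
  induction E, hE using MeasurableSpace.induction_on_inter hgen hpi with
  | empty =>
    have := fun ω => stieltjesIntegral_const_mul (hα ω) (hV ω) (hZ ω)
      (k := fun _ => 0) measurable_const ⟨0, by simp⟩ 0
    simp only [zero_mul] at this
    simp [this]
  | basic s hs =>
    obtain ⟨_, ⟨a, rfl⟩, F, hF, rfl⟩ := hs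
    have : ∀ ω, stieltjesIntegral T (fun t => (Iic a ×ˢ F).indicator (fun _ => (1 : ℝ)) (t, ω))
        (fun t => A t ω) = F.indicator (fun ω => A (min a T) ω - A 0 ω) ω := by
      intro ω
      rw [stieltjesIntegral_congr (hα ω) (hV ω) (hZ ω)
        (h := (Ioc 0 (min a T)).indicator fun _ => F.indicator (fun _ => 1) ω)
        (hpath _ (measurableSet_Iic.prod hF) ω) ⟨1, fun t _ => hbd _ _⟩
        (measurable_const.indicator measurableSet_Ioc)
        (fun t h0 hT => by
          by_cases h1 : t ≤ a <;> by_cases h2 : ω ∈ F <;> simp [indicator, h0, hT, h1, h2]),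
        stieltjesIntegral_indicator_Ioc (hα ω) (hV ω) (hZ ω) zero_le (min_le_right _ _)]
      by_cases h2 : ω ∈ F <;> simp [h2]
    simp_rw [this]
    exact ((hAm _).sub (hAm _)).indicator hF
  | compl s hs ih =>
    have : ∀ ω, stieltjesIntegral T (fun t => sᶜ.indicator (fun _ => (1 : ℝ)) (t, ω))
        (fun t => A t ω) = (A T ω - A 0 ω) + (-1) * stieltjesIntegral T
          (fun t => s.indicator (fun _ => (1 : ℝ)) (t, ω)) (fun t => A t ω) := by
      intro ω
      rw [← hone, ← stieltjesIntegral_const_mul (hα ω) (hV ω) (hZ ω) (hpath s hs ω)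
        ⟨1, fun t _ => hbd _ _⟩, ← stieltjesIntegral_add (hα ω) (hV ω) (hZ ω) measurable_const
        ⟨1, by simp⟩ ((hpath s hs ω).const_mul _) ⟨1, fun t _ => by simpa using hbd _ _⟩]
      congr 1
      ext t
      by_cases h : (t, ω) ∈ s <;> simp [h]
    simp_rw [this]
    exact ((hAm _).sub (hAm _)).add (ih.const_mul _)
  | iUnion f hd hf ih =>
    have hpart : ∀ n : ℕ, Measurable fun ω => stieltjesIntegral T
        (fun t => (⋃ i < n, f i).indicator (fun _ => (1 : ℝ)) (t, ω)) (fun t => A t ω) := by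
      intro n
      induction n with
      | zero =>
        have := fun ω => stieltjesIntegral_const_mul (hα ω) (hV ω) (hZ ω)
          (k := fun _ => 0) measurable_const ⟨0, by simp⟩ 0
        simp only [zero_mul] at this
        simp [this]
      | succ n ihn =>
        have hU : MeasurableSet (⋃ i < n, f i) :=
          MeasurableSet.iUnion fun i => MeasurableSet.iUnion fun _ => hf i
        have hdis : Disjoint (⋃ i < n, f i) (f n) := by
          simp only [disjoint_iUnion_left]
          exact fun i hi => hd hi.ne
        have hun : ⋃ i < n + 1, f i = (⋃ i < n, f i) ∪ f n := biUnion_lt_succ f n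
        rw [hun]
        have : ∀ ω, stieltjesIntegral T (fun t =>
            ((⋃ i < n, f i) ∪ f n).indicator (fun _ => (1 : ℝ)) (t, ω)) (fun t => A t ω) =
            stieltjesIntegral T (fun t => (⋃ i < n, f i).indicator (fun _ => (1 : ℝ)) (t, ω))
              (fun t => A t ω) + stieltjesIntegral T
              (fun t => (f n).indicator (fun _ => (1 : ℝ)) (t, ω)) (fun t => A t ω) := by
          intro ω
          rw [← stieltjesIntegral_add (hα ω) (hV ω) (hZ ω) (hpath _ hU ω) ⟨1, fun t _ => hbd _ _⟩
            (hpath _ (hf n) ω) ⟨1, fun t _ => hbd _ _⟩, indicator_union_of_disjoint hdis]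
        simp_rw [this]
        exact ihn.add (ih n)
    refine measurable_of_tendsto_metrizable hpart (tendsto_pi_nhds.2 fun ω => ?_)
    refine tendsto_stieltjesIntegral (hα ω) (hV ω) (hZ ω) (C := 1) (fun n => hpath _
      (MeasurableSet.iUnion fun i => MeasurableSet.iUnion fun _ => hf i) ω) (fun n t _ => hbd _ _)
      (hpath _ (MeasurableSet.iUnion hf) ω) fun t _ => ?_
    by_cases h : (t, ω) ∈ ⋃ i, f i
    · obtain ⟨i, hi⟩ := mem_iUnion.1 h
      refine tendsto_const_nhds.congr' ?_
      filter_upwards [eventually_gt_atTop i] with n hn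
      rw [indicator_of_mem h, indicator_of_mem]
      exact mem_iUnion₂.2 ⟨i, hn, hi⟩
    · refine tendsto_const_nhds.congr fun n => ?_
      rw [indicator_of_notMem h, indicator_of_notMem]
      exact fun h' => h (by obtain ⟨i, _, hi⟩ := mem_iUnion₂.1 h'; exact mem_iUnion.2 ⟨i, hi⟩)

lemma measurable_stieltjesIntegral {K : ℝ≥0 → Ω → ℝ} (hK : Measurable (Function.uncurry K))
    (hKb : ∀ ω, ∃ C, ∀ t ≤ T, |K t ω| ≤ C) :
    Measurable fun ω => stieltjesIntegral T (fun t => K t ω) (fun t => A t ω) := by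
  have hs : ∀ f : SimpleFunc (ℝ≥0 × Ω) ℝ, Measurable fun ω =>
      stieltjesIntegral T (fun t => f (t, ω)) (fun t => A t ω) := by
    intro f
    have hp : ∀ (f : SimpleFunc (ℝ≥0 × Ω) ℝ) ω, Measurable fun t => f (t, ω) := fun f ω =>
      f.measurable.comp measurable_prodMk_right
    have hb : ∀ (f : SimpleFunc (ℝ≥0 × Ω) ℝ) ω, ∃ C, ∀ t ≤ T, |f (t, ω)| ≤ C := fun f ω => by
      obtain ⟨C, hC⟩ := f.exists_forall_norm_le
      exact ⟨C, fun t _ => hC _⟩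
    induction f using SimpleFunc.induction with
    | const c hE =>
      rename_i E
      have : ∀ ω, stieltjesIntegral T (fun t => (SimpleFunc.piecewise E hE (SimpleFunc.const _ c)
          (SimpleFunc.const _ 0)) (t, ω)) (fun t => A t ω) = c * stieltjesIntegral T
            (fun t => E.indicator (fun _ => (1 : ℝ)) (t, ω)) (fun t => A t ω) := by
        intro ω
        have hE1 : Measurable fun t => E.indicator (fun _ => (1 : ℝ)) (t, ω) :=
          (measurable_const.indicator hE).comp measurable_prodMk_right
        rw [← stieltjesIntegral_const_mul (hα ω) (hV ω) (hZ ω) hE1 ⟨1, fun t _ => by by_cases hq : (t, ω) ∈ E <;> simp [indicator, hq]⟩]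
        congr 1
        ext t
        by_cases hq : (t, ω) ∈ E <;> simp [hq]
      simp_rw [this]
      exact (measurable_stieltjesIntegral_indicator hAm hα hV hZ hE).const_mul c
    | @add f g _ hf hg =>
      have : ∀ ω, stieltjesIntegral T (fun t => (f + g) (t, ω)) (fun t => A t ω) =
          stieltjesIntegral T (fun t => f (t, ω)) (fun t => A t ω) +
          stieltjesIntegral T (fun t => g (t, ω)) (fun t => A t ω) := fun ω =>
        stieltjesIntegral_add (hα ω) (hV ω) (hZ ω) (hp f ω) (hb f ω) (hp g ω) (hb g ω)
      simp_rw [this]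
      exact hf.add hg
  refine measurable_of_tendsto_metrizable
    (fun n => hs (SimpleFunc.approxOn (Function.uncurry K) hK univ 0 trivial n))
    (tendsto_pi_nhds.2 fun ω => ?_)
  obtain ⟨C, hC⟩ := hKb ω
  refine tendsto_stieltjesIntegral (hα ω) (hV ω) (hZ ω) (C := C + C)
    (fun n => (SimpleFunc.measurable _).comp measurable_prodMk_right) (fun n t ht => ?_)
    (hK.comp measurable_prodMk_right) fun t _ => ?_
  · exact (SimpleFunc.norm_approxOn_zero_le hK (mem_univ 0) (t, ω) n).trans
      (add_le_add (hC t ht) (hC t ht))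
  · exact SimpleFunc.tendsto_approxOn hK (mem_univ 0) (by simp)

end

end Measurability

end

noncomputable section

variable {Ω : Type*} {mΩ : MeasurableSpace Ω} {P : Measure Ω} {𝓕 : Filtration ℝ≥0 mΩ} {T : ℝ≥0}

/-! ### Drifts as integrators -/

/-- Two processes with right-continuous paths that agree at each time are indistinguishable. -/
lemma ae_forall_eq_of_forall_ae_eq {X Y : ℝ≥0 → Ω → ℝ}
    (hX : ∀ᵐ ω ∂P, ∀ t, ContinuousWithinAt (fun s => X s ω) (Ici t) t)
    (hY : ∀ᵐ ω ∂P, ∀ t, ContinuousWithinAt (fun s => Y s ω) (Ici t) t)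
    (h : ∀ t ≤ T, X t =ᵐ[P] Y t) : ∀ᵐ ω ∂P, ∀ t ≤ T, X t ω = Y t ω := by
  have h1 : ∀ᵐ ω ∂P, ∀ n k : ℕ,
      X (min ((k : ℝ≥0) / (n + 1)) T) ω = Y (min ((k : ℝ≥0) / (n + 1)) T) ω :=
    ae_all_iff.2 fun n => ae_all_iff.2 fun k => h _ (min_le_right _ _)
  filter_upwards [h1, hX, hY] with ω hω hXω hYω t ht
  have hlim : Tendsto (fun n => min (gridRight n t) T) atTop (𝓝[≥] t) := by
    refine tendsto_nhdsWithin_iff.2 ⟨?_, Eventually.of_forall fun n => le_min (le_gridRight n t) ht⟩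
    have := ((tendsto_nhdsWithin_iff.1 (tendsto_gridRight t)).1).min
      (tendsto_const_nhds (x := T))
    rwa [min_eq_left ht] at this
  have e : ∀ n, X (min (gridRight n t) T) ω = Y (min (gridRight n t) T) ω := fun n => hω n _
  refine tendsto_nhds_unique ((hXω t).tendsto.comp hlim) ?_
  exact ((hYω t).tendsto.comp hlim).congr fun n => (e n).symm

namespace IsDrift

variable {A : ℝ≥0 → Ω → ℝ}

lemma exists_bound (hA : IsDrift 𝓕 P T A) : ∃ Z : Ω → ℝ, MemLp Z 2 P ∧ (∀ ω, 0 ≤ Z ω) ∧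
    ∀ᵐ ω ∂P, (∀ t, ContinuousWithinAt (fun s => A s ω) (Ici t) t) ∧
      eVariationOn (fun t => A t ω) (Iic T) ≤ ENNReal.ofReal (Z ω) := by
  obtain ⟨Z, hZ, hv⟩ := hA.variation
  refine ⟨fun ω => |Z ω|, hZ.abs, fun ω => abs_nonneg _, ?_⟩
  filter_upwards [hv, hA.cadlag] with ω h1 h2
  exact ⟨fun t => (h2 t).1, h1.trans (ENNReal.ofReal_le_ofReal (le_abs_self _))⟩

lemma memS2 (hA : IsDrift 𝓕 P T A) : MemS2 𝓕 P T A := by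
  obtain ⟨Z, hZ, hZ0, hv⟩ := hA.exists_bound
  refine ⟨hA.predictable, Z, hZ, ?_⟩
  filter_upwards [hv, hA.zero] with ω h1 h0 t ht
  have h2 : edist (A t ω) (A 0 ω) ≤ ENNReal.ofReal (Z ω) :=
    (eVariationOn.edist_le _ (mem_Iic.2 ht) (mem_Iic.2 zero_le)).trans h1.2
  rw [edist_dist, h0, Real.dist_eq, sub_zero] at h2
  exact (ENNReal.ofReal_le_ofReal_iff (hZ0 ω)).1 h2

lemma stieltjesIntegral_add_const_mul (hA : IsDrift 𝓕 P T A) {K H : ℝ≥0 → Ω → ℝ}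
    (hK : MemS2 𝓕 P T K) (hH : MemS2 𝓕 P T H) (c : ℝ) :
    ∀ᵐ ω ∂P, stieltjesIntegral T (fun t => K t ω + c * H t ω) (fun t => A t ω) =
      stieltjesIntegral T (fun t => K t ω) (fun t => A t ω) +
        c * stieltjesIntegral T (fun t => H t ω) (fun t => A t ω) := by
  obtain ⟨Z, hZ, hZ0, hv⟩ := hA.exists_bound
  obtain ⟨hKp, ZK, -, hKb⟩ := hK
  obtain ⟨hHp, ZH, -, hHb⟩ := hH
  have hKm := (stronglyMeasurable_uncurry_of_predictable hKp).measurable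
  have hHm := (stronglyMeasurable_uncurry_of_predictable hHp).measurable
  filter_upwards [hv, hKb, hHb] with ω h1 h2 h3
  have m1 : Measurable fun t => K t ω := hKm.comp measurable_prodMk_right
  have m2 : Measurable fun t => H t ω := hHm.comp measurable_prodMk_right
  rw [stieltjesIntegral_add h1.1 h1.2 (hZ0 ω) m1 ⟨_, h2⟩ (m2.const_mul c) ⟨|c| * ZH ω, fun t ht => by
    rw [abs_mul]; exact mul_le_mul_of_nonneg_left (h3 t ht) (abs_nonneg c)⟩,
    stieltjesIntegral_const_mul h1.1 h1.2 (hZ0 ω) m2 ⟨_, h3⟩]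

lemma integrable_stieltjesIntegral (h𝓕 : UsualConditions 𝓕 P) (hA : IsDrift 𝓕 P T A)
    {K : ℝ≥0 → Ω → ℝ} (hK : MemS2 𝓕 P T K) :
    Integrable (fun ω => stieltjesIntegral T (fun t => K t ω) (fun t => A t ω)) P := by
  obtain ⟨Z, hZ, hZ0, hv⟩ := hA.exists_bound
  obtain ⟨hKp, ZK, hZK, hKb⟩ := hK
  have hKm := (stronglyMeasurable_uncurry_of_predictable hKp).measurable
  set G : Set Ω := {ω | ((∀ t, ContinuousWithinAt (fun s => A s ω) (Ici t) t) ∧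
      eVariationOn (fun t => A t ω) (Iic T) ≤ ENNReal.ofReal (Z ω)) ∧ ∀ t ≤ T, |K t ω| ≤ ZK ω}
  have hGae : ∀ᵐ ω ∂P, ω ∈ G := by filter_upwards [hv, hKb] with ω h1 h2 using ⟨h1, h2⟩
  have hG : MeasurableSet G := by
    have := 𝓕.le 0 _ (h𝓕.complete Gᶜ hGae)
    exact (compl_compl G) ▸ this.compl
  have hm : Measurable fun ω => stieltjesIntegral T (fun t => G.indicator (K t) ω)
      (fun t => G.indicator (A t) ω) := by
    refine measurable_stieltjesIntegral (Z := Z) (fun t => ?_) (fun ω t => ?_) (fun ω => ?_) hZ0 ?_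
      (fun ω => ?_)
    · exact ((hA.predictable.stronglyAdapted t).mono (𝓕.le t)).measurable.indicator hG
    · by_cases h : ω ∈ G
      · simpa [h] using h.1.1 t
      · simpa [h] using continuousWithinAt_const
    · by_cases h : ω ∈ G
      · simpa [h] using h.1.2
      · have : eVariationOn (fun _ : ℝ≥0 => (0 : ℝ)) (Iic T) = 0 :=
          eVariationOn.constant_on (by rintro _ ⟨_, _, rfl⟩ _ ⟨_, _, rfl⟩; rfl)
        simp [h, this]
    · have : Function.uncurry (fun t => G.indicator (K t)) =
          (univ ×ˢ G).indicator (Function.uncurry K) := by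
        ext ⟨t, ω⟩
        by_cases h : ω ∈ G <;> simp [indicator, h]
      rw [this]
      exact hKm.indicator (MeasurableSet.univ.prod hG)
    · by_cases h : ω ∈ G
      · exact ⟨ZK ω, fun t ht => by simpa [h] using h.2 t ht⟩
      · exact ⟨0, fun t ht => by simp [h]⟩
  have hae : (fun ω => stieltjesIntegral T (fun t => G.indicator (K t) ω)
      (fun t => G.indicator (A t) ω)) =ᵐ[P]
      fun ω => stieltjesIntegral T (fun t => K t ω) (fun t => A t ω) := by
    filter_upwards [hGae] with ω h
    simp [h]
  refine Integrable.mono' (g := fun ω => ZK ω * (3 * Z ω)) ?_ (hm.aestronglyMeasurable.congr hae) ?_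
  · exact MemLp.integrable_mul hZK (hZ.const_mul 3)
  · filter_upwards [hGae] with ω h
    exact abs_stieltjesIntegral_le h.1.1 h.1.2 (hZ0 ω) (hKm.comp measurable_prodMk_right) h.2

end IsDrift

/-- The absolutely continuous process with a square-integrable density is a drift. -/
lemma IsRegularRate.isDrift_position [IsProbabilityMeasure P] {g : ℝ≥0 → Ω → ℝ}
    (hg : IsRegularRate 𝓕 T g) (hg2 : MemL2 𝓕 P T g) : IsDrift 𝓕 P T (position g) where
  predictable := hg.predictable_position
  cadlag := ae_of_all _ fun ω t => ⟨(hg.continuous_position ω).continuousWithinAt, _,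
    ((hg.continuous_position ω).tendsto t).mono_left nhdsWithin_le_nhds⟩
  zero := ae_of_all _ fun ω => by
    have : Iic (0 : ℝ≥0) = {0} := by ext; simp
    rw [position, this]
    exact setIntegral_measure_zero _ (leb_singleton 0)
  variation := ⟨_, memLp_integral_abs hg2, ae_of_all _ hg.eVariationOn_position_le⟩

/-- The step function on the `n`-th grid that takes the value `c i` on the `i`-th interval of the
grid, cut off at the horizon. -/
def gridStep (T : ℝ≥0) (n : ℕ) (c : ℕ → ℝ) (s : ℝ≥0) : ℝ :=
  ∑ i ∈ Finset.range ⌈((n : ℝ≥0) + 1) * T⌉₊,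
    (Ioc (min ((i : ℝ≥0) / (n + 1)) T) (min (((i + 1 : ℕ) : ℝ≥0) / (n + 1)) T)).indicator
      (fun _ => c i) s

lemma measurable_gridStep (n : ℕ) (c : ℕ → ℝ) : Measurable (gridStep T n c) :=
  Finset.measurable_sum _ fun _ _ => measurable_const.indicator measurableSet_Ioc

/-- At a time `s` in `(0, T]` the step function takes the value of the interval that ends
at `gridRight n s`. -/
lemma exists_gridStep_eq (n : ℕ) {s : ℝ≥0} (h0 : 0 < s) (hs : s ≤ T) :
    ∃ i : ℕ, gridRight n s = ((i + 1 : ℕ) : ℝ≥0) / (n + 1) ∧ ∀ c, gridStep T n c s = c i := by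
  have hpos : 0 < ⌈((n : ℝ≥0) + 1) * s⌉₊ := Nat.ceil_pos.2 (by positivity)
  have hcs : ⌈((n : ℝ≥0) + 1) * s⌉₊ - 1 + 1 = ⌈((n : ℝ≥0) + 1) * s⌉₊ := Nat.sub_add_cancel hpos
  refine ⟨⌈((n : ℝ≥0) + 1) * s⌉₊ - 1, by rw [hcs, gridRight], fun c => ?_⟩
  have hmem : ∀ j : ℕ, s ∈ Ioc (min ((j : ℝ≥0) / (n + 1)) T)
      (min (((j + 1 : ℕ) : ℝ≥0) / (n + 1)) T) ↔ j = ⌈((n : ℝ≥0) + 1) * s⌉₊ - 1 := by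
    intro j
    rw [mem_Ioc, min_lt_iff, le_min_iff, or_iff_left (not_lt.2 hs), and_iff_left hs,
      div_lt_iff₀ (by positivity), le_div_iff₀ (by positivity), mul_comm s]
    have : ((j : ℝ≥0) < (n + 1) * s ∧ (n + 1) * s ≤ ((j + 1 : ℕ) : ℝ≥0)) ↔
        ⌈((n : ℝ≥0) + 1) * s⌉₊ = j + 1 := by
      rw [Nat.ceil_eq_iff (by simp)]
      simp
    rw [this]
    omega
  rw [gridStep, Finset.sum_eq_single (⌈((n : ℝ≥0) + 1) * s⌉₊ - 1)]
  · exact indicator_of_mem ((hmem _).2 rfl) _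
  · intro j _ hj
    exact indicator_of_notMem (fun h => hj ((hmem j).1 h)) _
  · intro h
    refine absurd (Finset.mem_range.2 ?_) h
    have : ⌈((n : ℝ≥0) + 1) * s⌉₊ ≤ ⌈((n : ℝ≥0) + 1) * T⌉₊ := Nat.ceil_mono (by gcongr)
    omega

lemma gridStep_zero (n : ℕ) (c : ℕ → ℝ) : gridStep T n c 0 = 0 :=
  Finset.sum_eq_zero fun _ _ => indicator_of_notMem (by simp) _

end

noncomputable section

variable {Ω : Type*} {mΩ : MeasurableSpace Ω} {P : Measure Ω} {𝓕 : Filtration ℝ≥0 mΩ} {T : ℝ≥0}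

/-! ### A drift is determined by its integrals -/

/-- Summation by parts for two Riemann sums of a path against itself. -/
lemma sum_left_add_sum_right (b : ℕ → ℝ) (n : ℕ) :
    ∑ i ∈ Finset.range n, b i * (b (i + 1) - b i) +
      ∑ i ∈ Finset.range n, b (i + 1) * (b (i + 1) - b i) = b n ^ 2 - b 0 ^ 2 := by
  rw [← Finset.sum_add_distrib, ← Finset.sum_range_sub (fun i => b i ^ 2)]
  exact Finset.sum_congr rfl fun i _ => by ring

lemma abs_gridStep_le {n : ℕ} {c : ℕ → ℝ} {C : ℝ} (hc : ∀ i, |c i| ≤ C) {s : ℝ≥0} (hs : s ≤ T) :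
    |gridStep T n c s| ≤ C := by
  rcases eq_or_ne s 0 with rfl | h0
  · rw [gridStep_zero, abs_zero]
    exact (abs_nonneg _).trans (hc 0)
  · obtain ⟨i, -, hi⟩ := exists_gridStep_eq n (pos_iff_ne_zero.2 h0) hs
    rw [hi]
    exact hc i

/-- The grid points, cut off at the horizon. -/
def gridPoint (T : ℝ≥0) (n i : ℕ) : ℝ≥0 := min ((i : ℝ≥0) / (n + 1)) T

lemma gridPoint_le (n i : ℕ) : gridPoint T n i ≤ T := min_le_right _ _

lemma monotone_gridPoint (n : ℕ) : Monotone (gridPoint T n) := fun i j hij =>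
  min_le_min_right T (by gcongr)

@[simp] lemma gridPoint_zero (n : ℕ) : gridPoint T n 0 = 0 := by simp [gridPoint]

lemma gridPoint_last (n : ℕ) : gridPoint T n ⌈((n : ℝ≥0) + 1) * T⌉₊ = T := by
  refine min_eq_right ?_
  rw [le_div_iff₀ (by positivity), mul_comm]
  exact Nat.le_ceil _

lemma stieltjesIntegral_gridStep {α : ℝ≥0 → ℝ} {V : ℝ}
    (hα : ∀ t, ContinuousWithinAt α (Ici t) t)
    (hV : eVariationOn α (Iic T) ≤ ENNReal.ofReal V) (hV0 : 0 ≤ V) (n : ℕ) (c : ℕ → ℝ) :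
    stieltjesIntegral T (gridStep T n c) α = ∑ i ∈ Finset.range ⌈((n : ℝ≥0) + 1) * T⌉₊,
      c i * (α (gridPoint T n (i + 1)) - α (gridPoint T n i)) :=
  stieltjesIntegral_sum_indicator hα hV hV0 (monotone_gridPoint n) (gridPoint_le n) c _

/-- Sampling a right-continuous path at the right end points of the grid. -/
lemma tendsto_gridStep {b : ℝ≥0 → ℝ} (hb : ∀ t, ContinuousWithinAt b (Ici t) t) (h0 : b 0 = 0)
    {s : ℝ≥0} (hs : s ≤ T) :
    Tendsto (fun n => gridStep T n (fun i => b (gridPoint T n (i + 1))) s) atTop (𝓝 (b s)) := by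
  rcases eq_or_ne s 0 with rfl | hs0
  · simp [gridStep_zero, h0]
  · have e : ∀ n, gridStep T n (fun i => b (gridPoint T n (i + 1))) s = b (min (gridRight n s) T) := by
      intro n
      obtain ⟨i, hi, h⟩ := exists_gridStep_eq n (pos_iff_ne_zero.2 hs0) hs
      rw [h, hi, gridPoint]
    simp_rw [e]
    have hlim : Tendsto (fun n => min (gridRight n s) T) atTop (𝓝[≥] s) := by
      refine tendsto_nhdsWithin_iff.2
        ⟨?_, Eventually.of_forall fun n => le_min (le_gridRight n s) hs⟩
      have := ((tendsto_nhdsWithin_iff.1 (tendsto_gridRight s)).1).min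
        (tendsto_const_nhds (x := T))
      rwa [min_eq_left hs] at this
    exact (hb s).tendsto.comp hlim

/-- The step process that samples a bounded process at the left end points of the grid. -/
lemma MemS2.gridStep {B : ℝ≥0 → Ω → ℝ} (hB : MemS2 𝓕 P T B) (n : ℕ) :
    MemS2 𝓕 P T fun s ω => gridStep T n (fun i => B (gridPoint T n i) ω) s := by
  obtain ⟨hp, Z, hZ, hBZ⟩ := hB
  refine ⟨?_, Z, hZ, ?_⟩
  · exact @Finset.stronglyMeasurable_fun_sum (ℝ≥0 × Ω) ℝ _ _ _ 𝓕.predictable _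
      (fun i (q : ℝ≥0 × Ω) => (Ioc (gridPoint T n i) (gridPoint T n (i + 1))).indicator
        (fun _ => B (gridPoint T n i) q.2) q.1) (Finset.range ⌈((n : ℝ≥0) + 1) * T⌉₊)
      fun i _ => isStronglyPredictable_indicator_Ioc (hp.stronglyAdapted (gridPoint T n i))
  · filter_upwards [hBZ] with ω hω s hs
    exact abs_gridStep_le (fun i => hω _ (gridPoint_le n i)) hs

/-- Two drifts that give the same expected integrals of all processes in `𝓢²` are
indistinguishable. The difference `B` satisfies `B_T² = ∑ B_{t_i} ΔB_i + ∑ B_{t_{i+1}} ΔB_i` along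
a grid. The first sum has mean `0`, and the second one converges to the integral of the
predictable process `B` against `dB`, which also has mean `0`. Hence `B_T = 0`, and testing with
`B_t 1_{(t, T]}` gives `B_t = 0`. -/
theorem IsDrift.ae_eq_of_integral_eq (h𝓕 : UsualConditions 𝓕 P) {A G : ℝ≥0 → Ω → ℝ}
    (hA : IsDrift 𝓕 P T A) (hG : IsDrift 𝓕 P T G)
    (h : ∀ H : ℝ≥0 → Ω → ℝ, MemS2 𝓕 P T H →
      ∫ ω, stieltjesIntegral T (fun t => H t ω) (fun t => A t ω) ∂P =
        ∫ ω, stieltjesIntegral T (fun t => H t ω) (fun t => G t ω) ∂P) :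
    ∀ᵐ ω ∂P, ∀ t ≤ T, A t ω = G t ω := by
  set B : ℝ≥0 → Ω → ℝ := fun t ω => A t ω - G t ω with hBdef
  set Φ : (ℝ≥0 → ℝ) → Ω → ℝ := fun k ω =>
    stieltjesIntegral T k (fun t => A t ω) - stieltjesIntegral T k (fun t => G t ω) with hΦ
  have hB : MemS2 𝓕 P T B := hA.memS2.sub hG.memS2
  have hint : ∀ H : ℝ≥0 → Ω → ℝ, MemS2 𝓕 P T H →
      Integrable (fun ω => Φ (fun t => H t ω) ω) P := fun H hH =>
    (hA.integrable_stieltjesIntegral h𝓕 hH).sub (hG.integrable_stieltjesIntegral h𝓕 hH)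
  have hzero : ∀ H : ℝ≥0 → Ω → ℝ, MemS2 𝓕 P T H → ∫ ω, Φ (fun t => H t ω) ω ∂P = 0 := by
    intro H hH
    have := integral_sub (hA.integrable_stieltjesIntegral h𝓕 hH)
      (hG.integrable_stieltjesIntegral h𝓕 hH)
    rw [hΦ]
    rw [this, h H hH, sub_self]
  obtain ⟨ZA, hZA, hZA0, hvA⟩ := hA.exists_bound
  obtain ⟨ZG, hZG, hZG0, hvG⟩ := hG.exists_bound
  have hB0 : ∀ᵐ ω ∂P, B 0 ω = 0 := by
    filter_upwards [hA.zero, hG.zero] with ω h1 h2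
    simp [hBdef, h1, h2]
  have hBc : ∀ᵐ ω ∂P, ∀ t, ContinuousWithinAt (fun s => B s ω) (Ici t) t := by
    filter_upwards [hvA, hvG] with ω h1 h2 t
    exact (h1.1 t).sub (h2.1 t)
  have hBm : ∀ ω, Measurable fun t => B t ω := fun ω =>
    (stronglyMeasurable_uncurry_of_predictable hB.1).measurable.comp measurable_prodMk_right
  have hstep : ∀ᵐ ω ∂P, ∀ n c, Φ (gridStep T n c) ω =
      ∑ i ∈ Finset.range ⌈((n : ℝ≥0) + 1) * T⌉₊,
        c i * (B (gridPoint T n (i + 1)) ω - B (gridPoint T n i) ω) := by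
    filter_upwards [hvA, hvG] with ω h1 h2 n c
    simp only [hΦ, hBdef]
    rw [stieltjesIntegral_gridStep h1.1 h1.2 (hZA0 ω), stieltjesIntegral_gridStep h2.1 h2.2 (hZG0 ω),
      ← Finset.sum_sub_distrib]
    exact Finset.sum_congr rfl fun i _ => by ring
  obtain ⟨ZB, hZB, hBZ⟩ := hB.2
  have hBT : B T =ᵐ[P] 0 := by
    set L : ℕ → Ω → ℝ := fun n ω => Φ (gridStep T n fun i => B (gridPoint T n i) ω) ω with hL
    set R : ℕ → Ω → ℝ := fun n ω => Φ (gridStep T n fun i => B (gridPoint T n (i + 1)) ω) ω with hR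
    have hsq : Integrable (fun ω => B T ω ^ 2) P := (hB.memLp_apply le_rfl).integrable_sq
    have hLint : ∀ n, Integrable (L n) P := fun n => hint _ (hB.gridStep n)
    have hRL : ∀ n, (fun ω => B T ω ^ 2 - L n ω) =ᵐ[P] R n := by
      intro n
      filter_upwards [hstep, hB0] with ω h1 h0
      have e := sum_left_add_sum_right (fun i => B (gridPoint T n i) ω) ⌈((n : ℝ≥0) + 1) * T⌉₊
      rw [gridPoint_last, gridPoint_zero, h0] at e
      simp only [hL, hR, h1]
      linarith
    have hRe : ∀ n, ∫ ω, R n ω ∂P = ∫ ω, B T ω ^ 2 ∂P := by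
      intro n
      rw [← integral_congr_ae (hRL n), integral_sub hsq (hLint n), hzero _ (hB.gridStep n), sub_zero]
    have hlim : Tendsto (fun n => ∫ ω, R n ω ∂P) atTop (𝓝 (∫ ω, Φ (fun t => B t ω) ω ∂P)) := by
      refine tendsto_integral_of_dominated_convergence
        (fun ω => ZB ω * (3 * ZA ω) + ZB ω * (3 * ZG ω)) (fun n => ?_) ?_ (fun n => ?_) ?_
      · exact (hsq.sub (hLint n)).aestronglyMeasurable.congr (hRL n)
      · exact (MemLp.integrable_mul hZB (hZA.const_mul 3)).add
          (MemLp.integrable_mul hZB (hZG.const_mul 3))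
      · filter_upwards [hvA, hvG, hBZ] with ω h1 h2 h3
        have hb : ∀ s ≤ T, |gridStep T n (fun i => B (gridPoint T n (i + 1)) ω) s| ≤ ZB ω :=
          fun s hs => abs_gridStep_le (fun i => h3 _ (gridPoint_le n _)) hs
        exact (abs_sub _ _).trans (add_le_add
          (abs_stieltjesIntegral_le h1.1 h1.2 (hZA0 ω) (measurable_gridStep n _) hb)
          (abs_stieltjesIntegral_le h2.1 h2.2 (hZG0 ω) (measurable_gridStep n _) hb))
      · filter_upwards [hvA, hvG, hBZ, hB0, hBc] with ω h1 h2 h3 h4 h5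
        have hb : ∀ n, ∀ s ≤ T, |gridStep T n (fun i => B (gridPoint T n (i + 1)) ω) s| ≤ ZB ω :=
          fun n s hs => abs_gridStep_le (fun i => h3 _ (gridPoint_le n _)) hs
        exact (tendsto_stieltjesIntegral h1.1 h1.2 (hZA0 ω) (fun n => measurable_gridStep n _) hb
          (hBm ω) fun t ht => tendsto_gridStep h5 h4 ht).sub
          (tendsto_stieltjesIntegral h2.1 h2.2 (hZG0 ω) (fun n => measurable_gridStep n _) hb
          (hBm ω) fun t ht => tendsto_gridStep h5 h4 ht)
    rw [hzero B hB] at hlim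
    simp_rw [hRe] at hlim
    have h0 : ∫ ω, B T ω ^ 2 ∂P = 0 := tendsto_nhds_unique tendsto_const_nhds hlim
    have h1 := (integral_eq_zero_iff_of_nonneg (fun ω => sq_nonneg (B T ω)) hsq).1 h0
    filter_upwards [h1] with ω hω
    exact pow_eq_zero_iff (two_ne_zero) |>.1 hω
  have hBt : ∀ t ≤ T, B t =ᵐ[P] 0 := by
    intro t ht
    have hH : MemS2 𝓕 P T fun r ω => (Ioc t T).indicator (fun _ => B t ω) r := by
      refine ⟨isStronglyPredictable_indicator_Ioc (hB.1.stronglyAdapted t), ZB, hZB, ?_⟩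
      filter_upwards [hBZ] with ω hω s hs
      exact (norm_indicator_le_norm_self (fun _ => B t ω) s).trans (hω t ht)
    have hsq : Integrable (fun ω => B t ω ^ 2) P := (hB.memLp_apply ht).integrable_sq
    have e : (fun ω => Φ (fun r => (Ioc t T).indicator (fun _ => B t ω) r) ω) =ᵐ[P]
        fun ω => - B t ω ^ 2 := by
      filter_upwards [hvA, hvG, hBT] with ω h1 h2 h3
      simp only [hΦ]
      rw [stieltjesIntegral_indicator_Ioc h1.1 h1.2 (hZA0 ω) ht le_rfl,
        stieltjesIntegral_indicator_Ioc h2.1 h2.2 (hZG0 ω) ht le_rfl]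
      have h3' : A T ω - G T ω = 0 := h3
      simp only [hBdef]
      linear_combination (A t ω - G t ω) * h3'
    have h0 := hzero _ hH
    rw [integral_congr_ae e, integral_neg, neg_eq_zero] at h0
    have h1 := (integral_eq_zero_iff_of_nonneg (fun ω => sq_nonneg (B t ω)) hsq).1 h0
    filter_upwards [h1] with ω hω
    exact pow_eq_zero_iff (two_ne_zero) |>.1 hω
  refine ae_forall_eq_of_forall_ae_eq ?_ ?_ fun t ht => ?_
  · exact hvA.mono fun ω h => h.1
  · exact hvG.mono fun ω h => h.1
  · filter_upwards [hBt t ht] with ω hω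
    exact sub_eq_zero.1 hω

end

noncomputable section

variable {Ω : Type*} {mΩ : MeasurableSpace Ω} {P : Measure Ω} {𝓕 : Filtration ℝ≥0 mΩ} {T : ℝ≥0}

/-! ### Paths along the dyadic times -/

/-- The `j`-th dyadic time of level `n`. -/
def dyadic (n j : ℕ) : ℝ≥0 := (j : ℝ≥0) / 2 ^ n

/-- The set of dyadic times. -/
def dyadics : Set ℝ≥0 := {q | ∃ n j, q = dyadic n j}

lemma dyadic_le_dyadic {n i j : ℕ} : dyadic n i ≤ dyadic n j ↔ i ≤ j := by
  rw [dyadic, dyadic, div_le_div_iff_of_pos_right (by positivity), Nat.cast_le]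

lemma dyadic_lt_dyadic {n i j : ℕ} : dyadic n i < dyadic n j ↔ i < j := by
  rw [dyadic, dyadic, div_lt_div_iff_of_pos_right (by positivity), Nat.cast_lt]

lemma dyadic_monotone (n : ℕ) : Monotone (dyadic n) := fun _ _ h => dyadic_le_dyadic.2 h

lemma dyadic_add (n k j : ℕ) : dyadic n j = dyadic (n + k) (j * 2 ^ k) := by
  rw [dyadic, dyadic, div_eq_div_iff (by positivity) (by positivity)]
  push_cast
  ring

lemma eventually_eq_dyadic {q : ℝ≥0} (hq : q ∈ dyadics) : ∀ᶠ n in atTop, ∃ j, q = dyadic n j := by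
  obtain ⟨n, j, rfl⟩ := hq
  filter_upwards [eventually_ge_atTop n] with m hm
  obtain ⟨k, rfl⟩ := Nat.exists_eq_add_of_le hm
  exact ⟨_, dyadic_add n k j⟩

/-- The dyadic time of level `n` that follows `t`. -/
def nextDyadic (n : ℕ) (t : ℝ≥0) : ℝ≥0 := dyadic n (⌊t * 2 ^ n⌋₊ + 1)

lemma lt_nextDyadic (n : ℕ) (t : ℝ≥0) : t < nextDyadic n t := by
  rw [nextDyadic, dyadic, lt_div_iff₀ (by positivity)]
  exact_mod_cast Nat.lt_floor_add_one (t * 2 ^ n)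

lemma nextDyadic_le (n : ℕ) (t : ℝ≥0) : nextDyadic n t ≤ t + (1 / 2) ^ n := by
  rw [nextDyadic, dyadic, div_le_iff₀ (by positivity), add_mul, ← mul_pow]
  have : (⌊t * 2 ^ n⌋₊ : ℝ≥0) ≤ t * 2 ^ n := Nat.floor_le zero_le
  simpa using this

lemma nextDyadic_mem (n : ℕ) (t : ℝ≥0) : nextDyadic n t ∈ dyadics := ⟨_, _, rfl⟩

lemma tendsto_nextDyadic (t : ℝ≥0) :
    Tendsto (fun n => nextDyadic n t) atTop (𝓝[dyadics ∩ Ioi t] t) := by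
  refine tendsto_nhdsWithin_iff.2
    ⟨?_, Eventually.of_forall fun n => ⟨nextDyadic_mem n t, lt_nextDyadic n t⟩⟩
  refine tendsto_of_tendsto_of_tendsto_of_le_of_le tendsto_const_nhds ?_
    (fun n => (lt_nextDyadic n t).le) (fun n => nextDyadic_le n t)
  have : Tendsto (fun n : ℕ => ((1 : ℝ≥0) / 2) ^ n) atTop (𝓝 0) :=
    NNReal.tendsto_pow_atTop_nhds_zero_of_lt_one (by rw [← NNReal.coe_lt_coe]; push_cast; norm_num)
  simpa using tendsto_const_nhds.add this

instance (t : ℝ≥0) : (𝓝[dyadics ∩ Ioi t] t).NeBot := (tendsto_nextDyadic t).neBot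

/-- If the right limits `M` of a path `x` along the dyadic times exist, then `M` inherits the limits
of `x` from either side. -/
lemma tendsto_of_forall_tendsto_dyadics {x M : ℝ≥0 → ℝ}
    (hM : ∀ s, Tendsto x (𝓝[dyadics ∩ Ioi s] s) (𝓝 (M s))) {O : Set ℝ≥0} (hO : IsOpen O) {t : ℝ≥0}
    {l : ℝ} (h : Tendsto x (𝓝[dyadics ∩ O] t) (𝓝 l)) : Tendsto M (𝓝[O] t) (𝓝 l) := by
  refine (closed_nhds_basis l).tendsto_right_iff.2 fun V ⟨hV, hVc⟩ => ?_
  obtain ⟨W, hW, htW, hWV⟩ := mem_nhdsWithin.1 (h hV)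
  refine mem_nhdsWithin.2 ⟨W, hW, htW, fun s ⟨hsW, hsO⟩ => ?_⟩
  refine hVc.mem_of_tendsto (hM s) ?_
  filter_upwards [self_mem_nhdsWithin, mem_nhdsWithin_of_mem_nhds ((hW.inter hO).mem_nhds ⟨hsW, hsO⟩)]
    with q hq1 hq2
  exact hWV ⟨hq2.1, hq1.1, hq2.2⟩

/-- `UpcrossingChain x a b k l r`: the path `x` passes at least `k` times from below `a` to
above `b` along dyadic times between `l` and `r`. -/
def UpcrossingChain (x : ℝ≥0 → ℝ) (a b : ℝ) : ℕ → ℝ≥0 → ℝ≥0 → Prop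
  | 0, l, r => l ≤ r
  | k + 1, l, r => ∃ m q₁ q₂, UpcrossingChain x a b k l m ∧ q₁ ∈ dyadics ∧ q₂ ∈ dyadics ∧ m < q₁ ∧
      q₁ < q₂ ∧ q₂ < r ∧ x q₁ < a ∧ b < x q₂

namespace UpcrossingChain

variable {x : ℝ≥0 → ℝ} {a b : ℝ}

lemma prepend {k : ℕ} {l m r q₁ q₂ : ℝ≥0} (h1 : q₁ ∈ dyadics) (h2 : q₂ ∈ dyadics) (hl : l < q₁)
    (h12 : q₁ < q₂) (hm : q₂ < m) (ha : x q₁ < a) (hb : b < x q₂)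
    (h : UpcrossingChain x a b k m r) : UpcrossingChain x a b (k + 1) l r := by
  induction k generalizing r with
  | zero => exact ⟨l, q₁, q₂, le_rfl, h1, h2, hl, h12, hm.trans_le h, ha, hb⟩
  | succ k ih =>
    obtain ⟨m', p₁, p₂, hc, hp⟩ := h
    exact ⟨m', p₁, p₂, ih hc, hp⟩

lemma le {k : ℕ} {l r : ℝ≥0} (h : UpcrossingChain x a b k l r) : l ≤ r := by
  induction k generalizing r with
  | zero => exact h
  | succ k ih =>
    obtain ⟨m, p₁, p₂, hc, -, -, h1, h2, h3, -⟩ := h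
    exact (ih hc).trans (h1.trans (h2.trans h3)).le

lemma mono_right {k : ℕ} {l r r' : ℝ≥0} (h : UpcrossingChain x a b k l r) (hr : r ≤ r') :
    UpcrossingChain x a b k l r' := by
  cases k with
  | zero => exact h.le.trans hr
  | succ k =>
    obtain ⟨m, p₁, p₂, hc, h1, h2, h3, h4, h5, h6⟩ := h
    exact ⟨m, p₁, p₂, hc, h1, h2, h3, h4, h5.trans_le hr, h6⟩

lemma mono_left {k : ℕ} {l l' r : ℝ≥0} (h : UpcrossingChain x a b k l r) (hl : l' ≤ l) :
    UpcrossingChain x a b k l' r := by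
  induction k generalizing r with
  | zero => exact hl.trans h.le
  | succ k ih =>
    obtain ⟨m, p₁, p₂, hc, h⟩ := h
    exact ⟨m, p₁, p₂, ih hc, h⟩

/-- A chain of upcrossings is seen by the upcrossing counts along all sufficiently fine grids. -/
lemma eventually_le_upcrossingsBefore (hab : a < b) {Z : ℝ≥0 → Ω → ℝ} {ω : Ω} {k : ℕ} {l r : ℝ≥0}
    (h : UpcrossingChain (fun t => Z t ω) a b k l r) :
    ∀ᶠ n in atTop, ∀ j, r ≤ dyadic n j →
      k ≤ upcrossingsBefore a b (fun i => Z (dyadic n i)) j ω := by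
  induction k generalizing r with
  | zero => exact Eventually.of_forall fun _ _ _ => zero_le
  | succ k ih =>
    obtain ⟨m, q₁, q₂, hc, h1, h2, h3, h4, h5, h6, h7⟩ := h
    filter_upwards [ih hc, eventually_eq_dyadic h1, eventually_eq_dyadic h2] with n hn h1n h2n j hj
    obtain ⟨j₁, rfl⟩ := h1n
    obtain ⟨j₂, rfl⟩ := h2n
    have h8 := upcrossingsBefore_lt_of_exists_upcrossing (f := fun i => Z (dyadic n i)) (ω := ω) hab
      (le_refl j₁) h6 (dyadic_lt_dyadic.1 h4).le h7
    have h9 : j₂ + 1 ≤ j := dyadic_lt_dyadic.1 (h5.trans_le hj)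
    exact (Nat.succ_le_of_lt ((hn j₁ h3.le).trans_lt h8)).trans (upcrossingsBefore_mono hab h9 ω)

/-- A path that oscillates immediately after time `t` has arbitrarily many upcrossings there. -/
lemma of_frequently_right {t r : ℝ≥0} (htr : t < r)
    (h1 : ∃ᶠ q in 𝓝[dyadics ∩ Ioi t] t, x q < a) (h2 : ∃ᶠ q in 𝓝[dyadics ∩ Ioi t] t, b < x q)
    (k : ℕ) : ∃ l, t < l ∧ UpcrossingChain x a b k l r := by
  have hpick : ∀ {p : ℝ≥0 → Prop} {s : ℝ≥0}, t < s → (∃ᶠ q in 𝓝[dyadics ∩ Ioi t] t, p q) →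
      ∃ q ∈ dyadics, t < q ∧ q < s ∧ p q := by
    intro p s hs hp
    obtain ⟨q, hq, hq1, hq2⟩ := (hp.and_eventually (inter_mem
      (mem_nhdsWithin_of_mem_nhds (Iio_mem_nhds hs)) self_mem_nhdsWithin)).exists
    exact ⟨q, hq2.1, hq2.2, hq1, hq⟩
  induction k with
  | zero =>
    obtain ⟨l, hl, hlr⟩ := exists_between htr
    exact ⟨l, hl, hlr.le⟩
  | succ k ih =>
    obtain ⟨m, hm, hc⟩ := ih
    obtain ⟨q₂, hq2, ht2, hm2, hb⟩ := hpick hm h2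
    obtain ⟨q₁, hq1, ht1, h12, ha⟩ := hpick ht2 h1
    obtain ⟨l, hl, hl1⟩ := exists_between ht1
    exact ⟨l, hl, hc.prepend hq1 hq2 hl1 h12 hm2 ha hb⟩

/-- A path that oscillates immediately before time `t` has arbitrarily many upcrossings there. -/
lemma of_frequently_left {t : ℝ≥0}
    (h1 : ∃ᶠ q in 𝓝[dyadics ∩ Iio t] t, x q < a) (h2 : ∃ᶠ q in 𝓝[dyadics ∩ Iio t] t, b < x q)
    (k : ℕ) : ∃ r, r < t ∧ UpcrossingChain x a b k 0 r := by
  have hpick : ∀ {p : ℝ≥0 → Prop} {s : ℝ≥0}, s < t → (∃ᶠ q in 𝓝[dyadics ∩ Iio t] t, p q) →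
      ∃ q ∈ dyadics, s < q ∧ q < t ∧ p q := by
    intro p s hs hp
    obtain ⟨q, hq, hq1, hq2⟩ := (hp.and_eventually (inter_mem
      (mem_nhdsWithin_of_mem_nhds (Ioi_mem_nhds hs)) self_mem_nhdsWithin)).exists
    exact ⟨q, hq2.1, hq1, hq2.2, hq⟩
  induction k with
  | zero =>
    obtain ⟨q, hq, hq1, hq2⟩ := (h1.and_eventually self_mem_nhdsWithin).exists
    exact ⟨0, zero_le.trans_lt hq2, le_refl (0 : ℝ≥0)⟩
  | succ k ih =>
    obtain ⟨m, hm, hc⟩ := ih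
    obtain ⟨q₁, hq1, hm1, ht1, ha⟩ := hpick hm h1
    obtain ⟨q₂, hq2, h12, ht2, hb⟩ := hpick ht1 h2
    obtain ⟨r, hr2, hr⟩ := exists_between ht2
    exact ⟨r, hr, m, q₁, q₂, hc, hq1, hq2, hm1, h12, hr2, ha, hb⟩

end UpcrossingChain

/-- A path with finitely many upcrossings and bounded on bounded time intervals has one-sided
limits along the dyadic times. -/
lemma exists_tendsto_dyadics {x : ℝ≥0 → ℝ}
    (hup : ∀ a b : ℚ, a < b → ∀ N : ℕ, ∃ k, ¬ UpcrossingChain x a b k 0 N)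
    (hbd : ∀ N : ℕ, ∃ C : ℝ, ∀ q ∈ dyadics, q ≤ N → |x q| ≤ C) (t : ℝ≥0) :
    (∃ l, Tendsto x (𝓝[dyadics ∩ Ioi t] t) (𝓝 l)) ∧
      ∃ l, Tendsto x (𝓝[dyadics ∩ Iio t] t) (𝓝 l) := by
  obtain ⟨N, hN⟩ := exists_nat_gt t
  obtain ⟨C, hC⟩ := hbd N
  have hev : ∀ O : Set ℝ≥0, ∀ᶠ q in 𝓝[dyadics ∩ O] t, |x q| ≤ C := by
    intro O
    filter_upwards [self_mem_nhdsWithin, mem_nhdsWithin_of_mem_nhds (Iio_mem_nhds hN)] with q h1 h2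
    exact hC q h1.1 (le_of_lt h2)
  have hle : ∀ O : Set ℝ≥0, (𝓝[dyadics ∩ O] t).IsBoundedUnder (· ≤ ·) x := fun O =>
    ⟨C, (hev O).mono fun q hq => (abs_le.1 hq).2⟩
  have hge : ∀ O : Set ℝ≥0, (𝓝[dyadics ∩ O] t).IsBoundedUnder (· ≥ ·) x := fun O =>
    ⟨-C, (hev O).mono fun q hq => (abs_le.1 hq).1⟩
  have hd : Dense (range ((↑) : ℚ → ℝ)) := Rat.denseRange_cast
  constructor
  · refine tendsto_of_no_upcrossings hd ?_ (hle _) (hge _)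
    rintro _ ⟨a, rfl⟩ _ ⟨b, rfl⟩ hab ⟨h1, h2⟩
    obtain ⟨k, hk⟩ := hup a b (by exact_mod_cast hab) N
    obtain ⟨l, -, hc⟩ := UpcrossingChain.of_frequently_right hN h1 h2 k
    exact hk (hc.mono_left zero_le)
  · refine tendsto_of_no_upcrossings hd ?_ (hle _) (hge _)
    rintro _ ⟨a, rfl⟩ _ ⟨b, rfl⟩ hab ⟨h1, h2⟩
    obtain ⟨k, hk⟩ := hup a b (by exact_mod_cast hab) N
    obtain ⟨r, hr, hc⟩ := UpcrossingChain.of_frequently_left h1 h2 k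
    exact hk (hc.mono_right (hr.trans hN).le)

end

noncomputable section

variable {Ω : Type*} {mΩ : MeasurableSpace Ω} {P : Measure Ω} {𝓕 : Filtration ℝ≥0 mΩ} {T : ℝ≥0}

/-! ### The càdlàg version of a closed martingale -/

/-- The filtration along the dyadic times of level `n`. -/
def dyadicFiltration (𝓕 : Filtration ℝ≥0 mΩ) (n : ℕ) : Filtration ℕ mΩ where
  seq j := 𝓕 (dyadic n j)
  mono' _ _ h := 𝓕.mono (dyadic_monotone n h)
  le' _ := 𝓕.le _

section

variable [IsProbabilityMeasure P] {Y : Ω → ℝ}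

lemma martingale_dyadic (n : ℕ) :
    Martingale (fun j => P[Y | 𝓕 (dyadic n j)]) (dyadicFiltration 𝓕 n) P :=
  martingale_condExp Y (dyadicFiltration 𝓕 n) P

/-- Doob's upcrossing inequality along the dyadic times and Fatou's lemma. -/
lemma ae_exists_not_upcrossingChain {a b : ℝ} (hab : a < b) (N : ℕ) :
    ∀ᵐ ω ∂P, ∃ k, ¬ UpcrossingChain (fun t => (P[Y | 𝓕 t]) ω) a b k 0 N := by
  set f : ℕ → ℕ → Ω → ℝ := fun n j => P[Y | 𝓕 (dyadic n j)] with hf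
  set J : ℕ → ℕ := fun n => N * 2 ^ n
  have hJ : ∀ n, dyadic n (J n) = N := fun n => by
    rw [dyadic, div_eq_iff (by positivity)]
    simp [J]
  set c : ℕ → Ω → ℝ≥0∞ := fun n ω => (upcrossingsBefore a b (f n) (J n) ω : ℝ≥0∞) with hc
  have hadapt : ∀ n, StronglyAdapted (dyadicFiltration 𝓕 n) (f n) := fun n =>
    (martingale_dyadic n).stronglyAdapted
  have hcm : ∀ n, Measurable (c n) := fun n =>
    measurable_from_top.comp ((hadapt n).measurable_upcrossingsBefore hab)
  set B : ℝ := (∫ ω, ((P[Y | 𝓕 N]) ω - a)⁺ ∂P) / (b - a)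
  have hle : ∀ n, ∫⁻ ω, c n ω ∂P ≤ ENNReal.ofReal B := by
    intro n
    have h1 := (martingale_dyadic (𝓕 := 𝓕) (P := P) (Y := Y) n).submartingale
      |>.mul_integral_upcrossingsBefore_le_integral_pos_part a b (J n)
    rw [hJ] at h1
    have h2 := (hadapt n).integrable_upcrossingsBefore (μ := P) (N := J n) hab
    have h3 : ∫⁻ ω, c n ω ∂P = ENNReal.ofReal (∫ ω, (upcrossingsBefore a b (f n) (J n) ω : ℝ) ∂P) := by
      rw [ofReal_integral_eq_lintegral_ofReal h2 (ae_of_all _ fun _ => Nat.cast_nonneg _)]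
      simp [hc]
    rw [h3]
    refine ENNReal.ofReal_le_ofReal ?_
    rw [le_div_iff₀ (sub_pos.2 hab), mul_comm]
    exact h1
  have hlim : ∫⁻ ω, liminf (fun n => c n ω) atTop ∂P ≠ ∞ := by
    refine ne_top_of_le_ne_top ENNReal.ofReal_ne_top
      ((lintegral_liminf_le hcm).trans (liminf_le_of_frequently_le' (x := ENNReal.ofReal B) ?_))
    exact Frequently.of_forall hle
  have hfin := ae_lt_top (Measurable.liminf hcm) hlim
  filter_upwards [hfin] with ω hω
  by_contra! hcon
  refine hω.ne (ENNReal.eq_top_of_forall_nnreal_le fun r => ?_)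
  obtain ⟨k, hk⟩ := exists_nat_ge r
  refine le_liminf_of_le (by isBoundedDefault) ?_
  filter_upwards [(hcon k).eventually_le_upcrossingsBefore hab] with n hn
  have := hn (J n) (hJ n).ge
  calc (r : ℝ≥0∞) ≤ (k : ℝ≥0∞) := by exact_mod_cast hk
    _ ≤ _ := Nat.cast_le.2 this

/-- Doob's maximal inequality along the dyadic times. -/
lemma ae_exists_abs_condExp_le (N : ℕ) :
    ∀ᵐ ω ∂P, ∃ C : ℝ, ∀ q ∈ dyadics, q ≤ N → |(P[Y | 𝓕 q]) ω| ≤ C := by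
  set g : ℕ → ℕ → Ω → ℝ := fun n j ω => |(P[Y | 𝓕 (dyadic n j)]) ω| with hg
  set J : ℕ → ℕ := fun n => N * 2 ^ n
  have hJ : ∀ n, dyadic n (J n) = N := fun n => by
    rw [dyadic, div_eq_iff (by positivity)]
    simp [J]
  have hsub : ∀ n, Submartingale (g n) (dyadicFiltration 𝓕 n) P := by
    intro n
    have h := (martingale_dyadic (𝓕 := 𝓕) (P := P) (Y := Y) n).submartingale
    have h' := (martingale_dyadic (𝓕 := 𝓕) (P := P) (Y := Y) n).neg.submartingale
    exact h.sup h'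
  set E : ℝ≥0 → ℕ → Set Ω := fun ε n => {ω | ∃ j ≤ J n, (ε : ℝ) ≤ g n j ω} with hE
  have hmono : ∀ ε, Monotone (E ε) := by
    refine fun ε => monotone_nat_of_le_succ fun n ω ⟨j, hj, h⟩ => ⟨j * 2, ?_, ?_⟩
    · simp only [J, pow_succ] at hj ⊢
      nlinarith
    · have := dyadic_add n 1 j
      rw [pow_one] at this
      simp only [hg] at h ⊢
      rwa [← this]
  have hmeas : ∀ (ε : ℝ≥0) n, (ε : ℝ≥0∞) * P (E ε n) ≤ ENNReal.ofReal (∫ ω, |Y ω| ∂P) := by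
    intro ε n
    have h1 := maximal_ineq (hsub n) (fun j ω => abs_nonneg _) (ε := ε) (J n)
    have h2 : {ω | (ε : ℝ) ≤ (Finset.range (J n + 1)).sup' Finset.nonempty_range_add_one
        fun k => g n k ω} = E ε n := by
      ext ω
      simp only [hE, mem_ofPred_eq, Finset.le_sup'_iff, Finset.mem_range, Nat.lt_succ_iff]
    rw [h2] at h1
    refine h1.trans (ENNReal.ofReal_le_ofReal ?_)
    refine (setIntegral_le_integral ((hsub n).integrable _) (ae_of_all _ fun ω => abs_nonneg _)).trans ?_
    exact integral_abs_condExp_le Y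
  have hU : ∀ k : ℕ, (k : ℝ≥0∞) * P (⋂ k : ℕ, ⋃ n, E k n) ≤ ENNReal.ofReal (∫ ω, |Y ω| ∂P) := by
    intro k
    have h1 : P (⋂ k : ℕ, ⋃ n, E k n) ≤ ⨆ n, P (E k n) := by
      rw [← (hmono k).measure_iUnion]
      exact measure_mono (iInter_subset _ k)
    refine (mul_le_mul_right h1 _).trans ?_
    rw [ENNReal.mul_iSup]
    exact iSup_le fun n => by simpa using hmeas k n
  have h0 : P (⋂ k : ℕ, ⋃ n, E k n) = 0 := by
    by_contra hne
    obtain ⟨k, hk⟩ := ENNReal.exists_nat_mul_gt hne (ENNReal.ofReal_ne_top (r := ∫ ω, |Y ω| ∂P))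
    exact absurd (hU k) (not_le.2 hk)
  filter_upwards [measure_eq_zero_iff_ae_notMem.1 h0] with ω hω
  simp only [mem_iInter, mem_iUnion, not_forall, not_exists] at hω
  obtain ⟨k, hk⟩ := hω
  refine ⟨k, fun q ⟨n, j, hq⟩ hqN => ?_⟩
  have h1 := hk n
  simp only [hE, mem_ofPred_eq, not_exists, not_and, not_le] at h1
  rw [hq]
  have h2 := h1 j (by rw [hq, ← hJ n, dyadic_le_dyadic] at hqN; exact hqN)
  exact_mod_cast h2.le

/-- Under the usual conditions the martingale `E_t[Y]` has a càdlàg version. -/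
theorem UsualConditions.exists_cadlag_condExp (h𝓕 : UsualConditions 𝓕 P) (hY : Integrable Y P) :
    ∃ M : ℝ≥0 → Ω → ℝ, Martingale M 𝓕 P ∧ (∀ ω, IsCadlag fun t => M t ω) ∧
      ∀ t, M t =ᵐ[P] P[Y | 𝓕 t] := by
  classical
  set Z : ℝ≥0 → Ω → ℝ := fun t => P[Y | 𝓕 t] with hZ
  set G : Set Ω := {ω | ∀ t, (∃ l, Tendsto (fun q => Z q ω) (𝓝[dyadics ∩ Ioi t] t) (𝓝 l)) ∧
      ∃ l, Tendsto (fun q => Z q ω) (𝓝[dyadics ∩ Iio t] t) (𝓝 l)} with hG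
  have hGae : ∀ᵐ ω ∂P, ω ∈ G := by
    have h1 : ∀ᵐ ω ∂P, ∀ a b : ℚ, a < b → ∀ N : ℕ,
        ∃ k, ¬ UpcrossingChain (fun t => Z t ω) a b k 0 N :=
      ae_all_iff.2 fun a => ae_all_iff.2 fun b => ae_all_iff.2 fun hab => ae_all_iff.2 fun N =>
        ae_exists_not_upcrossingChain (by exact_mod_cast hab) N
    have h2 : ∀ᵐ ω ∂P, ∀ N : ℕ, ∃ C : ℝ, ∀ q ∈ dyadics, q ≤ N → |Z q ω| ≤ C :=
      ae_all_iff.2 fun N => ae_exists_abs_condExp_le N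
    filter_upwards [h1, h2] with ω h1 h2 t
    exact exists_tendsto_dyadics h1 h2 t
  have hGm : MeasurableSet[𝓕 0] G := by
    have := h𝓕.complete Gᶜ hGae
    exact (compl_compl G) ▸ this.compl
  set Z' : ℝ≥0 → Ω → ℝ := fun t => G.indicator (Z t) with hZ'
  have hlim : ∀ ω t, (∃ l, Tendsto (fun q => Z' q ω) (𝓝[dyadics ∩ Ioi t] t) (𝓝 l)) ∧
      ∃ l, Tendsto (fun q => Z' q ω) (𝓝[dyadics ∩ Iio t] t) (𝓝 l) := by
    intro ω t
    by_cases h : ω ∈ G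
    · simpa [hZ', h] using h t
    · simp only [hZ', h, not_false_eq_true, indicator_of_notMem]
      exact ⟨⟨0, tendsto_const_nhds⟩, 0, tendsto_const_nhds⟩
  choose M hM using fun t ω => (hlim ω t).1
  have hZ'ae : ∀ t, Z' t =ᵐ[P] Z t := fun t => by
    filter_upwards [hGae] with ω h
    simp [hZ', h]
  have hZ'm : ∀ t, StronglyMeasurable[𝓕 t] (Z' t) := fun t =>
    stronglyMeasurable_condExp.indicator (𝓕.mono zero_le _ hGm)
  have hseq : ∀ t ω, Tendsto (fun n => Z' (nextDyadic n t) ω) atTop (𝓝 (M t ω)) := fun t ω =>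
    (hM t ω).comp (tendsto_nextDyadic t)
  have hMm : ∀ t, StronglyMeasurable[𝓕 t] (M t) := by
    intro t
    have h1 : ∀ s, t < s → StronglyMeasurable[𝓕 s] (M t) := by
      intro s hs
      have h2 : ∀ᶠ n in atTop, nextDyadic n t < s :=
        (tendsto_nhdsWithin_iff.1 (tendsto_nextDyadic t)).1.eventually (Iio_mem_nhds hs)
      obtain ⟨n, hn⟩ := eventually_atTop.1 h2
      refine stronglyMeasurable_of_tendsto (u := atTop) (f := fun k => Z' (nextDyadic (k + n) t))
        (fun k => (hZ'm _).mono (𝓕.mono (hn _ (Nat.le_add_left n k)).le)) ?_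
      rw [tendsto_pi_nhds]
      exact fun ω => (tendsto_add_atTop_iff_nat n).2 (hseq t ω)
    refine stronglyMeasurable_iff_measurable.2 fun s hs => ?_
    have := h𝓕.rightCont
    refine Filtration.IsRightContinuous.measurableSet ?_
    rw [Filtration.rightCont_eq]
    simp only [MeasurableSpace.measurableSet_iInf]
    exact fun j hj => (h1 j hj).measurable hs
  have hMae : ∀ t, M t =ᵐ[P] Z t := by
    intro t
    have hui : UniformIntegrable (fun n => P[Y | 𝓕 (nextDyadic n t)]) 1 P :=
      hY.uniformIntegrable_condExp fun n => 𝓕.le _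
    have hae : ∀ᵐ ω ∂P, Tendsto (fun n => (P[Y | 𝓕 (nextDyadic n t)]) ω) atTop (𝓝 (M t ω)) := by
      filter_upwards [ae_all_iff.2 fun n => hZ'ae (nextDyadic n t)] with ω h
      exact (hseq t ω).congr h
    have hMp : MemLp (M t) 1 P := hui.memLp_of_ae_tendsto hae
    have hL1 := tendsto_Lp_finite_of_tendsto_ae le_rfl ENNReal.one_ne_top
      (fun n => integrable_condExp.aestronglyMeasurable) hMp hui.unifIntegrable hae
    have hMi : Integrable (M t) P := memLp_one_iff_integrable.1 hMp
    have hle : ∀ n, eLpNorm (Z t - M t) 1 P ≤ eLpNorm (P[Y | 𝓕 (nextDyadic n t)] - M t) 1 P := by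
      intro n
      have h1 : P[P[Y | 𝓕 (nextDyadic n t)] - M t | 𝓕 t] =ᵐ[P] Z t - M t := by
        refine (condExp_sub integrable_condExp hMi _).trans ?_
        rw [condExp_of_stronglyMeasurable (𝓕.le t) (hMm t) hMi]
        filter_upwards [condExp_condExp_of_le (μ := P) (f := Y) (𝓕.mono (lt_nextDyadic n t).le)
          (𝓕.le _)] with ω hω
        simp [hω, hZ]
      rw [← eLpNorm_congr_ae h1]
      exact eLpNorm_condExp_le_eLpNorm _ le_rfl
    have h0 : eLpNorm (Z t - M t) 1 P = 0 :=
      le_antisymm (ge_of_tendsto' hL1 hle) zero_le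
    have h1 := (eLpNorm_eq_zero_iff (integrable_condExp.aestronglyMeasurable.sub
      hMi.aestronglyMeasurable) one_ne_zero).1 h0
    filter_upwards [h1] with ω hω
    exact (sub_eq_zero.1 hω).symm
  refine ⟨M, (martingale_condExp Y 𝓕 P).congr hMm fun t => (hMae t).symm, fun ω t => ⟨?_, ?_⟩, hMae⟩
  · refine continuousWithinAt_Ioi_iff_Ici.1 ?_
    exact tendsto_of_forall_tendsto_dyadics (fun s => hM s ω) isOpen_Ioi (hM t ω)
  · obtain ⟨l, hl⟩ := (hlim ω t).2
    exact ⟨l, tendsto_of_forall_tendsto_dyadics (fun s => hM s ω) isOpen_Iio hl⟩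

end

end

noncomputable section

variable {Ω : Type*} {mΩ : MeasurableSpace Ω} {P : Measure Ω} {𝓕 : Filtration ℝ≥0 mΩ} {T : ℝ≥0}

/-! ### Multiplication by deterministic continuous functions -/

lemma exists_bound_of_continuous {f : ℝ → ℝ} (hf : Continuous f) (T : ℝ≥0) :
    ∃ C, ∀ t : ℝ≥0, t ≤ T → |f t| ≤ C := by
  obtain ⟨C, hC⟩ := (isCompact_Icc (a := (0 : ℝ≥0)) (b := T)).exists_bound_of_continuousOn
    (f := fun s : ℝ≥0 => f s) (hf.comp NNReal.continuous_coe).continuousOn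
  exact ⟨C, fun t ht => hC t ⟨zero_le, ht⟩⟩

lemma integrableOn_continuous_mul {f : ℝ → ℝ} (hf : Continuous f) {g : ℝ≥0 → ℝ}
    (hg : IntegrableOn g (Iic T) leb) : IntegrableOn (fun t : ℝ≥0 => f t * g t) (Iic T) leb := by
  obtain ⟨C, hC⟩ := exists_bound_of_continuous hf T
  refine Integrable.bdd_mul (c := C) (f := fun t : ℝ≥0 => f t) hg
    (hf.comp NNReal.continuous_coe).aestronglyMeasurable ?_
  exact (ae_restrict_iff' measurableSet_Iic).2 (ae_of_all _ fun t ht => hC t ht)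

lemma IsRegularRate.continuous_mul {f : ℝ → ℝ} (hf : Continuous f) {u : ℝ≥0 → Ω → ℝ}
    (hu : IsRegularRate 𝓕 T u) : IsRegularRate 𝓕 T fun t ω => f t * u t ω where
  predictable := StronglyMeasurable.mul (isStronglyPredictable_of_measurable
    (hf.comp NNReal.continuous_coe).measurable) hu.predictable
  integrable ω := by
    refine (integrableOn_iff_integrable_of_support_subset (s := Iic T) fun t ht => ?_).1
      (integrableOn_continuous_mul hf (hu.integrable ω).integrableOn)
    by_contra h
    exact ht (by simp [hu.eq_zero t ω (not_le.1 h)])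
  eq_zero t ω h := by simp [hu.eq_zero t ω h]

lemma MemL2.continuous_mul [IsProbabilityMeasure P] {f : ℝ → ℝ} (hf : Continuous f)
    {X : ℝ≥0 → Ω → ℝ} (hX : MemL2 𝓕 P T X) : MemL2 𝓕 P T fun t ω => f t * X t ω := by
  have hp := StronglyMeasurable.mul (isStronglyPredictable_of_measurable (𝓕 := 𝓕)
    (hf.comp NNReal.continuous_coe).measurable) hX.1
  obtain ⟨C, hC⟩ := exists_bound_of_continuous hf T
  refine ⟨hp, (hX.2.const_mul C).of_le
    (stronglyMeasurable_uncurry_of_predictable (X := fun t ω => f t * X t ω) hp).aestronglyMeasurable ?_⟩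
  refine ae_timeProd_of_ae (p := fun t ω => ‖f t * X t ω‖ ≤ ‖C * X t ω‖)
    (ae_of_all _ fun ω t ht => ?_)
  rw [norm_mul, norm_mul]
  exact mul_le_mul_of_nonneg_right ((hC t ht).trans (le_abs_self C)) (norm_nonneg _)

/-! ### The linear equation along a path -/

/-- The functions that solve the linear equation: `c` satisfies `c'' = Δ c` and `φ = Δ / c`. -/
structure IsFundamental (Δ : ℝ) (c c' φ φ' : ℝ → ℝ) : Prop where
  deriv_c : ∀ x, HasDerivAt c (c' x) x
  deriv_c' : ∀ x, HasDerivAt c' (Δ * c x) x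
  deriv_φ : ∀ x, HasDerivAt φ (φ' x) x
  continuous_φ' : Continuous φ'
  pos : ∀ x, 0 < c x
  φ_mul : ∀ x, φ x * c x = Δ
  φ'_mul : ∀ x, φ' x * c x = -(φ x * c' x)

namespace IsFundamental

variable {Δ : ℝ} {c c' φ φ' : ℝ → ℝ} (hF : IsFundamental Δ c c' φ φ')
include hF

lemma continuous_c : Continuous c := continuous_iff_continuousAt.2 fun x => (hF.deriv_c x).continuousAt

lemma continuous_c' : Continuous c' :=
  continuous_iff_continuousAt.2 fun x => (hF.deriv_c' x).continuousAt

lemma continuous_φ : Continuous φ := continuous_iff_continuousAt.2 fun x => (hF.deriv_φ x).continuousAt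

lemma continuous_inv : Continuous fun x => (c x)⁻¹ := hF.continuous_c.inv₀ fun x => (hF.pos x).ne'

/-- Variation of constants: `U = c ∫ v / c` has the density `v + c' ∫ v / c`. -/
lemma mul_integral_eq {v : ℝ≥0 → ℝ} {t : ℝ≥0} (hv : IntegrableOn v (Iic t) leb)
    (hQ : IntegrableOn (fun s : ℝ≥0 => ∫ r in Iic s, (c r)⁻¹ * v r ∂leb) (Iic t) leb) :
    c t * (∫ r in Iic t, (c r)⁻¹ * v r ∂leb) =
      ∫ s in Iic t, (v s + c' s * ∫ r in Iic s, (c r)⁻¹ * v r ∂leb) ∂leb := by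
  rw [integral_by_parts hF.deriv_c hF.continuous_c' (integrableOn_continuous_mul hF.continuous_inv hv),
    integral_add hv (integrableOn_continuous_mul hF.continuous_c' hQ), add_comm]
  congr 1
  refine integral_congr_ae (ae_of_all _ fun r => ?_)
  have := (hF.pos r).ne'
  simp only
  field_simp

/-- The bounded variation part of the density `φ (n - ∫ c x) + c' ∫ v / c` of the solution
`U = c ∫ v / c`, where `v = φ (n - ∫ c x)`. -/
lemma density_eq {n x p v : ℝ≥0 → ℝ} {t : ℝ≥0} (hn : IntegrableOn n (Iic t) leb)
    (hx : IntegrableOn x (Iic t) leb) (hp : IntegrableOn p (Iic t) leb)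
    (hpx : ∀ s ≤ t, p s = ∫ r in Iic s, c r * x r ∂leb) (hv : ∀ s ≤ t, v s = φ s * (n s - p s))
    (hQ : IntegrableOn (fun s : ℝ≥0 => ∫ r in Iic s, (c r)⁻¹ * v r ∂leb) (Iic t) leb) :
    c' t * (∫ r in Iic t, (c r)⁻¹ * v r ∂leb) - φ t * p t -
        Δ * ∫ s in Iic t, (c s * (∫ r in Iic s, (c r)⁻¹ * v r ∂leb) - x s) ∂leb =
      - ∫ s in Iic t, φ' s * n s ∂leb := by
  have hvi : IntegrableOn v (Iic t) leb :=
    (integrableOn_congr_fun hv measurableSet_Iic).2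
      (integrableOn_continuous_mul hF.continuous_φ (hn.sub hp))
  have e1 := integral_by_parts hF.deriv_c' (continuous_const.mul hF.continuous_c)
    (integrableOn_continuous_mul hF.continuous_inv hvi)
  have e2 := integral_by_parts hF.deriv_φ hF.continuous_φ'
    (integrableOn_continuous_mul hF.continuous_c hx)
  have e3 : ∫ s in Iic t, φ' s * ∫ r in Iic s, c r * x r ∂leb ∂leb = ∫ s in Iic t, φ' s * p s ∂leb :=
    setIntegral_congr_fun measurableSet_Iic fun s hs => by simp only [hpx s hs]
  have e4 : ∫ r in Iic t, φ r * (c r * x r) ∂leb = Δ * ∫ r in Iic t, x r ∂leb := by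
    rw [← integral_const_mul]
    refine integral_congr_ae (ae_of_all _ fun r => ?_)
    simp only [← mul_assoc, hF.φ_mul]
  have e5 : ∫ r in Iic t, c' r * ((c r)⁻¹ * v r) ∂leb =
      (∫ r in Iic t, φ' r * p r ∂leb) - ∫ r in Iic t, φ' r * n r ∂leb := by
    rw [← integral_sub (integrableOn_continuous_mul hF.continuous_φ' hp)
      (integrableOn_continuous_mul hF.continuous_φ' hn)]
    refine setIntegral_congr_fun measurableSet_Iic fun r hr => ?_
    have h0 := (hF.pos r).ne'
    have h1 : φ' r = -(φ r * c' r) * (c r)⁻¹ := by rw [← hF.φ'_mul, mul_inv_cancel_right₀ h0]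
    simp only [hv r hr, h1]
    ring
  have e6 : ∫ s in Iic t, Δ * c s * (∫ r in Iic s, (c r)⁻¹ * v r ∂leb) ∂leb =
      Δ * ∫ s in Iic t, c s * (∫ r in Iic s, (c r)⁻¹ * v r ∂leb) ∂leb := by
    rw [← integral_const_mul]
    simp only [mul_assoc]
  rw [integral_sub (integrableOn_continuous_mul hF.continuous_c hQ) hx, hpx t le_rfl, e1, e2, e3, e4,
    e5, e6]
  ring

end IsFundamental

/-- The hyperbolic functions of the kernel. -/
lemma isFundamental_cosh {Δ : ℝ} (hΔ : 0 < Δ) (T : ℝ) :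
    IsFundamental Δ (fun x => Real.cosh (√Δ * (T - x))) (fun x => -(√Δ * Real.sinh (√Δ * (T - x))))
      (fun x => Δ / Real.cosh (√Δ * (T - x)))
      (fun x => Δ * (√Δ * Real.sinh (√Δ * (T - x))) / Real.cosh (√Δ * (T - x)) ^ 2) := by
  have hlin : ∀ x, HasDerivAt (fun x => √Δ * (T - x)) (-√Δ) x := fun x => by
    simpa using ((hasDerivAt_id x).const_sub T).const_mul (√Δ)
  have hc : ∀ x, HasDerivAt (fun x => Real.cosh (√Δ * (T - x)))
      (-(√Δ * Real.sinh (√Δ * (T - x)))) x := fun x => by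
    convert (hlin x).cosh using 1
    ring
  have hpos : ∀ x, 0 < Real.cosh (√Δ * (T - x)) := fun x => Real.cosh_pos _
  refine ⟨hc, fun x => ?_, fun x => ?_, ?_, hpos, fun x => ?_, fun x => ?_⟩
  · refine ((hlin x).sinh.const_mul (√Δ)).fun_neg.congr_deriv ?_
    have h := Real.mul_self_sqrt hΔ.le
    linear_combination Real.cosh (√Δ * (T - x)) * h
  · refine ((hasDerivAt_const x Δ).fun_div (hc x) (hpos x).ne').congr_deriv ?_
    ring
  · refine Continuous.div (by fun_prop) (by fun_prop) fun x => (pow_pos (hpos x) 2).ne'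
  · exact div_mul_cancel₀ _ (hpos x).ne'
  · have := (hpos x).ne'
    field_simp

end

noncomputable section

variable {Ω : Type*} {mΩ : MeasurableSpace Ω} {P : Measure Ω} {𝓕 : Filtration ℝ≥0 mΩ} {T : ℝ≥0}

/-! ### The linear forward-backward equation -/

variable [IsProbabilityMeasure P]

omit [IsProbabilityMeasure P] in
lemma leb_restrict_univ_lt_top : (leb.restrict (Iic T)) univ < ∞ := by
  rw [Measure.restrict_apply_univ, leb_Iic]
  exact ENNReal.coe_lt_top

/-- A jointly measurable version of `E_t[Y]` is square-integrable on `[0, T] × Ω`. -/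
lemma memLp_uncurry_of_condExp {M : ℝ≥0 → Ω → ℝ} (hM : StronglyMeasurable (Function.uncurry M))
    {Y : Ω → ℝ} (hY : MemLp Y 2 P) (h : ∀ t, M t =ᵐ[P] P[Y | 𝓕 t]) :
    MemLp (Function.uncurry M) 2 (timeProd P T) := by
  refine ⟨hM.aestronglyMeasurable, ?_⟩
  have h2 : ∀ (α : Type _) (mα : MeasurableSpace α) (μ : Measure α) (f : α → ℝ),
      eLpNorm f 2 μ ^ (2 : ℝ) = ∫⁻ x, ‖f x‖ₑ ^ (2 : ℝ) ∂μ := fun α mα μ f => by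
    have := eLpNorm_nnreal_pow_eq_lintegral (f := f) (p := 2) (μ := μ) (by norm_num)
    simpa using this
  have hlt : ∫⁻ q, ‖Function.uncurry M q‖ₑ ^ (2 : ℝ) ∂(timeProd P T) < ∞ := by
    rw [timeProd, lintegral_prod _ (hM.measurable.enorm.pow_const _).aemeasurable]
    calc ∫⁻ t, ∫⁻ ω, ‖M t ω‖ₑ ^ (2 : ℝ) ∂P ∂(leb.restrict (Iic T))
        ≤ ∫⁻ _, eLpNorm Y 2 P ^ (2 : ℝ) ∂(leb.restrict (Iic T)) := by
          refine lintegral_mono fun t => ?_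
          rw [← h2, eLpNorm_congr_ae (h t)]
          exact ENNReal.rpow_le_rpow (eLpNorm_condExp_le_eLpNorm _ (by norm_num)) (by norm_num)
      _ = eLpNorm Y 2 P ^ (2 : ℝ) * (leb.restrict (Iic T)) univ := lintegral_const _
      _ < ∞ := ENNReal.mul_lt_top (ENNReal.rpow_lt_top_of_nonneg (by norm_num) hY.2.ne)
          leb_restrict_univ_lt_top
  have h3 := h2 _ _ (timeProd P T) (Function.uncurry M)
  rw [← h3] at hlt
  by_contra hcon
  rw [not_lt, top_le_iff] at hcon
  rw [hcon, ENNReal.top_rpow_of_pos (by norm_num)] at hlt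
  exact lt_irrefl _ hlt

/-- The conditional expectation of the time integral of a martingale. -/
lemma condExp_setIntegral_Ioc {M n : ℝ≥0 → Ω → ℝ} (hM : Martingale M 𝓕 P)
    {f f' : ℝ → ℝ} (hf : ∀ x, HasDerivAt f (f' x) x) (hf' : Continuous f')
    (hn : Integrable (fun q : ℝ≥0 × Ω => f' q.1 * n q.1 q.2) (timeProd P T))
    (hnM : ∀ᵐ q ∂(timeProd P T), n q.1 q.2 = M q.1 q.2) {t : ℝ≥0} (ht : t ≤ T) :
    P[fun ω => ∫ r in Ioc t T, f' r * n r ω ∂leb | 𝓕 t] =ᵐ[P] fun ω => (f T - f t) * M t ω := by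
  have hsub : Ioc t T ⊆ Iic T := fun _ h => h.2
  have hn' : Integrable (fun q : ℝ≥0 × Ω => f' q.1 * n q.1 q.2) ((leb.restrict (Ioc t T)).prod P) := by
    refine hn.mono_measure ?_
    rw [timeProd]
    exact Measure.prod_mono (Measure.restrict_mono hsub le_rfl) le_rfl
  have hnM' : ∀ᵐ q ∂((leb.restrict (Ioc t T)).prod P), n q.1 q.2 = M q.1 q.2 := by
    refine Measure.absolutelyContinuous_of_le ?_ |>.ae_le hnM
    rw [timeProd]
    exact Measure.prod_mono (Measure.restrict_mono hsub le_rfl) le_rfl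
  have hint : Integrable (fun ω => ∫ r in Ioc t T, f' r * n r ω ∂leb) P := hn'.integral_prod_right
  refine (ae_eq_condExp_of_forall_setIntegral_eq (𝓕.le t) hint
    (fun B _ _ => ((hM.integrable t).const_mul _).integrableOn) (fun B hB _ => ?_)
    ((hM.stronglyMeasurable t).const_mul _).aestronglyMeasurable).symm
  have hBr : (leb.restrict (Ioc t T)).prod (P.restrict B) ≤ (leb.restrict (Ioc t T)).prod P :=
    Measure.prod_mono le_rfl Measure.restrict_le_self
  rw [integral_integral_swap (f := fun ω (r : ℝ≥0) => f' r * n r ω) ((hn'.mono_measure hBr).swap), integral_const_mul,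
    ← setIntegral_leb_deriv hf hf' ht, ← integral_mul_const]
  have h1 : ∀ᵐ r ∂(leb.restrict (Ioc t T)), ∀ᵐ ω ∂P, n r ω = M r ω := Measure.ae_ae_of_ae_prod hnM'
  refine integral_congr_ae ?_
  filter_upwards [h1, ae_restrict_mem measurableSet_Ioc] with r hr hrt
  rw [integral_const_mul, hM.setIntegral_eq hrt.1.le hB]
  congr 1
  refine integral_congr_ae (ae_restrict_of_ae ?_)
  filter_upwards [hr] with ω hω using hω.symm

/-- For every integrand the explicit formula gives a solution of the forward-backward equation. With
`c(t) = cosh(√Δ (T - t))`, `φ = Δ / c` and `M_t = E_t[∫₀ᵀ c X dr]`, the position is `U = c ∫ V / c` for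
`V_t = φ(t) (M_t - ∫₀ᵗ c X dr)`, and its rate is `V + c' ∫ V / c`. Integration by parts shows that this
rate equals `Δ ∫ (U - X)` up to `φ M - ∫ φ' M`, which is a martingale. The terminal
value vanishes since `M_T = ∫₀ᵀ c X dr` and `c'(T) = 0`. -/
theorem UsualConditions.exists_solution (h𝓕 : UsualConditions 𝓕 P) {Δ : ℝ} (hΔ : 0 < Δ)
    {X : ℝ≥0 → Ω → ℝ} (hX : MemL2 𝓕 P T X) :
    ∃ u, IsRegularRate 𝓕 T u ∧ MemL2 𝓕 P T u ∧ IsExplicitSolution 𝓕 P T Δ X (position u) ∧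
      IsFBSDESolution 𝓕 P T Δ X u (position u) := by
  have hF := isFundamental_cosh hΔ T
  set c : ℝ → ℝ := fun x => Real.cosh (√Δ * (T - x)) with hc
  set c' : ℝ → ℝ := fun x => -(√Δ * Real.sinh (√Δ * (T - x))) with hc'
  set φ : ℝ → ℝ := fun x => Δ / Real.cosh (√Δ * (T - x)) with hφ
  set φ' : ℝ → ℝ := fun x =>
    Δ * (√Δ * Real.sinh (√Δ * (T - x))) / Real.cosh (√Δ * (T - x)) ^ 2 with hφ'
  have hc'T : c' T = 0 := by simp [hc']
  have hker : ∀ s r : ℝ≥0, kernel Δ T s r = φ s * c r := fun s r => by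
    simp only [kernel, hφ, hc]
    ring
  obtain ⟨X₀, hX₀, hX₀2, hX₀X, -⟩ := h𝓕.exists_isRegularRate_of_memL2 hX
  -- the martingale `M` closed by `∫₀ᵀ c X dr`
  have hg := hX₀.continuous_mul hF.continuous_c
  have hg2 := hX₀2.continuous_mul hF.continuous_c
  set p : ℝ≥0 → Ω → ℝ := position fun t ω => c t * X₀ t ω with hp
  have hp2 : MemS2 𝓕 P T p := hg.memS2_position hg2
  have hpm : ∀ t, StronglyMeasurable[𝓕 t] (p t) := hp2.1.stronglyAdapted
  have hY : MemLp (p T) 2 P := hp2.memLp_apply le_rfl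
  obtain ⟨M, hM, hMc, hMY⟩ := h𝓕.exists_cadlag_condExp (hY.integrable (by norm_num))
  have hMm : StronglyMeasurable (Function.uncurry M) :=
    stronglyMeasurable_uncurry_of_rightCont (fun t => (hM.stronglyMeasurable t).mono (𝓕.le t))
      fun ω t => (hMc ω t).1
  have hM2 : MemLp (Function.uncurry M) 2 (timeProd P T) := memLp_uncurry_of_condExp hMm hY hMY
  -- its predictable version `n`
  obtain ⟨R, hR, -, hRM⟩ := exists_predictable_leftLim hM.stronglyAdapted hMc
  have hRMae : ∀ᵐ q ∂(timeProd P T), R q.1 q.2 = M q.1 q.2 := by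
    have hs : MeasurableSet {q : ℝ≥0 × Ω | R q.1 q.2 = M q.1 q.2} :=
      measurableSet_eq_fun (stronglyMeasurable_uncurry_of_predictable hR).measurable hMm.measurable
    have h1 : ∀ᵐ q ∂(P.prod (leb.restrict (Iic T))), R q.2 q.1 = M q.2 q.1 := by
      refine (Measure.ae_prod_iff_ae_ae (measurable_swap hs)).2 (ae_of_all _ fun ω => ?_)
      exact ae_restrict_of_ae (ae_eq_of_tendsto_nhdsLT fun t ht => hRM t ht ω)
    exact Measure.measurePreserving_swap.quasiMeasurePreserving.ae h1
  have hR2 : MemL2 𝓕 P T R :=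
    ⟨hR, (memLp_congr_ae (hRMae : Function.uncurry R =ᵐ[_] Function.uncurry M)).2 hM2⟩
  obtain ⟨n, hn, hn2, hnR, -⟩ := h𝓕.exists_isRegularRate_of_memL2 hR2
  have hnM : ∀ᵐ q ∂(timeProd P T), n q.1 q.2 = M q.1 q.2 := by
    filter_upwards [ae_timeProd_of_ae hnR, hRMae] with q h1 h2
    exact h1.trans h2
  -- the rate `u` and the position
  set v : ℝ≥0 → Ω → ℝ := fun t ω => φ t * (n t ω - p t ω) with hv
  have hv2 : MemL2 𝓕 P T v := (hn2.sub hp2.memL2).continuous_mul hF.continuous_φ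
  set Q : ℝ≥0 → Ω → ℝ := position fun t ω => (c t)⁻¹ * v t ω with hQ
  obtain ⟨Q', hQ'2, hQ'Q⟩ := h𝓕.exists_memS2_position (hv2.continuous_mul hF.continuous_inv)
  have hw2 : MemL2 𝓕 P T fun t ω => v t ω + c' t * Q' t ω :=
    hv2.add (hQ'2.memL2.continuous_mul hF.continuous_c')
  obtain ⟨u, hu, hu2, huw, hpu⟩ := h𝓕.exists_isRegularRate_of_memL2 hw2
  have hvi := hv2.integrable.prod_left_ae
  have hQi := hQ'2.memL2.integrable.prod_left_ae
  have hQint : ∀ᵐ ω ∂P, IntegrableOn (fun t => Q t ω) (Iic T) leb := by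
    filter_upwards [hQi, hQ'Q] with ω h1 h2
    exact (integrableOn_congr_fun (fun t ht => h2 t ht) measurableSet_Iic).1 h1
  have hU : ∀ᵐ ω ∂P, ∀ t ≤ T, position u t ω = c t * Q t ω := by
    filter_upwards [hpu, hvi, hQint, hQ'Q] with ω h1 h2 h3 h4 t ht
    have hsub : Iic t ⊆ Iic T := Iic_subset_Iic.2 ht
    have h2' : IntegrableOn (fun t => v t ω) (Iic T) leb := h2
    rw [h1 t ht]
    simp only [hQ, position]
    rw [hF.mul_integral_eq (h2'.mono_set hsub) (h3.mono_set hsub)]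
    exact setIntegral_congr_fun measurableSet_Iic fun s hs => by
      simp only [h4 s (hsub hs)]
      rfl
  have hut : ∀ᵐ ω ∂P, ∀ t ≤ T, u t ω = v t ω + c' t * Q t ω := by
    filter_upwards [huw, hQ'Q] with ω h1 h2 t ht
    rw [h1 t ht, h2 t ht]
  -- the drift of the rate
  have hI2 := (hu.memS2_position hu2).memL2.sub hX₀2
  set I : ℝ≥0 → Ω → ℝ := position fun t ω => position u t ω - X₀ t ω with hI
  have hφn := hn.continuous_mul hF.continuous_φ'
  have hφn2 := hn2.continuous_mul hF.continuous_φ'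
  set d : ℝ≥0 → Ω → ℝ := position fun t ω => φ' t * n t ω with hd
  have hdrift : ∀ᵐ ω ∂P, ∀ t ≤ T, c' t * Q t ω - φ t * p t ω - Δ * I t ω = - d t ω := by
    filter_upwards [hU, hQint, hp2.memL2.integrable.prod_left_ae] with ω h1 h2 h3 t ht
    have hsub : Iic t ⊆ Iic T := Iic_subset_Iic.2 ht
    have h3' : IntegrableOn (fun t => p t ω) (Iic T) leb := h3
    have h4 := hF.density_eq (n := fun t => n t ω) (x := fun t => X₀ t ω) (p := fun t => p t ω)
      (v := fun t => v t ω) (t := t) (hn.integrable ω).integrableOn (hX₀.integrable ω).integrableOn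
      (h3'.mono_set hsub) (fun s _ => rfl) (fun s _ => rfl) (h2.mono_set hsub)
    have h5 : I t ω = ∫ s in Iic t, (c s * (∫ r in Iic s, (c r)⁻¹ * v r ω ∂leb) - X₀ s ω) ∂leb :=
      setIntegral_congr_fun measurableSet_Iic fun s hs => by
        simp only [h1 s (hsub hs)]
        rfl
    rw [h5]
    exact h4
  -- the martingale part of the rate
  obtain ⟨J, hJ2, hJI⟩ := h𝓕.exists_memS2_position hI2
  set ξ : Ω → ℝ := fun ω => -Δ * J T ω with hξ
  have hξ2 : MemLp ξ 2 P := (hJ2.memLp_apply le_rfl).const_mul _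
  have hξm : StronglyMeasurable[𝓕 T] ξ := (hJ2.1.stronglyAdapted T).const_mul _
  obtain ⟨N, hN, hNc, hNξ⟩ := h𝓕.exists_cadlag_condExp (hξ2.integrable (by norm_num))
  have hNT : N T =ᵐ[P] ξ := by
    refine (hNξ T).trans ?_
    rw [condExp_of_stronglyMeasurable (𝓕.le T) hξm (hξ2.integrable (by norm_num))]
  have hξd : ξ =ᵐ[P] fun ω => φ T * p T ω - d T ω := by
    filter_upwards [hdrift, hJI] with ω h1 h2
    have h3 := h1 T le_rfl
    rw [hc'T] at h3
    simp only [hξ]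
    have h4 : J T ω = I T ω := h2 T le_rfl
    rw [h4]
    linarith
  have hdS : MemS2 𝓕 P T d := hφn.memS2_position hφn2
  have hNt : ∀ t ≤ T, ∀ᵐ ω ∂P, N t ω = φ t * M t ω - d t ω := by
    intro t ht
    have hdt : ∀ t ≤ T, Integrable (d t) P := fun t ht =>
      (hdS.memLp_apply ht).integrable (by norm_num)
    have hpi : Integrable (fun ω => φ T * p T ω) P := (hY.integrable (by norm_num)).const_mul _
    have htail : (fun ω => ∫ r in Ioc t T, φ' r * n r ω ∂leb) = fun ω => d T ω - d t ω := by
      ext ω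
      rw [hd, hφn.position_sub ht]
    have h1 := condExp_setIntegral_Ioc hM hF.deriv_φ hF.continuous_φ' hφn2.integrable hnM ht
    rw [htail] at h1
    have h2 : P[ξ | 𝓕 t] =ᵐ[P] P[(fun ω => φ T * p T ω) - ((fun ω => d T ω - d t ω) + d t) | 𝓕 t] := by
      refine condExp_congr_ae ?_
      filter_upwards [hξd] with ω hω
      simp [hω]
    have h3 := condExp_sub hpi (((hdt T le_rfl).sub (hdt t ht)).add (hdt t ht)) (𝓕 t)
    have h4 := condExp_add ((hdt T le_rfl).sub (hdt t ht)) (hdt t ht) (𝓕 t)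
    have h5 : P[d t | 𝓕 t] = d t :=
      condExp_of_stronglyMeasurable (𝓕.le t) (hdS.1.stronglyAdapted t) (hdt t ht)
    have h6 := condExp_smul (μ := P) (φ T) (p T) (𝓕 t)
    filter_upwards [hNξ t, h1, h2, h3, h4, h6, hMY t] with ω a1 a2 a3 a4 a5 a6 a7
    have a4' : (P[(fun ω => φ T * p T ω) - ((fun ω => d T ω - d t ω) + d t) | 𝓕 t]) ω =
        (P[fun ω => φ T * p T ω | 𝓕 t]) ω - (P[(fun ω => d T ω - d t ω) + d t | 𝓕 t]) ω := a4
    have a5' : (P[(fun ω => d T ω - d t ω) + d t | 𝓕 t]) ω =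
        (P[fun ω => d T ω - d t ω | 𝓕 t]) ω + (P[d t | 𝓕 t]) ω := a5
    have a6' : (P[fun ω => φ T * p T ω | 𝓕 t]) ω = φ T * (P[p T | 𝓕 t]) ω := a6
    rw [a1, a3, a4', a5', a6', a2, h5, ← a7]
    ring
  have hNm : StronglyMeasurable (Function.uncurry N) :=
    stronglyMeasurable_uncurry_of_rightCont (fun t => (hN.stronglyMeasurable t).mono (𝓕.le t))
      fun ω t => (hNc ω t).1
  have hNae : ∀ᵐ q ∂(timeProd P T), N q.1 q.2 = φ q.1 * M q.1 q.2 - d q.1 q.2 := by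
    refine ae_eq_of_forall_ae_eq (g := fun t ω => φ t * M t ω - d t ω) hNm.measurable ?_ hNt
    exact (((hF.continuous_φ.comp NNReal.continuous_coe).measurable.comp measurable_fst).mul
      hMm.measurable).sub (stronglyMeasurable_uncurry_of_predictable hdS.1).measurable
  have hXint : ∀ᵐ ω ∂P, ∀ t ≤ T, ∫ s in Ioc t T, Δ * (position u s ω - X s ω) ∂leb =
      Δ * (I T ω - I t ω) := by
    filter_upwards [hX₀X] with ω h1 t ht
    have h2 : IntegrableOn (fun s => position u s ω - X₀ s ω) (Iic T) leb := by
      refine Integrable.sub ?_ (hX₀.integrable ω).integrableOn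
      have : IsCompact (Iic T) := by rw [← Icc_bot]; exact isCompact_Icc
      exact (hu.continuous_position ω).continuousOn.integrableOn_compact this
    have h3 : Iic T = Iic t ∪ Ioc t T := (Iic_union_Ioc_eq_Iic ht).symm
    have h4 : I T ω = I t ω + ∫ s in Ioc t T, (position u s ω - X₀ s ω) ∂leb := by
      simp only [hI, position]
      conv_lhs => rw [h3]
      refine setIntegral_union ?_ measurableSet_Ioc (h2.mono_set (Iic_subset_Iic.2 ht))
        (h2.mono_set fun r hr => hr.2)
      rw [Set.disjoint_left]
      intro x hx hx'
      exact not_lt.2 hx hx'.1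
    rw [h4, integral_const_mul, add_sub_cancel_left]
    congr 1
    exact setIntegral_congr_fun measurableSet_Ioc fun r hr => by simp only [h1 r hr.2]
  refine ⟨u, hu, hu2, ⟨fun t ω => φ t * (M t ω - p t ω), ae_of_all _ fun ω t => ⟨?_, ?_⟩, ?_, ?_⟩,
    hu2, ae_of_all _ fun ω t _ => rfl, N, ⟨hN, ae_of_all _ hNc, ?_⟩, ?_⟩
  · exact ((hF.continuous_φ.comp NNReal.continuous_coe).continuousWithinAt).mul
      ((hMc ω t).1.sub (hg.continuous_position ω).continuousWithinAt)
  · obtain ⟨l, hl⟩ := (hMc ω t).2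
    refine ⟨φ t * (l - p t ω), Tendsto.mul ?_ (hl.sub ?_)⟩
    · exact ((hF.continuous_φ.comp NNReal.continuous_coe).tendsto t).mono_left nhdsWithin_le_nhds
    · exact ((hg.continuous_position ω).tendsto t).mono_left nhdsWithin_le_nhds
  · intro s hs
    have hpT : Integrable (p T) P := hY.integrable (by norm_num)
    have hps : Integrable (p s) P := (hp2.memLp_apply hs).integrable (by norm_num)
    have e : (fun ω => ∫ r in Ioc s T, kernel Δ T s r * X r ω ∂leb) =ᵐ[P] φ (s : ℝ) • (p T - p s) := by
      filter_upwards [hX₀X] with ω h1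
      simp only [Pi.smul_apply, Pi.sub_apply, smul_eq_mul]
      rw [hp, hg.position_sub hs, ← integral_const_mul]
      refine setIntegral_congr_fun measurableSet_Ioc fun r hr => ?_
      simp only [hker, h1 r hr.2]
      ring
    have h1 := condExp_smul (μ := P) (φ s) (p T - p s) (𝓕 s)
    have h2 := condExp_sub hpT hps (𝓕 s)
    have h3 : P[p s | 𝓕 s] = p s := condExp_of_stronglyMeasurable (𝓕.le s) (hpm s) hps
    filter_upwards [condExp_congr_ae (m := 𝓕 s) e, h1, h2, hMY s] with ω a1 a2 a3 a4
    rw [a1, a2, Pi.smul_apply, a3, Pi.sub_apply, h3, ← a4, smul_eq_mul]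
  · filter_upwards [hU, ae_ae_of_ae_timeProd (p := fun t ω => n t ω = M t ω) hnM] with ω h1 h2 t ht
    rw [h1 t ht]
    simp only [hQ, position, hker]
    rw [← integral_const_mul, ← integral_const_mul]
    refine integral_congr_ae ?_
    filter_upwards [ae_restrict_of_ae_restrict_of_subset (Iic_subset_Iic.2 ht) h2] with r hr
    have h0 : c r ≠ 0 := (hF.pos r).ne'
    have h1 : φ r = Δ * (c r)⁻¹ := by rw [← hF.φ_mul, mul_inv_cancel_right₀ h0]
    simp only [hv, hr, h1]
    field_simp
  · exact (memLp_congr_ae hNT).2 hξ2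
  · have hNT' : ∀ᵐ q ∂(timeProd P T), N T q.2 = ξ q.2 := Measure.quasiMeasurePreserving_snd.ae hNT
    have hJT : ∀ᵐ q ∂(timeProd P T), J T q.2 = I T q.2 :=
      Measure.quasiMeasurePreserving_snd.ae (hJI.mono fun ω h => h T le_rfl)
    filter_upwards [hNT', hJT, hNae, hnM, ae_timeProd_of_ae hut, ae_timeProd_of_ae hdrift,
      ae_timeProd_of_ae hXint] with q a1 a2 a3 a4 a5 a6 a7
    rw [a7, a1, a3, a5]
    simp only [hξ, a2, hv, a4]
    linear_combination -a6

end

noncomputable section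

variable {Ω : Type*} {mΩ : MeasurableSpace Ω} {P : Measure Ω} {𝓕 : Filtration ℝ≥0 mΩ} {T : ℝ≥0}

/-! ### The weak form of the linear equation -/

variable [IsProbabilityMeasure P]

omit [IsProbabilityMeasure P] in
lemma position_const_mul (c : ℝ) (u : ℝ≥0 → Ω → ℝ) :
    position (fun t ω => c * u t ω) = fun t ω => c * position u t ω := by
  ext t ω
  exact integral_const_mul _ _

lemma MemL2.position_add_const_mul {u h : ℝ≥0 → Ω → ℝ} (hu : MemL2 𝓕 P T u) (hh : MemL2 𝓕 P T h)
    (ε : ℝ) : ∀ᵐ q ∂(timeProd P T), position (fun t ω => u t ω + ε * h t ω) q.1 q.2 =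
      position u q.1 q.2 + ε * position h q.1 q.2 := by
  refine ae_timeProd_of_ae (p := fun t ω => position (fun t ω => u t ω + ε * h t ω) t ω =
    position u t ω + ε * position h t ω) ?_
  filter_upwards [hu.integrable.prod_left_ae, hh.integrable.prod_left_ae] with ω h1 h2 t ht
  have h1' : IntegrableOn (fun t => u t ω) (Iic T) leb := h1
  have h2' : IntegrableOn (fun t => h t ω) (Iic T) leb := h2
  simp only [position]
  rw [integral_add (h1'.mono_set (Iic_subset_Iic.2 ht))
    ((h2'.mono_set (Iic_subset_Iic.2 ht)).integrable.const_mul ε), integral_const_mul]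

lemma position_sum {ι : Type*} [Fintype ι] {u : ι → ℝ≥0 → Ω → ℝ} (hu : ∀ i, MemL2 𝓕 P T (u i))
    (c : ι → ℝ) : ∀ᵐ q ∂(timeProd P T), position (fun t ω => ∑ i, c i * u i t ω) q.1 q.2 =
      ∑ i, c i * position (u i) q.1 q.2 := by
  refine ae_timeProd_of_ae (p := fun t ω => position (fun t ω => ∑ i, c i * u i t ω) t ω =
    ∑ i, c i * position (u i) t ω) ?_
  filter_upwards [ae_all_iff.2 fun i => (hu i).integrable.prod_left_ae] with ω h1 t ht
  simp only [position]
  rw [integral_finsetSum]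
  · simp only [integral_const_mul]
  · intro i _
    have h1' : IntegrableOn (fun t => u i t ω) (Iic T) leb := h1 i
    exact (h1'.mono_set (Iic_subset_Iic.2 ht)).integrable.const_mul _

lemma UsualConditions.memLp_position (h𝓕 : UsualConditions 𝓕 P) {u : ℝ≥0 → Ω → ℝ}
    (hu : MemL2 𝓕 P T u) :
    MemLp (fun q : ℝ≥0 × Ω => position u q.1 q.2) 2 (timeProd P T) := by
  obtain ⟨U, hU, hUu⟩ := h𝓕.exists_memS2_position hu
  exact (memLp_congr_ae (ae_timeProd_of_ae (p := fun t ω => U t ω = position u t ω) hUu)).1 hU.memL2.memLp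

/-- The increment of a square-integrable martingale after time `t` is orthogonal to the
information available at time `t`. -/
lemma Martingale.integral_mul_sub_eq_zero {N : ℝ≥0 → Ω → ℝ} (hN : Martingale N 𝓕 P)
    (hN2 : MemLp (N T) 2 P) {t : ℝ≥0} (ht : t ≤ T) {f : Ω → ℝ} (hf : StronglyMeasurable[𝓕 t] f)
    (hf2 : MemLp f 2 P) : ∫ ω, f ω * (N T ω - N t ω) ∂P = 0 := by
  have h1 : P[N T | 𝓕 t] =ᵐ[P] N t := hN.condExp_ae_eq ht
  have hNt2 : MemLp (N t) 2 P := (memLp_congr_ae h1).1 (hN2.condExp (by norm_num))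
  have i1 : Integrable (f * N T) P := MemLp.integrable_mul hf2 hN2
  have i2 : Integrable (f * N t) P := MemLp.integrable_mul hf2 hNt2
  have h2 : ∫ ω, (f * N T) ω ∂P = ∫ ω, (f * N t) ω ∂P := by
    rw [← integral_condExp (𝓕.le t)]
    refine integral_congr_ae ?_
    refine (condExp_mul_of_stronglyMeasurable_left hf i1 (hN2.integrable (by norm_num))).trans ?_
    filter_upwards [h1] with ω hω
    simp [hω]
  have h3 : ∫ ω, f ω * (N T ω - N t ω) ∂P = ∫ ω, ((f * N T) ω - (f * N t) ω) ∂P := by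
    refine integral_congr_ae (ae_of_all _ fun ω => ?_)
    simp only [Pi.mul_apply]
    ring
  rw [h3, integral_sub i1 i2, h2, sub_self]

/-- The weak form of the forward-backward equation: the equation is tested with a rate `h`, which
eliminates the martingale part. -/
theorem IsFBSDESolution.integral_mul_eq (h𝓕 : UsualConditions 𝓕 P) {Δ : ℝ} {X u U : ℝ≥0 → Ω → ℝ}
    (hs : IsFBSDESolution 𝓕 P T Δ X u U) (hX : MemL2 𝓕 P T X) (hU : MemL2 𝓕 P T U)
    {h : ℝ≥0 → Ω → ℝ} (hh : MemL2 𝓕 P T h) :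
    ∫ q, u q.1 q.2 * h q.1 q.2 ∂(timeProd P T) =
      - ∫ q, Δ * (U q.1 q.2 - X q.1 q.2) * position h q.1 q.2 ∂(timeProd P T) := by
  obtain ⟨hu, -, N, hN, heq⟩ := hs
  obtain ⟨i1, e1⟩ := h𝓕.integral_mul_tail_eq hh ((hU.sub hX).const_mul Δ)
  have i2 := hu.integrable_mul hh
  set f : ℝ≥0 × Ω → ℝ := fun q => h q.1 q.2 * (N T q.2 - N q.1 q.2) with hf
  have hfe : (fun q : ℝ≥0 × Ω => -(u q.1 q.2 * h q.1 q.2) -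
      h q.1 q.2 * ∫ r in Ioc q.1 T, Δ * (U r q.2 - X r q.2) ∂leb) =ᵐ[timeProd P T] f := by
    filter_upwards [heq] with q hq
    simp only [hf]
    linear_combination h q.1 q.2 * hq
  have hfi : Integrable f (timeProd P T) := (i2.neg.sub i1).congr hfe
  have h0 : ∫ q, f q ∂(timeProd P T) = 0 := by
    rw [timeProd, integral_prod f hfi]
    refine integral_eq_zero_of_ae ?_
    have hsq : ∀ᵐ t ∂(leb.restrict (Iic T)), Integrable (fun ω => h t ω ^ 2) P :=
      hh.integrable_sq.prod_right_ae
    filter_upwards [hsq, ae_restrict_mem measurableSet_Iic] with t h1 ht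
    have hm := hh.1.stronglyAdapted t
    exact Martingale.integral_mul_sub_eq_zero hN.martingale hN.sq_integrable ht hm
      ((memLp_two_iff_integrable_sq (hm.mono (𝓕.le t)).aestronglyMeasurable).2 h1)
  have i3 : Integrable (fun q : ℝ≥0 × Ω => -(u q.1 q.2 * h q.1 q.2)) (timeProd P T) := i2.neg
  rw [← integral_congr_ae hfe, integral_sub i3 i1, integral_neg, e1] at h0
  linarith

omit [IsProbabilityMeasure P] in
lemma MemL2.ae_eq_zero {w : ℝ≥0 → Ω → ℝ} (hw : MemL2 𝓕 P T w)
    (h : ∫ q, w q.1 q.2 ^ 2 ∂(timeProd P T) = 0) : ∀ᵐ q ∂(timeProd P T), w q.1 q.2 = 0 := by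
  filter_upwards [(integral_eq_zero_iff_of_nonneg (fun q => sq_nonneg (w q.1 q.2))
    hw.integrable_sq).1 h] with q hq
  exact pow_eq_zero_iff two_ne_zero |>.1 hq

/-- The weak equation has at most one solution. -/
lemma ae_eq_of_integral_mul_eq (h𝓕 : UsualConditions 𝓕 P) {Δ : ℝ} (hΔ : 0 < Δ) {X u v : ℝ≥0 → Ω → ℝ}
    (hX : MemL2 𝓕 P T X) (hu : MemL2 𝓕 P T u) (hv : MemL2 𝓕 P T v)
    (hu' : ∀ h, MemL2 𝓕 P T h → ∫ q, u q.1 q.2 * h q.1 q.2 ∂(timeProd P T) =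
      - ∫ q, Δ * (position u q.1 q.2 - X q.1 q.2) * position h q.1 q.2 ∂(timeProd P T))
    (hv' : ∀ h, MemL2 𝓕 P T h → ∫ q, v q.1 q.2 * h q.1 q.2 ∂(timeProd P T) =
      - ∫ q, Δ * (position v q.1 q.2 - X q.1 q.2) * position h q.1 q.2 ∂(timeProd P T)) :
    ∀ᵐ q ∂(timeProd P T), u q.1 q.2 = v q.1 q.2 := by
  set w : ℝ≥0 → Ω → ℝ := fun t ω => u t ω + (-1) * v t ω with hw
  have hw2 : MemL2 𝓕 P T w := hu.add (hv.const_mul (-1))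
  have hpw := hu.position_add_const_mul hv (-1)
  have hpu := h𝓕.memLp_position hu
  have hpv := h𝓕.memLp_position hv
  have hpw2 := h𝓕.memLp_position hw2
  have hX2 := hX.memLp
  have i1 : Integrable (fun q : ℝ≥0 × Ω =>
      Δ * (position u q.1 q.2 - X q.1 q.2) * position w q.1 q.2) (timeProd P T) :=
    MemLp.integrable_mul ((hpu.sub hX2).const_mul Δ) hpw2
  have i2 : Integrable (fun q : ℝ≥0 × Ω =>
      Δ * (position v q.1 q.2 - X q.1 q.2) * position w q.1 q.2) (timeProd P T) :=
    MemLp.integrable_mul ((hpv.sub hX2).const_mul Δ) hpw2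
  have e1 : ∫ q, w q.1 q.2 ^ 2 ∂(timeProd P T) = (∫ q, u q.1 q.2 * w q.1 q.2 ∂(timeProd P T)) -
      ∫ q, v q.1 q.2 * w q.1 q.2 ∂(timeProd P T) := by
    rw [← integral_sub (hu.integrable_mul hw2) (hv.integrable_mul hw2)]
    refine integral_congr_ae (ae_of_all _ fun q => ?_)
    simp only [hw]
    ring
  have e2 : (∫ q, Δ * (position u q.1 q.2 - X q.1 q.2) * position w q.1 q.2 ∂(timeProd P T)) -
      ∫ q, Δ * (position v q.1 q.2 - X q.1 q.2) * position w q.1 q.2 ∂(timeProd P T) =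
      Δ * ∫ q, position w q.1 q.2 ^ 2 ∂(timeProd P T) := by
    rw [← integral_sub i1 i2, ← integral_const_mul]
    refine integral_congr_ae ?_
    filter_upwards [hpw] with q hq
    have : position w q.1 q.2 = position u q.1 q.2 + -1 * position v q.1 q.2 := hq
    linear_combination (-Δ * position w q.1 q.2) * this
  have h1 : 0 ≤ ∫ q, position w q.1 q.2 ^ 2 ∂(timeProd P T) := integral_nonneg fun q => sq_nonneg _
  have h2 : 0 ≤ ∫ q, w q.1 q.2 ^ 2 ∂(timeProd P T) := integral_nonneg fun q => sq_nonneg _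
  have h3 : ∫ q, w q.1 q.2 ^ 2 ∂(timeProd P T) = 0 := by
    rw [hu' w hw2, hv' w hw2] at e1
    have := mul_nonneg hΔ.le h1
    linarith
  filter_upwards [hw2.ae_eq_zero h3] with q h4
  simp only [hw] at h4
  linarith

end

noncomputable section

variable {Ω : Type*} {mΩ : MeasurableSpace Ω} {P : Measure Ω} {𝓕 : Filtration ℝ≥0 mΩ} {T : ℝ≥0}

/-! ### The goal functional -/

lemma integral_add_const_mul_add_const_mul {α : Type*} {mα : MeasurableSpace α} {μ : Measure α}
    {f g k : α → ℝ} (hf : Integrable f μ) (hg : Integrable g μ) (hk : Integrable k μ) (a b : ℝ) :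
    ∫ x, (f x + a * g x + b * k x) ∂μ = (∫ x, f x ∂μ) + a * (∫ x, g x ∂μ) + b * ∫ x, k x ∂μ := by
  have h1 : Integrable (fun x => f x + a * g x) μ := hf.add (hg.const_mul a)
  rw [integral_add h1 (hk.const_mul b), integral_add hf (hg.const_mul a), integral_const_mul,
    integral_const_mul]

section

variable [IsProbabilityMeasure P] {𝒜 : Type*} (p : Params 𝒜) (a : 𝒜)

/-- The goal functional without the constraint that an agent with infinite friction does not trade;
the costs are computed with the friction parameter `(λ^a).toReal`, which is `0` for `λ^a = ∞`. -/
def Params.realGoal (P : Measure Ω) (ξ v A K u : ℝ≥0 → Ω → ℝ) : ℝ :=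
  (∫ ω, stieltjesIntegral p.T (fun t => K t ω) (fun t => A t ω) ∂P) -
    (∫ q, (p.lam * v q.1 q.2 * u q.1 q.2 +
      (p.lam * p.m a + (p.lamA a).toReal / 2) * u q.1 q.2 ^ 2) ∂(timeProd P p.T)) -
    ∫ q, 1 / (2 * p.ρ a) * (ξ q.1 q.2 - K q.1 q.2 - position u q.1 q.2) ^ 2 ∂(timeProd P p.T)

/-- The derivative of `Params.realGoal` at `(K, u)` in the direction `(H, h)`. -/
def Params.derivGoal (P : Measure Ω) (ξ v A K u H h : ℝ≥0 → Ω → ℝ) : ℝ :=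
  (∫ ω, stieltjesIntegral p.T (fun t => H t ω) (fun t => A t ω) ∂P) -
    (∫ q, (p.lam * v q.1 q.2 + (2 * p.lam * p.m a + (p.lamA a).toReal) * u q.1 q.2) * h q.1 q.2
      ∂(timeProd P p.T)) +
    ∫ q, 1 / p.ρ a * (ξ q.1 q.2 - K q.1 q.2 - position u q.1 q.2) *
      (H q.1 q.2 + position h q.1 q.2) ∂(timeProd P p.T)

/-- Minus the second order term of `Params.realGoal` in the direction `(H, h)`. -/
def Params.quadGoal (P : Measure Ω) (H h : ℝ≥0 → Ω → ℝ) : ℝ :=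
  (∫ q, (p.lam * p.m a + (p.lamA a).toReal / 2) * h q.1 q.2 ^ 2 ∂(timeProd P p.T)) +
    ∫ q, 1 / (2 * p.ρ a) * (H q.1 q.2 + position h q.1 q.2) ^ 2 ∂(timeProd P p.T)

omit [IsProbabilityMeasure P] in
lemma Params.quadGoal_nonneg (H h : ℝ≥0 → Ω → ℝ) : 0 ≤ p.quadGoal a P H h := by
  have h1 := p.lam_nonneg
  have h2 := p.m_pos a
  have h3 := p.ρ_pos a
  exact add_nonneg (integral_nonneg fun q => by positivity) (integral_nonneg fun q => by positivity)

variable {ξ v A K u H h : ℝ≥0 → Ω → ℝ}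

/-- The goal functional is quadratic. -/
lemma Params.realGoal_add (h𝓕 : UsualConditions 𝓕 P) (hξ : MemS2 𝓕 P p.T ξ) (hv : MemL2 𝓕 P p.T v)
    (hA : IsDrift 𝓕 P p.T A) (hK : MemS2 𝓕 P p.T K) (hu : MemL2 𝓕 P p.T u)
    (hH : MemS2 𝓕 P p.T H) (hh : MemL2 𝓕 P p.T h) (ε : ℝ) :
    p.realGoal a P ξ v A (fun t ω => K t ω + ε * H t ω) (fun t ω => u t ω + ε * h t ω) =
      p.realGoal a P ξ v A K u + ε * p.derivGoal a P ξ v A K u H h - ε ^ 2 * p.quadGoal a P H h := by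
  set κ := p.lam * p.m a + (p.lamA a).toReal / 2 with hκ
  have hρ := p.ρ_pos a
  have e1 : ∫ ω, stieltjesIntegral p.T (fun t => K t ω + ε * H t ω) (fun t => A t ω) ∂P =
      (∫ ω, stieltjesIntegral p.T (fun t => K t ω) (fun t => A t ω) ∂P) +
        ε * ∫ ω, stieltjesIntegral p.T (fun t => H t ω) (fun t => A t ω) ∂P := by
    rw [integral_congr_ae (hA.stieltjesIntegral_add_const_mul hK hH ε),
      integral_add (hA.integrable_stieltjesIntegral h𝓕 hK)
        ((hA.integrable_stieltjesIntegral h𝓕 hH).const_mul ε), integral_const_mul]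
  have i1 : Integrable (fun q : ℝ≥0 × Ω => p.lam * v q.1 q.2 * u q.1 q.2 + κ * u q.1 q.2 ^ 2)
      (timeProd P p.T) :=
    ((hv.const_mul p.lam).integrable_mul hu).add (hu.integrable_sq.const_mul κ)
  have i2 : Integrable (fun q : ℝ≥0 × Ω =>
      (p.lam * v q.1 q.2 + (2 * p.lam * p.m a + (p.lamA a).toReal) * u q.1 q.2) * h q.1 q.2)
      (timeProd P p.T) := ((hv.const_mul _).add (hu.const_mul _)).integrable_mul hh
  have i3 : Integrable (fun q : ℝ≥0 × Ω => κ * h q.1 q.2 ^ 2) (timeProd P p.T) :=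
    hh.integrable_sq.const_mul κ
  have e2 : ∫ q, (p.lam * v q.1 q.2 * (u q.1 q.2 + ε * h q.1 q.2) +
      κ * (u q.1 q.2 + ε * h q.1 q.2) ^ 2) ∂(timeProd P p.T) =
      (∫ q, (p.lam * v q.1 q.2 * u q.1 q.2 + κ * u q.1 q.2 ^ 2) ∂(timeProd P p.T)) +
      ε * (∫ q, (p.lam * v q.1 q.2 + (2 * p.lam * p.m a + (p.lamA a).toReal) * u q.1 q.2) *
        h q.1 q.2 ∂(timeProd P p.T)) + ε ^ 2 * ∫ q, κ * h q.1 q.2 ^ 2 ∂(timeProd P p.T) := by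
    rw [← integral_add_const_mul_add_const_mul i1 i2 i3]
    refine integral_congr_ae (ae_of_all _ fun q => ?_)
    simp only [hκ]
    ring
  have hpu := h𝓕.memLp_position hu
  have hph := h𝓕.memLp_position hh
  have hy : MemLp (fun q : ℝ≥0 × Ω => ξ q.1 q.2 - K q.1 q.2 - position u q.1 q.2) 2
      (timeProd P p.T) := (hξ.sub hK).memL2.memLp.sub hpu
  have hz : MemLp (fun q : ℝ≥0 × Ω => H q.1 q.2 + position h q.1 q.2) 2 (timeProd P p.T) :=
    hH.memL2.memLp.add hph
  have i4 : Integrable (fun q : ℝ≥0 × Ω =>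
      1 / (2 * p.ρ a) * (ξ q.1 q.2 - K q.1 q.2 - position u q.1 q.2) ^ 2) (timeProd P p.T) :=
    hy.integrable_sq.const_mul _
  have i5 : Integrable (fun q : ℝ≥0 × Ω => 1 / p.ρ a * (ξ q.1 q.2 - K q.1 q.2 - position u q.1 q.2) *
      (H q.1 q.2 + position h q.1 q.2)) (timeProd P p.T) :=
    MemLp.integrable_mul (hy.const_mul _) hz
  have i6 : Integrable (fun q : ℝ≥0 × Ω => 1 / (2 * p.ρ a) * (H q.1 q.2 + position h q.1 q.2) ^ 2)
      (timeProd P p.T) := hz.integrable_sq.const_mul _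
  have e3 : ∫ q, 1 / (2 * p.ρ a) * (ξ q.1 q.2 - (K q.1 q.2 + ε * H q.1 q.2) -
      position (fun t ω => u t ω + ε * h t ω) q.1 q.2) ^ 2 ∂(timeProd P p.T) =
      (∫ q, 1 / (2 * p.ρ a) * (ξ q.1 q.2 - K q.1 q.2 - position u q.1 q.2) ^ 2 ∂(timeProd P p.T)) +
      -ε * (∫ q, 1 / p.ρ a * (ξ q.1 q.2 - K q.1 q.2 - position u q.1 q.2) *
      (H q.1 q.2 + position h q.1 q.2) ∂(timeProd P p.T)) +
      ε ^ 2 * ∫ q, 1 / (2 * p.ρ a) * (H q.1 q.2 + position h q.1 q.2) ^ 2 ∂(timeProd P p.T) := by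
    rw [← integral_add_const_mul_add_const_mul i4 i5 i6]
    refine integral_congr_ae ?_
    filter_upwards [hu.position_add_const_mul hh ε] with q hq
    rw [hq]
    field_simp
    ring
  simp only [Params.realGoal, Params.derivGoal, Params.quadGoal]
  rw [e1, e2, e3]
  ring

lemma Params.goal_eq_sub (h𝓕 : UsualConditions 𝓕 P) (hξ : MemS2 𝓕 P p.T ξ) (hv : MemL2 𝓕 P p.T v)
    (hA : IsDrift 𝓕 P p.T A) (hK : MemS2 𝓕 P p.T K) (hu : MemL2 𝓕 P p.T u) :
    p.goal P a ξ v A K u = ((p.realGoal a P ξ v A K u +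
      ∫ q, (p.lamA a).toReal / 2 * u q.1 q.2 ^ 2 ∂(timeProd P p.T) : ℝ) : EReal) -
      ((p.lamA a / 2 * ∫⁻ q, ENNReal.ofReal (u q.1 q.2 ^ 2) ∂(timeProd P p.T) : ℝ≥0∞) : EReal) := by
  have hpu := h𝓕.memLp_position hu
  have hy : MemLp (fun q : ℝ≥0 × Ω => ξ q.1 q.2 - K q.1 q.2 - position u q.1 q.2) 2
      (timeProd P p.T) := (hξ.sub hK).memL2.memLp.sub hpu
  have i1 : Integrable (fun q : ℝ≥0 × Ω =>
      p.lam * v q.1 q.2 * u q.1 q.2 + p.lam * p.m a * u q.1 q.2 ^ 2) (timeProd P p.T) :=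
    ((hv.const_mul p.lam).integrable_mul hu).add (hu.integrable_sq.const_mul _)
  have i2 : Integrable (fun q : ℝ≥0 × Ω =>
      1 / (2 * p.ρ a) * (ξ q.1 q.2 - K q.1 q.2 - position u q.1 q.2) ^ 2) (timeProd P p.T) :=
    hy.integrable_sq.const_mul _
  have i3 : Integrable (fun q : ℝ≥0 × Ω => (p.lamA a).toReal / 2 * u q.1 q.2 ^ 2)
      (timeProd P p.T) := hu.integrable_sq.const_mul _
  have hum : Measurable fun q : ℝ≥0 × Ω => u q.1 q.2 :=
    (stronglyMeasurable_uncurry_of_predictable hu.1).measurable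
  have hm : Measurable fun q : ℝ≥0 × Ω => ENNReal.ofReal (u q.1 q.2 ^ 2) :=
    (hum.pow_const 2).ennreal_ofReal
  have e1 : ∫⁻ ω, ∫⁻ t in Iic p.T, p.lamA a / 2 * ENNReal.ofReal (u t ω ^ 2) ∂leb ∂P =
      p.lamA a / 2 * ∫⁻ q, ENNReal.ofReal (u q.1 q.2 ^ 2) ∂(timeProd P p.T) := by
    rw [← lintegral_const_mul _ hm, timeProd, lintegral_prod_symm]
    exact (hm.const_mul _).aemeasurable
  have e2 : ∫ ω, (stieltjesIntegral p.T (fun t => K t ω) (fun t => A t ω) -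
      ∫ t in Iic p.T, (p.lam * v t ω * u t ω + p.lam * p.m a * u t ω ^ 2) ∂leb) ∂P =
      (∫ ω, stieltjesIntegral p.T (fun t => K t ω) (fun t => A t ω) ∂P) -
      ∫ q, (p.lam * v q.1 q.2 * u q.1 q.2 + p.lam * p.m a * u q.1 q.2 ^ 2) ∂(timeProd P p.T) := by
    rw [integral_timeProd i1]
    exact integral_sub (hA.integrable_stieltjesIntegral h𝓕 hK) i1.integral_prod_right
  have e3 : ∫ q, (p.lam * v q.1 q.2 * u q.1 q.2 +
      (p.lam * p.m a + (p.lamA a).toReal / 2) * u q.1 q.2 ^ 2) ∂(timeProd P p.T) =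
      (∫ q, (p.lam * v q.1 q.2 * u q.1 q.2 + p.lam * p.m a * u q.1 q.2 ^ 2) ∂(timeProd P p.T)) +
      ∫ q, (p.lamA a).toReal / 2 * u q.1 q.2 ^ 2 ∂(timeProd P p.T) := by
    rw [← integral_add i1 i3]
    exact integral_congr_ae (ae_of_all _ fun q => by ring)
  have e4 : ∫ ω, (∫ t in Iic p.T,
      1 / (2 * p.ρ a) * (ξ t ω - K t ω - position u t ω) ^ 2 ∂leb) ∂P =
      ∫ q, 1 / (2 * p.ρ a) * (ξ q.1 q.2 - K q.1 q.2 - position u q.1 q.2) ^ 2 ∂(timeProd P p.T) :=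
    (integral_timeProd i2).symm
  rw [Params.goal, e1, e2, e4, Params.realGoal, e3]
  congr 2
  ring

lemma Params.goal_eq_realGoal (h𝓕 : UsualConditions 𝓕 P) (hξ : MemS2 𝓕 P p.T ξ)
    (hv : MemL2 𝓕 P p.T v) (hA : IsDrift 𝓕 P p.T A) (hK : MemS2 𝓕 P p.T K) (hu : MemL2 𝓕 P p.T u)
    (hadm : p.lamA a = ∞ → ∀ᵐ q ∂(timeProd P p.T), u q.1 q.2 = 0) :
    p.goal P a ξ v A K u = p.realGoal a P ξ v A K u := by
  rw [p.goal_eq_sub a h𝓕 hξ hv hA hK hu]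
  have e : p.lamA a / 2 * ∫⁻ q, ENNReal.ofReal (u q.1 q.2 ^ 2) ∂(timeProd P p.T) =
      ENNReal.ofReal (∫ q, (p.lamA a).toReal / 2 * u q.1 q.2 ^ 2 ∂(timeProd P p.T)) := by
    rw [← ofReal_integral_eq_lintegral_ofReal hu.integrable_sq (ae_of_all _ fun q => sq_nonneg _),
      integral_const_mul, ENNReal.ofReal_mul (by positivity)]
    by_cases htop : p.lamA a = ∞
    · have h0 : ∫ q, u q.1 q.2 ^ 2 ∂(timeProd P p.T) = 0 :=
        integral_eq_zero_of_ae ((hadm htop).mono fun q hq => by simp [hq])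
      rw [h0]
      simp
    · rw [ENNReal.ofReal_div_of_pos two_pos, ENNReal.ofReal_toReal htop]
      simp
  rw [e, EReal.coe_ennreal_ofReal, max_eq_left (integral_nonneg fun q => by positivity),
    ← EReal.coe_sub, add_sub_cancel_right]

lemma Params.goal_eq_bot (h𝓕 : UsualConditions 𝓕 P) (hξ : MemS2 𝓕 P p.T ξ)
    (hv : MemL2 𝓕 P p.T v) (hA : IsDrift 𝓕 P p.T A) (hK : MemS2 𝓕 P p.T K) (hu : MemL2 𝓕 P p.T u)
    (htop : p.lamA a = ∞) (hu0 : ¬ ∀ᵐ q ∂(timeProd P p.T), u q.1 q.2 = 0) :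
    p.goal P a ξ v A K u = ⊥ := by
  have hum : Measurable fun q : ℝ≥0 × Ω => u q.1 q.2 :=
    (stronglyMeasurable_uncurry_of_predictable hu.1).measurable
  have hm : Measurable fun q : ℝ≥0 × Ω => ENNReal.ofReal (u q.1 q.2 ^ 2) :=
    (hum.pow_const 2).ennreal_ofReal
  have hne : ∫⁻ q, ENNReal.ofReal (u q.1 q.2 ^ 2) ∂(timeProd P p.T) ≠ 0 := by
    intro h0
    refine hu0 (((lintegral_eq_zero_iff hm).1 h0).mono fun q hq => ?_)
    have h1 : ENNReal.ofReal (u q.1 q.2 ^ 2) = 0 := hq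
    rw [ENNReal.ofReal_eq_zero] at h1
    exact pow_eq_zero_iff two_ne_zero |>.1 (le_antisymm h1 (sq_nonneg _))
  rw [p.goal_eq_sub a h𝓕 hξ hv hA hK hu, htop, ENNReal.top_div_of_ne_top (by simp),
    ENNReal.top_mul hne, EReal.coe_ennreal_top, EReal.sub_top]

/-- A linear term that is dominated by a quadratic one vanishes. -/
lemma eq_zero_of_forall_mul_le {L Q : ℝ} (h : ∀ ε : ℝ, ε * L - ε ^ 2 * Q ≤ 0) : L = 0 := by
  have h1 := h (L / (1 + |Q|))
  have hQ : 0 < 1 + |Q| := by positivity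
  have h2 : L / (1 + |Q|) * L - (L / (1 + |Q|)) ^ 2 * Q =
      L ^ 2 * ((1 + |Q|) - Q) / (1 + |Q|) ^ 2 := by
    field_simp
  rw [h2, div_le_iff₀ (by positivity), zero_mul] at h1
  have h3 : 1 ≤ (1 + |Q|) - Q := by linarith [le_abs_self Q]
  have h4 : L ^ 2 ≤ 0 := by nlinarith [sq_nonneg L]
  exact pow_eq_zero_iff two_ne_zero |>.1 (le_antisymm h4 (sq_nonneg L))

/-- Sufficiency of the first order conditions, by concavity. -/
theorem Params.goal_le_of_derivGoal_eq_zero (h𝓕 : UsualConditions 𝓕 P) (hξ : MemS2 𝓕 P p.T ξ)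
    (hv : MemL2 𝓕 P p.T v) (hA : IsDrift 𝓕 P p.T A) (hK : MemS2 𝓕 P p.T K) (hu : MemL2 𝓕 P p.T u)
    (hadm : p.lamA a = ∞ → ∀ᵐ q ∂(timeProd P p.T), u q.1 q.2 = 0)
    (hd : ∀ H h : ℝ≥0 → Ω → ℝ, MemS2 𝓕 P p.T H → MemL2 𝓕 P p.T h →
      (p.lamA a = ∞ → ∀ᵐ q ∂(timeProd P p.T), h q.1 q.2 = 0) → p.derivGoal a P ξ v A K u H h = 0)
    {K' u' : ℝ≥0 → Ω → ℝ} (hK' : MemS2 𝓕 P p.T K') (hu' : MemL2 𝓕 P p.T u') :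
    p.goal P a ξ v A K' u' ≤ p.goal P a ξ v A K u := by
  by_cases hadm' : p.lamA a = ∞ → ∀ᵐ q ∂(timeProd P p.T), u' q.1 q.2 = 0
  · rw [p.goal_eq_realGoal a h𝓕 hξ hv hA hK hu hadm, p.goal_eq_realGoal a h𝓕 hξ hv hA hK' hu' hadm',
      EReal.coe_le_coe_iff]
    have hH := hK'.sub hK
    have hh := hu'.sub hu
    have e := p.realGoal_add a h𝓕 hξ hv hA hK hu hH hh 1
    rw [hd _ _ hH hh fun htop => by
      filter_upwards [hadm htop, hadm' htop] with q h1 h2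
      rw [h1, h2, sub_self]] at e
    simp only [one_mul, add_sub_cancel] at e
    rw [e]
    have := p.quadGoal_nonneg a (P := P) (fun t ω => K' t ω - K t ω) (fun t ω => u' t ω - u t ω)
    linarith
  · rw [Classical.not_imp] at hadm'
    rw [p.goal_eq_bot a h𝓕 hξ hv hA hK' hu' hadm'.1 hadm'.2]
    exact bot_le

/-- An agent without access to the open market does not trade there. -/
theorem Params.ae_eq_zero_of_goal_le (h𝓕 : UsualConditions 𝓕 P) (hξ : MemS2 𝓕 P p.T ξ)
    (hv : MemL2 𝓕 P p.T v) (hA : IsDrift 𝓕 P p.T A) (hK : MemS2 𝓕 P p.T K) (hu : MemL2 𝓕 P p.T u)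
    (hmax : ∀ K' u' : ℝ≥0 → Ω → ℝ, MemS2 𝓕 P p.T K' → MemL2 𝓕 P p.T u' →
      p.goal P a ξ v A K' u' ≤ p.goal P a ξ v A K u) (htop : p.lamA a = ∞) :
    ∀ᵐ q ∂(timeProd P p.T), u q.1 q.2 = 0 := by
  by_contra hu0
  have h0 := MemS2.zero (𝓕 := 𝓕) (P := P) (T := p.T)
  have h1 := hmax _ _ h0 h0.memL2
  rw [p.goal_eq_bot a h𝓕 hξ hv hA hK hu htop hu0,
    p.goal_eq_realGoal a h𝓕 hξ hv hA h0 h0.memL2 fun _ => ae_of_all _ fun _ => rfl] at h1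
  exact absurd h1 (not_le.2 (EReal.bot_lt_coe _))

/-- Necessity of the first order conditions. -/
theorem Params.derivGoal_eq_zero_of_goal_le (h𝓕 : UsualConditions 𝓕 P) (hξ : MemS2 𝓕 P p.T ξ)
    (hv : MemL2 𝓕 P p.T v) (hA : IsDrift 𝓕 P p.T A) (hK : MemS2 𝓕 P p.T K) (hu : MemL2 𝓕 P p.T u)
    (hmax : ∀ K' u' : ℝ≥0 → Ω → ℝ, MemS2 𝓕 P p.T K' → MemL2 𝓕 P p.T u' →
      p.goal P a ξ v A K' u' ≤ p.goal P a ξ v A K u)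
    (hH : MemS2 𝓕 P p.T H) (hh : MemL2 𝓕 P p.T h)
    (hh0 : p.lamA a = ∞ → ∀ᵐ q ∂(timeProd P p.T), h q.1 q.2 = 0) :
    p.derivGoal a P ξ v A K u H h = 0 := by
  have hu0 := p.ae_eq_zero_of_goal_le a h𝓕 hξ hv hA hK hu hmax
  refine eq_zero_of_forall_mul_le (Q := p.quadGoal a P H h) fun ε => ?_
  have hK' := hK.add (hH.const_mul ε)
  have hu' := hu.add (hh.const_mul ε)
  have h1 := hmax _ _ hK' hu'
  rw [p.goal_eq_realGoal a h𝓕 hξ hv hA hK hu hu0, p.goal_eq_realGoal a h𝓕 hξ hv hA hK' hu'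
    (fun htop => by
      filter_upwards [hu0 htop, hh0 htop] with q h1 h2
      rw [h1, h2, mul_zero, add_zero]), EReal.coe_le_coe_iff,
    p.realGoal_add a h𝓕 hξ hv hA hK hu hH hh ε] at h1
  linarith

end

end

noncomputable section

variable {Ω : Type*} {mΩ : MeasurableSpace Ω} {P : Measure Ω} {𝓕 : Filtration ℝ≥0 mΩ} {T : ℝ≥0}

/-! ### The constants of the model -/

section

variable {𝒜 : Type*} (p : Params 𝒜)

lemma Params.friction_pos (a : 𝒜) : 0 < ENNReal.ofReal (p.m a * p.lam) + p.lamA a := by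
  have h := p.friction a
  rcases eq_or_ne (p.lamA a) 0 with h0 | h0
  · rw [h0, add_zero, ENNReal.ofReal_pos] at h
    exact add_pos_of_pos_of_nonneg (ENNReal.ofReal_pos.2 (mul_pos (p.m_pos a) h)) zero_le
  · exact (pos_iff_ne_zero.2 h0).trans_le le_add_self

lemma Params.η_nonneg (a : 𝒜) : 0 ≤ p.η a := ENNReal.toReal_nonneg

lemma Params.η_eq_zero {a : 𝒜} (h : p.lamA a = ∞) : p.η a = 0 := by simp [Params.η, h]

lemma Params.η_mul {a : 𝒜} (h : p.lamA a ≠ ∞) :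
    p.η a * (p.m a * p.lam + (p.lamA a).toReal) = 1 := by
  have h1 : (ENNReal.ofReal (p.m a * p.lam) + p.lamA a).toReal = p.m a * p.lam + (p.lamA a).toReal := by
    rw [ENNReal.toReal_add ENNReal.ofReal_ne_top h,
      ENNReal.toReal_ofReal (mul_nonneg (p.m_pos a).le p.lam_nonneg)]
  rw [Params.η, ENNReal.toReal_inv, ← h1]
  refine inv_mul_cancel₀ (ENNReal.toReal_pos (p.friction_pos a).ne' ?_).ne'
  exact ENNReal.add_ne_top.2 ⟨ENNReal.ofReal_ne_top, h⟩

variable [Fintype 𝒜]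

lemma Params.ηbar_pos : 0 < p.ηbar := by
  obtain ⟨a, ha⟩ := p.access
  refine Finset.sum_pos' (fun b _ => mul_nonneg (p.m_pos b).le (p.η_nonneg b)) ⟨a, Finset.mem_univ _, ?_⟩
  refine mul_pos (p.m_pos a) (lt_of_le_of_ne (p.η_nonneg a) fun h => ?_)
  have := p.η_mul ha.ne
  rw [← h, zero_mul] at this
  exact zero_ne_one this

/-- The shares `m(a) η^a / η̄` add up to `1`. -/
lemma Params.sum_share_mul (x : ℝ) : ∑ a, p.m a * (p.η a / p.ηbar * x) = x := by
  have h : ∀ a, p.m a * (p.η a / p.ηbar * x) = p.m a * p.η a * (x / p.ηbar) := fun a => by ring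
  simp only [h, ← Finset.sum_mul]
  rw [← Params.ηbar, mul_div_cancel₀ _ p.ηbar_pos.ne']

lemma Params.ρbar_pos : 0 < p.ρbar := by
  obtain ⟨a, -⟩ := p.access
  exact Finset.sum_pos (fun b _ => mul_pos (p.m_pos b) (p.ρ_pos b)) ⟨a, Finset.mem_univ _⟩

lemma Params.Δ_mul : p.Δ * p.ρbar * (1 + p.lam * p.ηbar) = p.ηbar := by
  have h1 := p.ηbar_pos
  have h2 := p.ρbar_pos
  have h3 := p.lam_nonneg
  rw [Params.Δ]
  split_ifs with h
  · rw [h]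
    field_simp
    ring
  · have h4 : 0 < p.lam := lt_of_le_of_ne h3 (Ne.symm h)
    have h5 : 1 / p.lam + p.ηbar ≠ 0 := by positivity
    field_simp

lemma Params.Δ_pos : 0 < p.Δ := by
  have h := p.Δ_mul
  have h1 := p.ηbar_pos
  have h2 : 0 < p.ρbar * (1 + p.lam * p.ηbar) :=
    mul_pos p.ρbar_pos (by have := mul_nonneg p.lam_nonneg h1.le; linarith)
  rw [mul_assoc] at h
  exact (mul_pos_iff_of_pos_right h2).1 (by rw [h]; exact h1)

end

/-! ### Uniqueness of the equilibrium -/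

section

variable {𝒜 : Type*} [Fintype 𝒜] {p : Params 𝒜}

lemma MemL2.agg {u : 𝒜 → ℝ≥0 → Ω → ℝ} (hu : ∀ a, MemL2 𝓕 P p.T (u a)) : MemL2 𝓕 P p.T (p.agg u) :=
  MemL2.sum _ fun a => (hu a).const_mul (p.m a)

lemma MemS2.agg {K : 𝒜 → ℝ≥0 → Ω → ℝ} (hK : ∀ a, MemS2 𝓕 P p.T (K a)) : MemS2 𝓕 P p.T (p.agg K) :=
  MemS2.sum _ fun a => (hK a).const_mul (p.m a)

variable {D : Ω → ℝ} {KN : ℝ≥0 → Ω → ℝ} {ξ K u : 𝒜 → ℝ≥0 → Ω → ℝ} {S A : ℝ≥0 → Ω → ℝ}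

variable [IsProbabilityMeasure P]

omit [Fintype 𝒜] in
/-- An absolutely continuous drift `∫₀ᵗ g_s ds` integrates test processes like `g dt`. -/
lemma IsRegularRate.integral_stieltjesIntegral_position {g H : ℝ≥0 → Ω → ℝ}
    (hg : IsRegularRate 𝓕 T g) (hg2 : MemL2 𝓕 P T g) (hH : MemS2 𝓕 P T H) :
    ∫ ω, stieltjesIntegral T (fun t => H t ω) (fun t => position g t ω) ∂P =
      ∫ q, g q.1 q.2 * H q.1 q.2 ∂(timeProd P T) := by
  rw [integral_timeProd (hg2.integrable_mul hH.memL2)]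
  obtain ⟨Z, -, hHZ⟩ := hH.2
  have hHm : ∀ ω, Measurable fun t => H t ω := fun ω =>
    (stronglyMeasurable_uncurry_of_predictable hH.1).measurable.comp measurable_prodMk_right
  refine integral_congr_ae ?_
  filter_upwards [hHZ] with ω h1
  rw [hg.stieltjesIntegral_position ω (hHm ω) ⟨_, h1⟩]
  simp only [mul_comm]

omit [Fintype 𝒜] in
/-- The first order condition of an agent in the dealer market: the drift integrates test processes
like `g dt`, where `g` is the marginal risk. -/
lemma Params.integral_stieltjesIntegral_eq (h𝓕 : UsualConditions 𝓕 P) (a : 𝒜)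
    {ξ v K u g H : ℝ≥0 → Ω → ℝ} (hξ : MemS2 𝓕 P p.T ξ) (hv : MemL2 𝓕 P p.T v)
    (hA : IsDrift 𝓕 P p.T A) (hK : MemS2 𝓕 P p.T K) (hu : MemL2 𝓕 P p.T u)
    (hmax : ∀ K' u' : ℝ≥0 → Ω → ℝ, MemS2 𝓕 P p.T K' → MemL2 𝓕 P p.T u' →
      p.goal P a ξ v A K' u' ≤ p.goal P a ξ v A K u)
    (hg : ∀ᵐ q ∂(timeProd P p.T),
      g q.1 q.2 = -(1 / p.ρ a * (ξ q.1 q.2 - K q.1 q.2 - position u q.1 q.2)))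
    (hH : MemS2 𝓕 P p.T H) :
    ∫ ω, stieltjesIntegral p.T (fun t => H t ω) (fun t => A t ω) ∂P =
      ∫ q, g q.1 q.2 * H q.1 q.2 ∂(timeProd P p.T) := by
  have h0 := (MemS2.zero (𝓕 := 𝓕) (P := P) (T := p.T)).memL2
  have h1 := p.derivGoal_eq_zero_of_goal_le a h𝓕 hξ hv hA hK hu hmax hH h0
    fun _ => ae_of_all _ fun _ => rfl
  have hp0 : ∀ t ω, position (fun (_ : ℝ≥0) (_ : Ω) => (0 : ℝ)) t ω = 0 := fun t ω => by
    simp [position]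
  simp only [Params.derivGoal, mul_zero, integral_zero, sub_zero, hp0, add_zero] at h1
  have h2 : ∫ q, 1 / p.ρ a * (ξ q.1 q.2 - K q.1 q.2 - position u q.1 q.2) * H q.1 q.2
      ∂(timeProd P p.T) = - ∫ q, g q.1 q.2 * H q.1 q.2 ∂(timeProd P p.T) := by
    rw [← integral_neg]
    refine integral_congr_ae ?_
    filter_upwards [hg] with q hq
    rw [hq]
    ring
  linarith

omit [Fintype 𝒜] in
/-- The first order condition of an agent in the open market. -/
lemma Params.integral_rate_mul_eq (h𝓕 : UsualConditions 𝓕 P) (a : 𝒜)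
    {ξ v K u g h : ℝ≥0 → Ω → ℝ} (hξ : MemS2 𝓕 P p.T ξ) (hv : MemL2 𝓕 P p.T v)
    (hA : IsDrift 𝓕 P p.T A) (hK : MemS2 𝓕 P p.T K) (hu : MemL2 𝓕 P p.T u)
    (hmax : ∀ K' u' : ℝ≥0 → Ω → ℝ, MemS2 𝓕 P p.T K' → MemL2 𝓕 P p.T u' →
      p.goal P a ξ v A K' u' ≤ p.goal P a ξ v A K u)
    (hg : ∀ᵐ q ∂(timeProd P p.T),
      g q.1 q.2 = -(1 / p.ρ a * (ξ q.1 q.2 - K q.1 q.2 - position u q.1 q.2)))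
    (hh : MemL2 𝓕 P p.T h) (htop : p.lamA a ≠ ∞) :
    ∫ q, (p.lam * v q.1 q.2 + (2 * p.lam * p.m a + (p.lamA a).toReal) * u q.1 q.2) * h q.1 q.2
      ∂(timeProd P p.T) = - ∫ q, g q.1 q.2 * position h q.1 q.2 ∂(timeProd P p.T) := by
  have h0 := MemS2.zero (𝓕 := 𝓕) (P := P) (T := p.T)
  have h1 := p.derivGoal_eq_zero_of_goal_le a h𝓕 hξ hv hA hK hu hmax h0 hh
    fun h => absurd h htop
  have h2 := p.integral_stieltjesIntegral_eq h𝓕 a hξ hv hA hK hu hmax hg h0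
  simp only [mul_zero, integral_zero] at h2
  simp only [Params.derivGoal, zero_add, h2] at h1
  have h3 : ∫ q, 1 / p.ρ a * (ξ q.1 q.2 - K q.1 q.2 - position u q.1 q.2) * position h q.1 q.2
      ∂(timeProd P p.T) = - ∫ q, g q.1 q.2 * position h q.1 q.2 ∂(timeProd P p.T) := by
    rw [← integral_neg]
    refine integral_congr_ae ?_
    filter_upwards [hg] with q hq
    rw [hq]
    ring
  linarith

/-- The drift rate that is determined by the aggregate position in the open market. -/
def Params.driftRate (p : Params 𝒜) (KN : ℝ≥0 → Ω → ℝ) (ξ u : 𝒜 → ℝ≥0 → Ω → ℝ) (t : ℝ≥0)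
    (ω : Ω) : ℝ :=
  1 / p.ρbar * (position (p.agg u) t ω - (KN t ω + p.agg ξ t ω))

/-- The first order conditions in equilibrium: all agents agree on the drift rate of the price, and
market clearing identifies it with the one determined by the aggregate position. -/
theorem Params.IsEquilibrium.exists_drift (h𝓕 : UsualConditions 𝓕 P)
    (hξ : ∀ a, MemS2 𝓕 P p.T (ξ a)) (he : p.IsEquilibrium 𝓕 P D KN ξ S K u) :
    ∃ M A g, IsDecomposition 𝓕 P p.T S M A ∧ MemS2 𝓕 P p.T g ∧
      (∀ᵐ q ∂(timeProd P p.T), g q.1 q.2 = p.driftRate KN ξ u q.1 q.2) ∧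
      (∀ᵐ ω ∂P, ∀ t ≤ p.T, A t ω = position g t ω) ∧
      (∀ a, ∀ᵐ q ∂(timeProd P p.T),
        K a q.1 q.2 = ξ a q.1 q.2 - position (u a) q.1 q.2 + p.ρ a * g q.1 q.2) ∧
      (∀ a, p.lamA a = ∞ → ∀ᵐ q ∂(timeProd P p.T), u a q.1 q.2 = 0) ∧
      ∀ a, p.lamA a ≠ ∞ → ∀ h, MemL2 𝓕 P p.T h →
        p.lam * (∫ q, p.agg u q.1 q.2 * h q.1 q.2 ∂(timeProd P p.T)) +
          (p.m a * p.lam + (p.lamA a).toReal) * (∫ q, u a q.1 q.2 * h q.1 q.2 ∂(timeProd P p.T)) =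
          - ∫ q, g q.1 q.2 * position h q.1 q.2 ∂(timeProd P p.T) := by
  obtain ⟨M, A, hdec, hnash⟩ := he.nash
  have hK := he.dealer
  have hu := he.rate
  have hA := hdec.drift
  have hagg : MemL2 𝓕 P p.T (p.agg u) := MemL2.agg hu
  have hv : ∀ a, MemL2 𝓕 P p.T fun t ω => p.agg u t ω - p.m a * u a t ω := fun a =>
    hagg.sub ((hu a).const_mul _)
  have hGex : ∀ a, ∃ G, MemS2 𝓕 P p.T G ∧ ∀ᵐ q ∂(timeProd P p.T), G q.1 q.2 =
      -(1 / p.ρ a * (ξ a q.1 q.2 - K a q.1 q.2 - position (u a) q.1 q.2)) := by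
    intro a
    obtain ⟨U, hU, hUu⟩ := h𝓕.exists_memS2_position (hu a)
    refine ⟨_, (((hξ a).sub (hK a)).sub hU).const_mul (-(1 / p.ρ a)), ?_⟩
    filter_upwards [ae_timeProd_of_ae (p := fun t ω => U t ω = position (u a) t ω) hUu] with q hq
    simp only [hq]
    ring
  choose G hG2 hGe using hGex
  have hGi : ∀ a H, MemS2 𝓕 P p.T H →
      ∫ ω, stieltjesIntegral p.T (fun t => H t ω) (fun t => A t ω) ∂P =
        ∫ q, G a q.1 q.2 * H q.1 q.2 ∂(timeProd P p.T) := fun a H hH =>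
    p.integral_stieltjesIntegral_eq h𝓕 a (hξ a) (hv a) hA (hK a) (hu a) (hnash a) (hGe a) hH
  have hGG : ∀ a b, ∀ᵐ q ∂(timeProd P p.T), G a q.1 q.2 = G b q.1 q.2 := by
    intro a b
    have hd := (hG2 a).sub (hG2 b)
    have h1 : ∫ q, (G a q.1 q.2 - G b q.1 q.2) ^ 2 ∂(timeProd P p.T) = 0 := by
      have h2 := integral_sub ((hG2 a).memL2.integrable_mul hd.memL2)
        ((hG2 b).memL2.integrable_mul hd.memL2)
      rw [← hGi a _ hd, ← hGi b _ hd, sub_self] at h2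
      rw [← h2]
      refine integral_congr_ae (ae_of_all _ fun q => ?_)
      simp only
      ring
    filter_upwards [hd.memL2.ae_eq_zero h1] with q hq
    exact sub_eq_zero.1 hq
  obtain ⟨a₀, -⟩ := p.access
  have hKa : ∀ a, ∀ᵐ q ∂(timeProd P p.T),
      K a q.1 q.2 = ξ a q.1 q.2 - position (u a) q.1 q.2 + p.ρ a * G a₀ q.1 q.2 := by
    intro a
    filter_upwards [hGe a, hGG a a₀] with q h1 h2
    have := (p.ρ_pos a).ne'
    rw [← h2, h1]
    field_simp
    ring
  have hga : ∀ a, ∀ᵐ q ∂(timeProd P p.T), G a₀ q.1 q.2 =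
      -(1 / p.ρ a * (ξ a q.1 q.2 - K a q.1 q.2 - position (u a) q.1 q.2)) := by
    intro a
    filter_upwards [hGe a, hGG a a₀] with q h1 h2
    rw [← h2, h1]
  refine ⟨M, A, G a₀, hdec, hG2 a₀, ?_, ?_, hKa, fun a => ?_, fun a htop h hh => ?_⟩
  · have hclear := ae_timeProd_of_ae (p := fun t ω => KN t ω + p.agg K t ω = 0) he.clearing
    have hpos := position_sum hu p.m
    filter_upwards [eventually_countable_forall.2 hKa, hclear, hpos] with q h1 h2 h3
    have h4 : position (p.agg u) q.1 q.2 = ∑ a, p.m a * position (u a) q.1 q.2 := h3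
    have h5 : p.agg K q.1 q.2 = p.agg ξ q.1 q.2 - position (p.agg u) q.1 q.2 +
        p.ρbar * G a₀ q.1 q.2 := by
      rw [h4, Params.ρbar, Finset.sum_mul]
      simp only [Params.agg]
      rw [← Finset.sum_sub_distrib, ← Finset.sum_add_distrib]
      exact Finset.sum_congr rfl fun a _ => by rw [h1 a]; ring
    have h6 := p.ρbar_pos.ne'
    rw [Params.driftRate, one_div, eq_inv_mul_iff_mul_eq₀ h6]
    linarith
  · obtain ⟨g, hg, hg2, hgG, hpg⟩ := h𝓕.exists_isRegularRate_of_memL2 (hG2 a₀).memL2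
    have h1 := hA.ae_eq_of_integral_eq h𝓕 (hg.isDrift_position hg2) fun H hH => by
      rw [hGi a₀ H hH, hg.integral_stieltjesIntegral_position hg2 hH]
      exact integral_congr_ae ((ae_timeProd_of_ae (p := fun t ω => g t ω = G a₀ t ω) hgG).mono
        fun q hq => by simp only [hq])
    filter_upwards [h1, hpg] with ω h2 h3 t ht
    rw [h2 t ht, h3 t ht]
  · exact p.ae_eq_zero_of_goal_le a h𝓕 (hξ a) (hv a) hA (hK a) (hu a) (hnash a)
  · rw [← p.integral_rate_mul_eq h𝓕 a (hξ a) (hv a) hA (hK a) (hu a) (hnash a) (hga a) hh htop,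
      ← integral_const_mul, ← integral_const_mul,
      ← integral_add ((hagg.integrable_mul hh).const_mul _) (((hu a).integrable_mul hh).const_mul _)]
    refine integral_congr_ae (ae_of_all _ fun q => ?_)
    simp only
    ring

omit [IsProbabilityMeasure P] in
/-- The weak form of the linear equation for the aggregate rate, from the first order conditions of
all agents. -/
lemma integral_agg_mul_eq {g h : ℝ≥0 → Ω → ℝ}
    (hu : ∀ a, MemL2 𝓕 P p.T (u a)) (hh : MemL2 𝓕 P p.T h)
    (hg : ∀ᵐ q ∂(timeProd P p.T), g q.1 q.2 = p.driftRate KN ξ u q.1 q.2)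
    (h0 : ∀ a, p.lamA a = ∞ → ∀ᵐ q ∂(timeProd P p.T), u a q.1 q.2 = 0)
    (h1 : ∀ a, p.lamA a ≠ ∞ →
        p.lam * (∫ q, p.agg u q.1 q.2 * h q.1 q.2 ∂(timeProd P p.T)) +
          (p.m a * p.lam + (p.lamA a).toReal) * (∫ q, u a q.1 q.2 * h q.1 q.2 ∂(timeProd P p.T)) =
          - ∫ q, g q.1 q.2 * position h q.1 q.2 ∂(timeProd P p.T)) :
    ∫ q, p.agg u q.1 q.2 * h q.1 q.2 ∂(timeProd P p.T) =
      - ∫ q, p.Δ * (position (p.agg u) q.1 q.2 - (KN q.1 q.2 + p.agg ξ q.1 q.2)) *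
        position h q.1 q.2 ∂(timeProd P p.T) := by
  set I := ∫ q, p.agg u q.1 q.2 * h q.1 q.2 ∂(timeProd P p.T) with hI
  set G := ∫ q, g q.1 q.2 * position h q.1 q.2 ∂(timeProd P p.T) with hG
  have h2 : ∀ a, p.m a * (∫ q, u a q.1 q.2 * h q.1 q.2 ∂(timeProd P p.T)) =
      -(p.m a * p.η a) * (G + p.lam * I) := by
    intro a
    by_cases htop : p.lamA a = ∞
    · have : ∫ q, u a q.1 q.2 * h q.1 q.2 ∂(timeProd P p.T) = 0 :=
        integral_eq_zero_of_ae ((h0 a htop).mono fun q hq => by simp [hq])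
      rw [this, p.η_eq_zero htop]
      ring
    · linear_combination (p.m a * p.η a) * h1 a htop -
        (p.m a * ∫ q, u a q.1 q.2 * h q.1 q.2 ∂(timeProd P p.T)) * p.η_mul htop
  have h3 : I = ∑ a, p.m a * ∫ q, u a q.1 q.2 * h q.1 q.2 ∂(timeProd P p.T) := by
    simp only [hI, Params.agg, Finset.sum_mul, mul_assoc]
    rw [integral_finsetSum _ fun a _ => ((hu a).integrable_mul hh).const_mul (p.m a)]
    simp only [integral_const_mul]
  have h4 : I = -p.ηbar * (G + p.lam * I) := by
    conv_lhs => rw [h3]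
    simp only [h2, ← Finset.sum_mul, Params.ηbar, Finset.sum_neg_distrib]
  have h5 : ∫ q, p.Δ * (position (p.agg u) q.1 q.2 - (KN q.1 q.2 + p.agg ξ q.1 q.2)) *
        position h q.1 q.2 ∂(timeProd P p.T) = p.Δ * p.ρbar * G := by
    rw [hG, ← integral_const_mul]
    refine integral_congr_ae ?_
    filter_upwards [hg] with q hq
    have := p.ρbar_pos.ne'
    rw [hq, Params.driftRate]
    field_simp
  rw [h5]
  have h6 : 0 < 1 + p.lam * p.ηbar := by
    have := mul_nonneg p.lam_nonneg p.ηbar_pos.le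
    linarith
  refine mul_right_cancel₀ h6.ne' ?_
  linear_combination h4 + G * p.Δ_mul

/-- The equilibrium is unique. -/
theorem Params.IsEquilibrium.unique (h𝓕 : UsualConditions 𝓕 P) (hKN : MemS2 𝓕 P p.T KN)
    (hξ : ∀ a, MemS2 𝓕 P p.T (ξ a)) (he : p.IsEquilibrium 𝓕 P D KN ξ S K u)
    {S' : ℝ≥0 → Ω → ℝ} {K' u' : 𝒜 → ℝ≥0 → Ω → ℝ} (he' : p.IsEquilibrium 𝓕 P D KN ξ S' K' u') :
    (∀ᵐ ω ∂P, ∀ t ≤ p.T, S' t ω = S t ω) ∧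
      ∀ a, (∀ᵐ q ∂(timeProd P p.T), K' a q.1 q.2 = K a q.1 q.2) ∧
        ∀ᵐ q ∂(timeProd P p.T), u' a q.1 q.2 = u a q.1 q.2 := by
  obtain ⟨M, A, g, hdec, hg2, hg, hA, hK, hu0, hu1⟩ := he.exists_drift h𝓕 hξ
  obtain ⟨M', A', g', hdec', hg2', hg', hA', hK', hu0', hu1'⟩ := he'.exists_drift h𝓕 hξ
  have hX : MemL2 𝓕 P p.T fun t ω => KN t ω + p.agg ξ t ω := (hKN.add (MemS2.agg hξ)).memL2
  have hagg : ∀ᵐ q ∂(timeProd P p.T), p.agg u' q.1 q.2 = p.agg u q.1 q.2 :=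
    ae_eq_of_integral_mul_eq h𝓕 p.Δ_pos hX (MemL2.agg he'.rate) (MemL2.agg he.rate)
      (fun h hh => integral_agg_mul_eq he'.rate hh hg' hu0' fun a ha => hu1' a ha h hh)
      fun h hh => integral_agg_mul_eq he.rate hh hg hu0 fun a ha => hu1 a ha h hh
  have hgg : ∀ᵐ q ∂(timeProd P p.T), g' q.1 q.2 = g q.1 q.2 := by
    have := ae_timeProd_of_ae (p := fun t ω => position (p.agg u') t ω = position (p.agg u) t ω)
      (position_eq_of_ae_eq hagg)
    filter_upwards [hg, hg', this] with q h1 h2 h3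
    rw [h1, h2, Params.driftRate, Params.driftRate, h3]
  have huu : ∀ a, ∀ᵐ q ∂(timeProd P p.T), u' a q.1 q.2 = u a q.1 q.2 := by
    intro a
    by_cases htop : p.lamA a = ∞
    · filter_upwards [hu0 a htop, hu0' a htop] with q h1 h2
      rw [h1, h2]
    · have hd := (he'.rate a).sub (he.rate a)
      set h : ℝ≥0 → Ω → ℝ := fun t ω => u' a t ω - u a t ω with hh
      have e1 := hu1 a htop h hd
      have e2 := hu1' a htop h hd
      have e3 : ∫ q, p.agg u' q.1 q.2 * h q.1 q.2 ∂(timeProd P p.T) =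
          ∫ q, p.agg u q.1 q.2 * h q.1 q.2 ∂(timeProd P p.T) :=
        integral_congr_ae (hagg.mono fun q hq => by simp only [hq])
      have e4 : ∫ q, g' q.1 q.2 * position h q.1 q.2 ∂(timeProd P p.T) =
          ∫ q, g q.1 q.2 * position h q.1 q.2 ∂(timeProd P p.T) :=
        integral_congr_ae (hgg.mono fun q hq => by simp only [hq])
      have e5 : ∫ q, h q.1 q.2 ^ 2 ∂(timeProd P p.T) =
          (∫ q, u' a q.1 q.2 * h q.1 q.2 ∂(timeProd P p.T)) -
          ∫ q, u a q.1 q.2 * h q.1 q.2 ∂(timeProd P p.T) := by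
        rw [← integral_sub ((he'.rate a).integrable_mul hd) ((he.rate a).integrable_mul hd)]
        refine integral_congr_ae (ae_of_all _ fun q => ?_)
        simp only [hh]
        ring
      have e6 : ∫ q, h q.1 q.2 ^ 2 ∂(timeProd P p.T) = 0 := by
        rw [e5]
        rw [e3, e4] at e2
        linear_combination p.η a * (e2 - e1) -
          ((∫ q, u' a q.1 q.2 * h q.1 q.2 ∂(timeProd P p.T)) -
          ∫ q, u a q.1 q.2 * h q.1 q.2 ∂(timeProd P p.T)) * p.η_mul htop
      filter_upwards [hd.ae_eq_zero e6] with q hq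
      exact sub_eq_zero.1 hq
  have hAA : ∀ᵐ ω ∂P, ∀ t ≤ p.T, A' t ω = A t ω := by
    filter_upwards [hA, hA', position_eq_of_ae_eq hgg] with ω h1 h2 h3 t ht
    rw [h1 t ht, h2 t ht, h3 t ht]
  refine ⟨?_, fun a => ⟨?_, huu a⟩⟩
  · have hMT : M' p.T =ᵐ[P] M p.T := by
      filter_upwards [hdec.eq, hdec'.eq, he.terminal, he'.terminal, hAA] with ω h1 h2 h3 h4 h5
      have a1 := h1 p.T le_rfl
      have a2 := h2 p.T le_rfl
      have a3 := h5 p.T le_rfl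
      linarith
    have hMM : ∀ᵐ ω ∂P, ∀ t ≤ p.T, M' t ω = M t ω := by
      refine ae_forall_eq_of_forall_ae_eq (hdec'.mart.cadlag.mono fun ω h t => (h t).1)
        (hdec.mart.cadlag.mono fun ω h t => (h t).1) fun t ht => ?_
      exact (hdec'.mart.martingale.condExp_ae_eq ht).symm.trans
        ((condExp_congr_ae hMT).trans (hdec.mart.martingale.condExp_ae_eq ht))
    filter_upwards [hdec.eq, hdec'.eq, hAA, hMM] with ω h1 h2 h3 h4 t ht
    rw [h1 t ht, h2 t ht, h3 t ht, h4 t ht]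
  · have hp : ∀ᵐ q ∂(timeProd P p.T), position (u' a) q.1 q.2 = position (u a) q.1 q.2 :=
      ae_timeProd_of_ae (p := fun t ω => position (u' a) t ω = position (u a) t ω)
        (position_eq_of_ae_eq (huu a))
    filter_upwards [hK a, hK' a, hgg, hp] with q h1 h2 h3 h4
    rw [h1, h2, h3, h4]

end

end

noncomputable section

variable {Ω : Type*} {mΩ : MeasurableSpace Ω} {P : Measure Ω} {𝓕 : Filtration ℝ≥0 mΩ} {T : ℝ≥0}

/-! ### Existence of the equilibrium -/

section

variable [IsProbabilityMeasure P] {𝒜 : Type*} [Fintype 𝒜] {p : Params 𝒜}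
variable {D : Ω → ℝ} {KN : ℝ≥0 → Ω → ℝ} {ξ : 𝒜 → ℝ≥0 → Ω → ℝ}

/-- The first order conditions hold if the aggregate rate `w` solves the linear equation, the agent
trades at the share `η^a / η̄` of it, and the drift rate `g` is the marginal risk of the agent. -/
lemma Params.derivGoal_eq_zero (h𝓕 : UsualConditions 𝓕 P) (a : 𝒜) {X w g ζ K H h : ℝ≥0 → Ω → ℝ}
    (hX : MemL2 𝓕 P p.T X) (hw : IsRegularRate 𝓕 p.T w) (hw2 : MemL2 𝓕 P p.T w)
    (hs : IsFBSDESolution 𝓕 P p.T p.Δ X w (position w))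
    (hg : IsRegularRate 𝓕 p.T g) (hg2 : MemL2 𝓕 P p.T g)
    (hgX : ∀ᵐ q ∂(timeProd P p.T),
      g q.1 q.2 = 1 / p.ρbar * (position w q.1 q.2 - X q.1 q.2))
    (hK : ∀ᵐ q ∂(timeProd P p.T),
      K q.1 q.2 = ζ q.1 q.2 - p.η a / p.ηbar * position w q.1 q.2 + p.ρ a * g q.1 q.2)
    (hH : MemS2 𝓕 P p.T H) (hh : MemL2 𝓕 P p.T h)
    (h0 : p.lamA a = ∞ → ∀ᵐ q ∂(timeProd P p.T), h q.1 q.2 = 0) :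
    p.derivGoal a P ζ (fun t ω => w t ω - p.m a * (p.η a / p.ηbar * w t ω)) (position g) K
      (fun t ω => p.η a / p.ηbar * w t ω) H h = 0 := by
  have hpos : MemLp (fun q : ℝ≥0 × Ω => position h q.1 q.2) 2 (timeProd P p.T) :=
    h𝓕.memLp_position hh
  have hηbar := p.ηbar_pos
  have hρ := p.ρ_pos a
  have hρbar := p.ρbar_pos
  have e3 : ∫ q, 1 / p.ρ a * (ζ q.1 q.2 - K q.1 q.2 -
        position (fun t ω => p.η a / p.ηbar * w t ω) q.1 q.2) * (H q.1 q.2 + position h q.1 q.2)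
        ∂(timeProd P p.T) =
      - ((∫ q, g q.1 q.2 * H q.1 q.2 ∂(timeProd P p.T)) +
        ∫ q, g q.1 q.2 * position h q.1 q.2 ∂(timeProd P p.T)) := by
    have i2 : Integrable (fun q : ℝ≥0 × Ω => g q.1 q.2 * position h q.1 q.2) (timeProd P p.T) :=
      MemLp.integrable_mul hg2.memLp hpos
    rw [← integral_add (hg2.integrable_mul hH.memL2) i2, ← integral_neg]
    refine integral_congr_ae ?_
    filter_upwards [hK] with q hq
    rw [hq, position_const_mul]
    field_simp
    ring
  have e2 : ∫ q, (p.lam * (w q.1 q.2 - p.m a * (p.η a / p.ηbar * w q.1 q.2)) +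
        (2 * p.lam * p.m a + (p.lamA a).toReal) * (p.η a / p.ηbar * w q.1 q.2)) * h q.1 q.2
        ∂(timeProd P p.T) = - ∫ q, g q.1 q.2 * position h q.1 q.2 ∂(timeProd P p.T) := by
    by_cases htop : p.lamA a = ∞
    · have hp : ∀ᵐ q ∂(timeProd P p.T), position h q.1 q.2 = 0 := by
        have h1 := position_eq_of_ae_eq (u := h) (v := fun _ _ => (0 : ℝ)) (h0 htop)
        filter_upwards [ae_timeProd_of_ae
          (p := fun t ω => position h t ω = position (fun _ _ => (0 : ℝ)) t ω) h1] with q hq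
        rw [hq]
        simp [position]
      rw [integral_eq_zero_of_ae ((h0 htop).mono fun q hq => by simp [hq]),
        integral_eq_zero_of_ae (hp.mono fun q hq => by simp [hq]), neg_zero]
    · have hfac : (p.lam + 1 / p.ηbar) * (p.Δ * p.ρbar) = 1 := by
        have := p.Δ_mul
        field_simp
        linear_combination this
      have e4 : ∀ q : ℝ≥0 × Ω, (p.lam * (w q.1 q.2 - p.m a * (p.η a / p.ηbar * w q.1 q.2)) +
          (2 * p.lam * p.m a + (p.lamA a).toReal) * (p.η a / p.ηbar * w q.1 q.2)) * h q.1 q.2 =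
          (p.lam + 1 / p.ηbar) * (w q.1 q.2 * h q.1 q.2) := fun q => by
        linear_combination (w q.1 q.2 * h q.1 q.2 / p.ηbar) * p.η_mul htop
      have e5 : ∫ q, p.Δ * (position w q.1 q.2 - X q.1 q.2) * position h q.1 q.2
          ∂(timeProd P p.T) =
          (p.Δ * p.ρbar) * ∫ q, g q.1 q.2 * position h q.1 q.2 ∂(timeProd P p.T) := by
        rw [← integral_const_mul]
        refine integral_congr_ae ?_
        filter_upwards [hgX] with q hq
        rw [hq]
        field_simp
      simp only [e4]
      rw [integral_const_mul, hs.integral_mul_eq h𝓕 hX (hw.memS2_position hw2).memL2 hh, e5]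
      linear_combination (- ∫ q, g q.1 q.2 * position h q.1 q.2 ∂(timeProd P p.T)) * hfac
  rw [Params.derivGoal, e3, e2, hg.integral_stieltjesIntegral_position hg2 hH]
  ring

omit [Fintype 𝒜] in
/-- A càdlàg price with drift rate `g` and terminal value `D`. -/
lemma UsualConditions.exists_price (h𝓕 : UsualConditions 𝓕 P)
    (hD : StronglyMeasurable[𝓕 T] D)
    (hD2 : MemLp D 2 P) {g : ℝ≥0 → Ω → ℝ} (hg : IsRegularRate 𝓕 T g) (hg2 : MemL2 𝓕 P T g) :
    ∃ M, IsDecomposition 𝓕 P T (fun t ω => M t ω + position g t ω) M (position g) ∧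
      (fun ω => M T ω + position g T ω) =ᵐ[P] D ∧
      ∀ t ≤ T, (fun ω => M t ω + position g t ω) =ᵐ[P]
        P[fun ω => D ω - ∫ s in Ioc t T, g s ω ∂leb | 𝓕 t] := by
  have hm : ∀ t, StronglyMeasurable[𝓕 t] (position g t) :=
    hg.predictable_position.stronglyAdapted
  have hA2 : ∀ t ≤ T, MemLp (position g t) 2 P := fun t ht =>
    (hg.memS2_position hg2).memLp_apply ht
  have hY2 : MemLp (fun ω => D ω - position g T ω) 2 P := hD2.sub (hA2 T le_rfl)
  obtain ⟨M, hM, hcad, hMY⟩ := h𝓕.exists_cadlag_condExp (hY2.integrable one_le_two)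
  have hMT : M T =ᵐ[P] fun ω => D ω - position g T ω := by
    refine (hMY T).trans ?_
    exact (condExp_of_stronglyMeasurable (f := fun ω => D ω - position g T ω) (𝓕.le T)
      (hD.sub (hm T)) (hY2.integrable one_le_two)).eventuallyEq
  refine ⟨M, ⟨⟨hM, ae_of_all _ hcad, (memLp_congr_ae hMT).2 hY2⟩, hg.isDrift_position hg2,
    ae_of_all _ fun ω t _ => rfl⟩, ?_, fun t ht => ?_⟩
  · filter_upwards [hMT] with ω hω
    rw [hω]
    ring
  · have e : (fun ω => D ω - ∫ s in Ioc t T, g s ω ∂leb) =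
        (fun ω => D ω - position g T ω) + position g t := by
      ext ω
      rw [← hg.position_sub ht ω]
      simp only [Pi.add_apply]
      ring
    rw [e]
    have h1 := condExp_add (hY2.integrable one_le_two) ((hA2 t ht).integrable one_le_two) (𝓕 t)
    rw [condExp_of_stronglyMeasurable (𝓕.le t) (hm t) ((hA2 t ht).integrable one_le_two)] at h1
    filter_upwards [h1, hMY t] with ω h2 h3
    rw [h2, Pi.add_apply, h3]

/-- The equilibrium that corresponds to a solution `w` of the linear equation. -/
theorem Params.exists_isEquilibrium (h𝓕 : UsualConditions 𝓕 P)
    (hD : StronglyMeasurable[𝓕 p.T] D) (hD2 : MemLp D 2 P) (hKN : MemS2 𝓕 P p.T KN)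
    (hξ : ∀ a, MemS2 𝓕 P p.T (ξ a)) {w : ℝ≥0 → Ω → ℝ} (hw : IsRegularRate 𝓕 p.T w)
    (hw2 : MemL2 𝓕 P p.T w)
    (hs : IsFBSDESolution 𝓕 P p.T p.Δ (fun t ω => KN t ω + p.agg ξ t ω) w (position w)) :
    ∃ S : ℝ≥0 → Ω → ℝ,
      p.IsEquilibrium 𝓕 P D KN ξ S
        (fun a t ω => ξ a t ω - p.η a / p.ηbar * position w t ω +
            p.ρ a / p.ρbar * (position w t ω - KN t ω - p.agg ξ t ω))
        (fun a t ω => p.η a / p.ηbar * w t ω) ∧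
      ∀ t ≤ p.T, S t =ᵐ[P] P[fun ω => D ω - ∫ s in Ioc t p.T,
        1 / p.ρbar * (position w s ω - KN s ω - p.agg ξ s ω) ∂leb | 𝓕 t] := by
  have hηbar := p.ηbar_pos
  have hρbar := p.ρbar_pos
  have hU := hw.memS2_position hw2
  have hX : MemS2 𝓕 P p.T fun t ω => KN t ω + p.agg ξ t ω := hKN.add (MemS2.agg hξ)
  have hG : MemS2 𝓕 P p.T fun t ω => 1 / p.ρbar * (position w t ω - KN t ω - p.agg ξ t ω) :=
    ((hU.sub hKN).sub (MemS2.agg hξ)).const_mul _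
  obtain ⟨g, hg, hg2, hgG, -⟩ := h𝓕.exists_isRegularRate_of_memL2 hG.memL2
  obtain ⟨M, hdec, hterm, hprice⟩ := h𝓕.exists_price hD hD2 hg hg2
  have hgG' := ae_timeProd_of_ae
    (p := fun t ω => g t ω = 1 / p.ρbar * (position w t ω - KN t ω - p.agg ξ t ω)) hgG
  have hagg := p.sum_share_mul
  have hu : ∀ a, MemL2 𝓕 P p.T fun t ω => p.η a / p.ηbar * w t ω := fun a => hw2.const_mul _
  have haggw : p.agg (fun a t ω => p.η a / p.ηbar * w t ω) = w := by
    ext t ω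
    exact hagg _
  have hK : ∀ a, MemS2 𝓕 P p.T fun t ω => ξ a t ω - p.η a / p.ηbar * position w t ω +
      p.ρ a / p.ρbar * (position w t ω - KN t ω - p.agg ξ t ω) := fun a =>
    ((hξ a).sub (hU.const_mul _)).add (((hU.sub hKN).sub (MemS2.agg hξ)).const_mul _)
  refine ⟨_, ⟨⟨M, _, hdec⟩, hterm, hK, hu, ?_, M, _, hdec, fun a K' u' hK' hu' => ?_⟩,
    fun t ht => (hprice t ht).trans (condExp_congr_ae ?_)⟩
  · refine ae_of_all _ fun ω t _ => ?_
    have h1 : ∀ y, ∑ a, p.m a * (ξ a t ω - p.η a / p.ηbar * position w t ω + p.ρ a / p.ρbar * y) =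
        p.agg ξ t ω - (∑ a, p.m a * (p.η a / p.ηbar * position w t ω)) +
          (∑ a, p.m a * p.ρ a) * (y / p.ρbar) := fun y => by
      rw [Finset.sum_mul, Params.agg, ← Finset.sum_sub_distrib, ← Finset.sum_add_distrib]
      exact Finset.sum_congr rfl fun a _ => by ring
    have h2 := h1 (position w t ω - KN t ω - p.agg ξ t ω)
    rw [hagg, ← Params.ρbar, mul_div_cancel₀ _ hρbar.ne'] at h2
    rw [Params.agg, h2]
    ring
  · rw [haggw]
    refine p.goal_le_of_derivGoal_eq_zero a h𝓕 (hξ a) (hw2.sub ((hu a).const_mul _)) hdec.drift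
      (hK a) (hu a) (fun h => ae_of_all _ fun q => ?_) (fun H h hH hh h0 => ?_) hK' hu'
    · simp only [p.η_eq_zero h, zero_div, zero_mul]
    · refine Params.derivGoal_eq_zero h𝓕 a hX.memL2 hw hw2 hs hg hg2 ?_ ?_ hH hh h0
      · filter_upwards [hgG'] with q hq
        rw [hq]
        ring
      · filter_upwards [hgG'] with q hq
        rw [hq]
        ring
  · filter_upwards [hgG] with ω h1
    rw [setIntegral_congr_fun measurableSet_Ioc fun s hs => h1 s hs.2]

end

end

end DealerMarket

theorem theorem1 {Ω : Type*} {mΩ : MeasurableSpace Ω} (P : Measure Ω) [IsProbabilityMeasure P]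
    (𝓕 : Filtration ℝ≥0 mΩ) (h𝓕 : DealerMarket.UsualConditions 𝓕 P)
    {𝒜 : Type*} [Fintype 𝒜] (p : DealerMarket.Params 𝒜)
    (D : Ω → ℝ) (hD : StronglyMeasurable[𝓕 p.T] D) (hD2 : MemLp D 2 P)
    (KN : ℝ≥0 → Ω → ℝ) (hKN : DealerMarket.MemS2 𝓕 P p.T KN)
    (ξ : 𝒜 → ℝ≥0 → Ω → ℝ) (hξ : ∀ a, DealerMarket.MemS2 𝓕 P p.T (ξ a)) :
    ∃ (S : ℝ≥0 → Ω → ℝ) (K u : 𝒜 → ℝ≥0 → Ω → ℝ),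
      -- an equilibrium exists
      p.IsEquilibrium 𝓕 P D KN ξ S K u ∧
      -- and it is unique
      (∀ (S' : ℝ≥0 → Ω → ℝ) (K' u' : 𝒜 → ℝ≥0 → Ω → ℝ), p.IsEquilibrium 𝓕 P D KN ξ S' K' u' →
        (∀ᵐ ω ∂P, ∀ t ≤ p.T, S' t ω = S t ω) ∧
        ∀ a, (∀ᵐ q ∂(DealerMarket.timeProd P p.T), K' a q.1 q.2 = K a q.1 q.2) ∧
          ∀ᵐ q ∂(DealerMarket.timeProd P p.T), u' a q.1 q.2 = u a q.1 q.2) ∧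
      ∃ (Ubar μ : ℝ≥0 → Ω → ℝ),
        Ubar = p.agg (fun a => DealerMarket.position (u a)) ∧
        μ = (fun t ω => 1 / p.ρbar * (Ubar t ω - KN t ω - p.agg ξ t ω)) ∧
        -- the aggregate position in the open market
        0 < p.Δ ∧
        DealerMarket.IsExplicitSolution 𝓕 P p.T p.Δ (fun t ω => KN t ω + p.agg ξ t ω) Ubar ∧
        DealerMarket.IsFBSDESolution 𝓕 P p.T p.Δ (fun t ω => KN t ω + p.agg ξ t ω)
          (p.agg u) Ubar ∧
        -- the individual shares
        (∀ a, ∀ᵐ ω ∂P, ∀ t ≤ p.T,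
          DealerMarket.position (u a) t ω = p.η a / p.ηbar * Ubar t ω) ∧
        -- the price
        (∀ t ≤ p.T, S t =ᵐ[P] P[fun ω => D ω - ∫ s in Ioc t p.T, μ s ω ∂DealerMarket.leb | 𝓕 t]) ∧
        -- the positions in the dealer market
        ∀ a, ∀ᵐ ω ∂P, ∀ t ≤ p.T,
          K a t ω = ξ a t ω - p.η a / p.ηbar * Ubar t ω +
            p.ρ a / p.ρbar * (Ubar t ω - KN t ω - p.agg ξ t ω) := by
  obtain ⟨w, hw, hw2, hexp, hs⟩ := h𝓕.exists_solution p.Δ_pos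
    (hKN.add (DealerMarket.MemS2.agg hξ)).memL2
  obtain ⟨S, he, hS⟩ := p.exists_isEquilibrium h𝓕 hD hD2 hKN hξ hw hw2 hs
  have hu : p.agg (fun a t ω => p.η a / p.ηbar * w t ω) = w := by
    ext t ω
    exact p.sum_share_mul _
  have hU : p.agg (fun a => DealerMarket.position fun t ω => p.η a / p.ηbar * w t ω) =
      DealerMarket.position w := by
    ext t ω
    simp only [DealerMarket.position_const_mul]
    exact p.sum_share_mul _
  refine ⟨S, _, _, he, fun S' K' u' he' => he.unique h𝓕 hKN hξ he', _, _, hU.symm, rfl, p.Δ_pos,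
    hexp, ?_, fun a => ?_, hS, fun a => ?_⟩
  · rw [hu]
    exact hs
  · refine ae_of_all _ fun ω t _ => ?_
    rw [DealerMarket.position_const_mul]
  · exact ae_of_all _ fun ω t _ => rfl
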